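/- All $\mathrm{C}^*$-algebras and $*$-homomorphisms are unital. For a $\mathrm{C}^*$-algebra $C$ and a nonprincipal ultrafilter $\mathcal U$ on $\mathbb N$, the ultrapower $C^{\mathcal U}$ is the quotient of $\ell^\infty(\mathbb N,C)$ by the ideal of sequences $(A_m)$ with $\lim_{\mathcal U}\|A_m\|=0$. $C$ is \emph{locally universal} if every nonzero separable $\mathrm{C}^*$-algebra embeds into such an ultrapower of $C$. The \emph{Kirchberg Embedding Problem} (KEP) has a positive solution if the Cuntz algebra $\mathcal O_2=C^*\langle s_1,s_2\mid s_i^*s_j=\delta_{ij}1,\ s_1s_1^*+s_2s_2^*=1\rangle$ is locally universal. A \emph{presentation} of $C$ is a sequence $(a_m)_{m\in\mathbb N}$ that generates $C$; it is \emph{computable} if there is an algorithm which, given a rational $*$-polynomial $p$ (noncommutative, coefficients in $\mathbb Q(i)$) and $j\in\mathbb N$, returns a rational $q$ with $\big|\,\|p(a_1,a_2,\dots)\|-q\,\big|<2^{-j}$. A \emph{nonlocal game} $\mathfrak G=(\pi,D)$ with $n$ questions and $k$ answers is a probability distribution $\pi$ on $[n]\times[n]$ with a predicate $D:[n]\times[n]\times[k]\times[k]\to\{0,1\}$.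 A \emph{$\mathfrak G$-strategy} in $C$ is a tuple $\sigma=(A,B,\phi)$, where for all $x,y\in[n]$ the families $(A^x_a)_{a\in[k]}$ and $(B^y_b)_{b\in[k]}$ are POVMs in $C$ (positive elements with sum $1$) and $\phi$ is a state on $C$. With $A\bullet B:=\frac12(A^{1/2}BA^{1/2}+B^{1/2}AB^{1/2})$, put $$\operatorname{val}(\mathfrak G,\sigma)=\sum_{x,y}\pi(x,y)\sum_{a,b}D(x,y,a,b)\,\phi(A^x_a\bullet B^y_b).$$ $\sigma$ is \emph{$\delta$-op-almost commuting} if $\sum_{a,b}\|[A^x_a,B^y_b]\|<\delta$ for all $x,y$. Let $\operatorname{val}^{co}_{\delta,\mathrm{op}}(\mathfrak G)$ be the supremum of $\operatorname{val}(\mathfrak G,\sigma)$ over all $\delta$-op-almost commuting strategies in $\mathcal B(\mathcal H)$, over all Hilbert spaces $\mathcal H$ ($0$ if there are none). For $\delta:\mathbb N\to[0,1]$, a language $L\subseteq\{0,1\}^{<\mathbb N}$ is in $\operatorname{MIP}^{co}_{\delta,\mathrm{op}}$ if there is an efficient mapping $z\mapsto\mathfrak G_z$ from bit strings to nonlocal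 games such that $\operatorname{val}^{co}_{\delta(|z|),\mathrm{op}}(\mathfrak G_z)=1$ if $z\in L$ and $\operatorname{val}^{co}_{\delta(|z|),\mathrm{op}}(\mathfrak G_z)\le\frac12$ if $z\notin L$. Here \emph{efficient} means: the numbers $n_z,k_z$ and a number $N_z$ are computable from $z$, in binary, in polynomial time; the distribution $\pi_z$ is the distribution of $S(z,s)$ for $s$ uniform in $\{0,\dots,N_z-1\}$, with $S$ computable in polynomial time; and $(z,x,y,a,b)\mapsto D_z(x,y,a,b)$ is computable in polynomial time. \textbf{Theorem.} If there is a locally universal $\mathrm{C}^*$-algebra that has a computable presentation, then for every computable function $\delta:\mathbb N\to[0,1]$ (its values are computable reals, uniformly in the argument), every language in $\operatorname{MIP}^{co}_{\delta,\mathrm{op}}$ is recursively enumerable. Moreover, if KEP has a positive solution, then there is a locally universal $\mathrm{C}^*$-algebra that has a computable presentation. -/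

import Mathlib

open Filter Topology BoundedContinuousFunction

noncomputable section

namespace KEP

/-! ## Ultrapowers and locally universal algebras -/

section Ultrapower

variable (U : Ultrafilter ℕ) (C : Type*) [CStarAlgebra C]

/-- The ideal of `ℓ^∞(ℕ, C)` of those bounded sequences whose norms tend to `0` along `U`.
Since `ℕ` is discrete, `ℕ →ᵇ C` is the algebra of all bounded sequences. -/
def nullIdeal : Ideal (ℕ →ᵇ C) where
  carrier := {x | Tendsto (fun m => ‖x m‖) (U : Filter ℕ) (𝓝 0)}
  zero_mem' := by simp
  add_mem' := by
    intro x y hx hy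
    refine squeeze_zero (fun m => norm_nonneg _) (fun m => norm_add_le (x m) (y m)) ?_
    simpa using Tendsto.add hx hy
  smul_mem' := by
    intro c x hx
    refine squeeze_zero (fun m => norm_nonneg _) (g := fun m => ‖c‖ * ‖x m‖) (fun m => ?_) ?_
    · exact (norm_mul_le (c m) (x m)).trans
        (mul_le_mul_of_nonneg_right (c.norm_coe_le_norm m) (norm_nonneg _))
    · simpa using Tendsto.const_mul ‖c‖ hx

instance : (nullIdeal U C).IsTwoSided where
  mul_mem_of_left := by
    intro x c hx
    refine squeeze_zero (fun m => norm_nonneg _) (g := fun m => ‖x m‖ * ‖c‖) (fun m => ?_) ?_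
    · exact (norm_mul_le (x m) (c m)).trans
        (mul_le_mul_of_nonneg_left (c.norm_coe_le_norm m) (norm_nonneg _))
    · simpa using Tendsto.mul_const ‖c‖ hx

theorem star_mem_nullIdeal {x : ℕ →ᵇ C} (hx : x ∈ nullIdeal U C) : star x ∈ nullIdeal U C := by
  change Tendsto (fun m => ‖star (x m)‖) (U : Filter ℕ) (𝓝 0)
  simp only [norm_star]
  exact hx

/-- The ultrapower `C^U`, as a unital complex `*`-algebra. -/
abbrev Ultrapower : Type _ := (ℕ →ᵇ C) ⧸ nullIdeal U C

/-- The involution of the ultrapower: `((A_m)_U)^* = (A_m^*)_U`. -/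
instance : Star (Ultrapower U C) where
  star := Quotient.map' star (by
    intro x y h
    rw [Submodule.quotientRel_def] at h ⊢
    rw [← star_sub]
    exact star_mem_nullIdeal U C h)

@[simp] theorem star_mk (x : ℕ →ᵇ C) :
    star (Ideal.Quotient.mk (nullIdeal U C) x) = Ideal.Quotient.mk (nullIdeal U C) (star x) :=
  rfl

instance : StarRing (Ultrapower U C) where
  star_involutive := by
    intro x
    obtain ⟨x, rfl⟩ := Ideal.Quotient.mk_surjective x
    simp
  star_mul := by
    intro x y
    obtain ⟨x, rfl⟩ := Ideal.Quotient.mk_surjective x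
    obtain ⟨y, rfl⟩ := Ideal.Quotient.mk_surjective y
    simp [← map_mul]
  star_add := by
    intro x y
    obtain ⟨x, rfl⟩ := Ideal.Quotient.mk_surjective x
    obtain ⟨y, rfl⟩ := Ideal.Quotient.mk_surjective y
    simp [← map_add]

end Ultrapower

/-- `C` is locally universal: every (nonzero, unital) separable C*-algebra admits a unital
embedding into an ultrapower of `C` with respect to a nonprincipal ultrafilter on `ℕ`.
(Every separable C*-algebra is isomorphic to one whose underlying type lies in `Type`.) -/
def LocallyUniversal (C : Type*) [CStarAlgebra C] : Prop :=
  ∀ (A : Type) [CStarAlgebra A] [Nontrivial A] [TopologicalSpace.SeparableSpace A],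
    ∃ U : Ultrafilter ℕ, (U : Filter ℕ) ≤ cofinite ∧
      ∃ φ : A →⋆ₐ[ℂ] Ultrapower U C, Function.Injective φ

/-! ## The Cuntz algebra and the Kirchberg Embedding Problem -/

/-- The relations `s i ^* s j = δ_ij`, `∑ s i s i ^* = 1` of the Cuntz algebra `O₂`. -/
def CuntzRelations {B : Type*} [CStarAlgebra B] (s : Fin 2 → B) : Prop :=
  (∀ i j, star (s i) * s j = if i = j then 1 else 0) ∧ ∑ i, s i * star (s i) = 1

/-- `(O, s)` is the universal C*-algebra `O₂ = C*⟨s₁, s₂ | s_i^* s_j = δ_ij, ∑ s_i s_i^* = 1⟩`. -/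
structure IsCuntzAlgebraTwo (O : Type) [CStarAlgebra O] (s : Fin 2 → O) : Prop where
  relations : CuntzRelations s
  existsUnique_hom : ∀ (B : Type) [CStarAlgebra B] (t : Fin 2 → B), CuntzRelations t →
    ∃! φ : O →⋆ₐ[ℂ] B, ∀ i, φ (s i) = t i

/-- The positive solution of the Kirchberg Embedding Problem: `O₂` is locally universal. -/
def KirchbergEmbedding : Prop :=
  ∃ (O : Type) (_ : CStarAlgebra O) (s : Fin 2 → O), IsCuntzAlgebraTwo O s ∧ LocallyUniversal O

/-! ## Computable reals and computable presentations -/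

/-- Codes for rational numbers: `(a, b, c)` codes `(a - b) / (c + 1)`. -/
abbrev RatCode : Type := ℕ × ℕ × ℕ

/-- The rational number with a given code, as a real number. -/
def RatCode.val (q : RatCode) : ℝ := ((q.1 : ℝ) - (q.2.1 : ℝ)) / ((q.2.2 : ℝ) + 1)

/-- A sequence of real numbers is computable if its terms can be computed, uniformly, to any
prescribed precision. -/
def IsComputableRealSeq (δ : ℕ → ℝ) : Prop :=
  ∃ f : ℕ × ℕ → RatCode, Computable f ∧ ∀ n k, |δ n - (f (n, k)).val| < (2 : ℝ)⁻¹ ^ k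

/-- Codes for rational `*`-polynomials in noncommuting indeterminates `X₀, X₁, …`: lists of terms
consisting of a coefficient in `ℚ(i)` (real and imaginary part) and a word in the letters
`(i, false)` for `X_i` and `(i, true)` for `X_i^*`. The empty word stands for the unit. -/
abbrev RatStarPoly : Type := List ((RatCode × RatCode) × List (ℕ × Bool))

section Presentation

variable {C : Type*} [CStarAlgebra C]

/-- The value of a word at a sequence of elements. -/
def evalWord (a : ℕ → C) (w : List (ℕ × Bool)) : C :=
  (w.map fun l => if l.2 then star (a l.1) else a l.1).prod

/-- The value of a rational `*`-polynomial at a sequence of elements. -/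
def RatStarPoly.eval (a : ℕ → C) (p : RatStarPoly) : C :=
  (p.map fun t => (⟨t.1.1.val, t.1.2.val⟩ : ℂ) • evalWord a t.2).sum

/-- The sequence `a` is a presentation of `C`: it generates `C` as a unital C*-algebra. -/
def IsPresentation (a : ℕ → C) : Prop :=
  (StarAlgebra.adjoin ℂ (Set.range a)).topologicalClosure = ⊤

/-- The presentation given by `a` is computable: an algorithm approximates the norms of rational
points to any prescribed precision. -/
def IsComputablePresentation (a : ℕ → C) : Prop :=
  IsPresentation a ∧ ∃ f : RatStarPoly × ℕ → RatCode, Computable f ∧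
    ∀ p k, |‖p.eval a‖ - (f (p, k)).val| < (2 : ℝ)⁻¹ ^ k

end Presentation

/-- There is a locally universal C*-algebra that has a computable presentation. -/
def ExistsLocallyUniversalComputable : Prop :=
  ∃ (C : Type) (_ : CStarAlgebra C),
    LocallyUniversal C ∧ ∃ a : ℕ → C, IsComputablePresentation a

/-! ## Nonlocal games and strategies -/

/-- A nonlocal game with `n` questions and `k` answers: a probability distribution on pairs of
questions and a decision predicate `D x y a b`. -/
structure NonlocalGame where
  /-- number of questions -/
  n : ℕ
  /-- number of answers -/
  k : ℕ
  /-- probability of a pair of questions -/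
  prob : Fin n → Fin n → ℝ
  prob_nonneg : ∀ x y, 0 ≤ prob x y
  sum_prob : ∑ x, ∑ y, prob x y = 1
  /-- decision predicate -/
  D : Fin n → Fin n → Fin k → Fin k → Bool

section Strategies

variable {C : Type*} [CStarAlgebra C]

/-- A POVM of length `k` in a C*-algebra: positive elements that add up to `1`. -/
def IsPOVM {k : ℕ} (A : Fin k → C) : Prop :=
  (∀ a, ∃ z : C, A a = star z * z) ∧ ∑ a, A a = 1

/-- The positive square root, by the continuous functional calculus. -/
def sqrt (A : C) : C := cfc Real.sqrt A

/-- `A • B = (A^{1/2} B A^{1/2} + B^{1/2} A B^{1/2}) / 2`. -/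
def symProd (A B : C) : C :=
  (2⁻¹ : ℂ) • (sqrt A * B * sqrt A + sqrt B * A * sqrt B)

/-- States: positive linear functionals that map `1` to `1`. -/
def IsState (φ : C →ₗ[ℂ] ℂ) : Prop :=
  (∀ z : C, 0 ≤ (φ (star z * z)).re ∧ (φ (star z * z)).im = 0) ∧ φ 1 = 1

end Strategies

/-- A `𝔊`-measurement in `C`: a POVM of length `k` for every question. -/
def IsMeasurement (𝔊 : NonlocalGame) {C : Type*} [CStarAlgebra C]
    (A : Fin 𝔊.n → Fin 𝔊.k → C) : Prop :=
  ∀ x, IsPOVM (A x)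

/-- A `𝔊`-strategy in `C`: two measurements and a state. -/
structure Strategy (𝔊 : NonlocalGame) (C : Type*) [CStarAlgebra C] where
  /-- Alice's measurements -/
  A : Fin 𝔊.n → Fin 𝔊.k → C
  /-- Bob's measurements -/
  B : Fin 𝔊.n → Fin 𝔊.k → C
  /-- the state -/
  φ : C →ₗ[ℂ] ℂ
  isMeasurement_A : IsMeasurement 𝔊 A
  isMeasurement_B : IsMeasurement 𝔊 B
  isState : IsState φ

namespace Strategy

variable {𝔊 : NonlocalGame} {C : Type*} [CStarAlgebra C]

/-- The correlation `p_σ(a, b | x, y) = φ(A^x_a • B^y_b)`, a real number. -/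
def corr (σ : Strategy 𝔊 C) (x y : Fin 𝔊.n) (a b : Fin 𝔊.k) : ℝ :=
  (σ.φ (symProd (σ.A x a) (σ.B y b))).re

/-- The value of `𝔊` when playing according to `σ`. -/
def value (σ : Strategy 𝔊 C) : ℝ :=
  ∑ x, ∑ y, 𝔊.prob x y * ∑ a, ∑ b, (if 𝔊.D x y a b then 1 else 0) * σ.corr x y a b

/-- `σ` is `δ`-op-almost commuting. -/
def OpAlmostCommuting (δ : ℝ) (σ : Strategy 𝔊 C) : Prop :=
  ∀ x y, ∑ a, ∑ b, ‖σ.A x a * σ.B y b - σ.B y b * σ.A x a‖ < δ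

end Strategy

/-- The `δ,op`-commuting value: the supremum of the values of the `δ`-op-almost commuting
strategies in `B(H)`, over all Hilbert spaces `H`. -/
def opCommutingValue (δ : ℝ) (𝔊 : NonlocalGame) : ℝ :=
  sSup {v : ℝ | ∃ (H : Type) (_ : NormedAddCommGroup H) (_ : InnerProductSpace ℂ H)
    (_ : CompleteSpace H) (σ : Strategy 𝔊 (H →L[ℂ] H)), σ.OpAlmostCommuting δ ∧ v = σ.value}

/-! ## The complexity class -/

open Computability in
/-- `f` is computed by a multi-stack Turing machine in time polynomial in the length of the input,
with respect to the given encodings of inputs and outputs by strings. -/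
def PolyTime {α β Γ₁ Γ₂ : Type} (ea : Encoding α Γ₁) (eb : Encoding β Γ₂) (f : α → β) : Prop :=
  Nonempty (Turing.TM2ComputableInPolyTime ea.encode eb.encode f)

open Computability in
/-- An efficient mapping from sequences of bits `z` to nonlocal games, in the sense of polynomial
time verifiers: the parameters `n`, `k` and the number `N` of seeds are computed from `z`, in
binary, in polynomial time; the pair of questions is `sampler (z, s)` for a uniformly random seed
`s < N`, where `sampler` runs in polynomial time; and the decision predicate runs in polynomial
time. Since `prob` has total mass one, `N` is positive and all sampled questions are in range. -/
def IsEfficient (𝔊 : List Bool → NonlocalGame) : Prop :=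
  ∃ (N : List Bool → ℕ) (sampler : List Bool × ℕ → ℕ × ℕ)
    (decider : List Bool × ℕ × ℕ × ℕ × ℕ → Bool),
    PolyTime (encodingList Bool)
      (encodingProd encodingNatBool (encodingProd encodingNatBool encodingNatBool))
      (fun z => ((𝔊 z).n, (𝔊 z).k, N z)) ∧
    PolyTime (encodingProd (encodingList Bool) encodingNatBool)
      (encodingProd encodingNatBool encodingNatBool) sampler ∧
    PolyTime (encodingProd (encodingList Bool) (encodingProd encodingNatBool
      (encodingProd encodingNatBool (encodingProd encodingNatBool encodingNatBool))))
      encodingBoolBool decider ∧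
    (∀ z (x y : Fin (𝔊 z).n), (𝔊 z).prob x y =
      (((Finset.range (N z)).filter fun s => sampler (z, s) = ((x : ℕ), (y : ℕ))).card : ℝ)
        / (N z : ℝ)) ∧
    ∀ z (x y : Fin (𝔊 z).n) (a b : Fin (𝔊 z).k),
      (𝔊 z).D x y a b = decider (z, (x : ℕ), (y : ℕ), (a : ℕ), (b : ℕ))

/-- The class `MIP^co_{δ,op}` of languages. -/
def MIPcoDeltaOp (δ : ℕ → ℝ) : Set (Set (List Bool)) :=
  {L | ∃ 𝔊 : List Bool → NonlocalGame, IsEfficient 𝔊 ∧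
    (∀ z ∈ L, opCommutingValue (δ z.length) (𝔊 z) = 1) ∧
    ∀ z ∉ L, opCommutingValue (δ z.length) (𝔊 z) ≤ 1 / 2}

end KEP

end

/-! Both halves reduce to norms of rational `*`-polynomials.

Games. Let `W` be the sum, over the `N` seeds of the sampler and the winning answer pairs, of
A^{1/2} B A^{1/2} + B^{1/2} A B^{1/2}. A strategy with state φ has value φ(W)/(2N), and `W` is
positive, so some state gives a value above 1/2 exactly when ‖W‖ > N. This removes the state.
Writing A = (c^*c)^2 makes positivity automatic and turns A^{1/2} = c^*c into a polynomial. The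
existence of an almost commuting strategy of value above 1/2 becomes a finite system of strict
inequalities between norms of `*`-polynomials, with a slack ε (`IsApproxStrategy`). Strict
inequalities are an open condition. A solution in B(H) lies in a separable subalgebra; an embedding
of that into an ultrapower of a locally universal `C` moves it to a coordinate in `C`, because norms
in the ultrapower are limits of norms (`IsApproxStrategy.exists_of_locallyUniversal`); from there it
moves to rational points of a presentation (`IsApproxStrategy.exists_rational`). If norms are
computable, a search over rational points and ε therefore succeeds for every z in the language.
Conversely, a solution in `C` is corrected to genuine POVMs at a cost covered by the slack, and GNS
carries the strategy to a Hilbert space. The value then exceeds 1/2, so z is in the language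
(`IsApproxStrategy.lt_opCommutingValue`). That the game data are computable follows by simulating
the Turing machines (`PolyTime.computable`).

The Cuntz algebra. For n ≥ 1 let U_n be the product of generators along the binary digits of n below
the leading one. For each l the projections U_n U_n^* with 2^l ≤ n < 2^(l+1) sum to 1. Away from
small n, words act on the U_n as they act on the basis of ℓ²(ℕ) under s_i e_n = e_{2n+i}. Let T be
the matrix of a polynomial h in that representation. Summing over `N` levels, N h equals ∑ T_{nm}
U_n U_m^* up to an error bounded independently of `N`. If the compression of q - T to these levels
is G^*G, the same sum formed with q - T is ∑ v_k v_k^* ≥ 0, so a positive h has ‖h‖ ≤ q + O(1/N)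
(`CuntzRelations.norm_eval_le`). Together with the universal property this identifies the norm in O₂
with the norm on ℓ²(ℕ). Finite matrices and vectors over the Gaussian rationals then certify upper
and lower bounds, and searching for both computes the norm. -/

noncomputable section

namespace KEP

/-! ## Computable functions: closure properties -/

section Computability

attribute [fun_prop] Computable

variable {α β γ δ σ : Type*} [Primcodable α] [Primcodable β] [Primcodable γ] [Primcodable δ]
  [Primcodable σ]

@[fun_prop] theorem computable_id : Computable fun x : α => x := Computable.id

@[fun_prop] theorem computable_const (b : β) : Computable fun _ : α => b := Computable.const b

@[fun_prop] theorem computable_comp {f : β → γ} {g : α → β} (hf : Computable f)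
    (hg : Computable g) : Computable fun x => f (g x) := hf.comp hg

@[fun_prop] theorem computable_pair {f : α → β} {g : α → γ} (hf : Computable f)
    (hg : Computable g) : Computable fun x => (f x, g x) := hf.pair hg

@[fun_prop] theorem computable_fst {f : α → β × γ} (hf : Computable f) :
    Computable fun x => (f x).1 := Computable.fst.comp hf

@[fun_prop] theorem computable_snd {f : α → β × γ} (hf : Computable f) :
    Computable fun x => (f x).2 := Computable.snd.comp hf

@[fun_prop] theorem computable_add {f g : α → ℕ} (hf : Computable f) (hg : Computable g) :
    Computable fun x => f x + g x := Computable₂.comp Primrec.nat_add.to_comp hf hg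

@[fun_prop] theorem computable_mul {f g : α → ℕ} (hf : Computable f) (hg : Computable g) :
    Computable fun x => f x * g x := Computable₂.comp Primrec.nat_mul.to_comp hf hg

@[fun_prop] theorem computable_sub {f g : α → ℕ} (hf : Computable f) (hg : Computable g) :
    Computable fun x => f x - g x := Computable₂.comp Primrec.nat_sub.to_comp hf hg

@[fun_prop] theorem computable_div {f g : α → ℕ} (hf : Computable f) (hg : Computable g) :
    Computable fun x => f x / g x := Computable₂.comp Primrec.nat_div.to_comp hf hg

@[fun_prop] theorem computable_mod {f g : α → ℕ} (hf : Computable f) (hg : Computable g) :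
    Computable fun x => f x % g x := Computable₂.comp Primrec.nat_mod.to_comp hf hg

@[fun_prop] theorem computable_bnot {f : α → Bool} (hf : Computable f) :
    Computable fun x => !f x := Computable.comp Primrec.not.to_comp hf

@[fun_prop] theorem computable_band {f g : α → Bool} (hf : Computable f) (hg : Computable g) :
    Computable fun x => f x && g x := Computable₂.comp Primrec.and.to_comp hf hg

@[fun_prop] theorem computable_bor {f g : α → Bool} (hf : Computable f) (hg : Computable g) :
    Computable fun x => f x || g x := Computable₂.comp Primrec.or.to_comp hf hg

@[fun_prop] theorem computable_decide_lt {f g : α → ℕ} (hf : Computable f) (hg : Computable g) :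
    Computable fun x => decide (f x < g x) := by
  obtain ⟨_, h⟩ := Primrec.nat_lt
  refine (Computable.comp h.to_comp (hf.pair hg)).of_eq fun a => ?_
  simp

@[fun_prop] theorem computable_decide_eq [DecidableEq β] {f g : α → β} (hf : Computable f)
    (hg : Computable g) : Computable fun x => decide (f x = g x) := by
  obtain ⟨_, h⟩ := Primrec.eq (α := β)
  refine (Computable.comp h.to_comp (hf.pair hg)).of_eq fun a => ?_
  simp

@[fun_prop] theorem computable_cond {c : α → Bool} {f g : α → β} (hc : Computable c)
    (hf : Computable f) (hg : Computable g) : Computable fun x => bif c x then f x else g x :=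
  hc.cond hf hg

@[fun_prop] theorem computable_ite {p : α → Prop} [DecidablePred p] {f g : α → β}
    (hc : Computable fun x => decide (p x)) (hf : Computable f) (hg : Computable g) :
    Computable fun x => if p x then f x else g x :=
  (hc.cond hf hg).of_eq fun a => by by_cases h : p a <;> simp [h]

@[fun_prop] theorem computable_some {f : α → β} (hf : Computable f) :
    Computable fun x => some (f x) := Computable.option_some.comp hf

@[fun_prop] theorem computable_cons {f : α → β} {g : α → List β} (hf : Computable f)
    (hg : Computable g) : Computable fun x => f x :: g x := Computable.list_cons.comp hf hg

@[fun_prop] theorem computable_append {f g : α → List β} (hf : Computable f)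
    (hg : Computable g) : Computable fun x => f x ++ g x := Computable.list_append.comp hf hg

@[fun_prop] theorem computable_reverse {f : α → List β} (hf : Computable f) :
    Computable fun x => (f x).reverse := Computable.list_reverse.comp hf

@[fun_prop] theorem computable_length {f : α → List β} (hf : Computable f) :
    Computable fun x => (f x).length := Computable.list_length.comp hf

@[fun_prop] theorem computable_getElem? {f : α → List β} {g : α → ℕ} (hf : Computable f)
    (hg : Computable g) : Computable fun x => (f x)[g x]? := Computable.list_getElem?.comp hf hg

@[fun_prop] theorem computable_option_getD {f : α → Option β} {g : α → β} (hf : Computable f)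
    (hg : Computable g) : Computable fun x => (f x).getD (g x) := Computable.option_getD hf hg

@[fun_prop] theorem computable_getD {f : α → List β} {g : α → ℕ} {d : α → β} (hf : Computable f)
    (hg : Computable g) (hd : Computable d) : Computable fun x => (f x).getD (g x) (d x) := by
  simp only [List.getD_eq_getElem?_getD]
  fun_prop

@[fun_prop] theorem computable_sum_inl {f : α → β} (hf : Computable f) :
    Computable fun x => (Sum.inl (f x) : β ⊕ γ) := Computable.sumInl.comp hf

@[fun_prop] theorem computable_sum_inr {f : α → γ} (hf : Computable f) :
    Computable fun x => (Sum.inr (f x) : β ⊕ γ) := Computable.sumInr.comp hf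

theorem computable_nat_rec {f : α → ℕ} {g : α → σ} {h : α × ℕ × σ → σ} (hf : Computable f)
    (hg : Computable g) (hh : Computable h) :
    Computable fun a => (Nat.rec (g a) (fun n s => h (a, n, s)) (f a) : σ) :=
  Computable.nat_rec hf hg (h := fun a p => h (a, p.1, p.2)) (by
    change Computable fun p : α × ℕ × σ => h (p.1, p.2.1, p.2.2)
    fun_prop)

theorem computable_iterate {f : α → ℕ} {g : α → σ} {h : α × σ → σ} (hf : Computable f)
    (hg : Computable g) (hh : Computable h) :
    Computable fun a => (fun s => h (a, s))^[f a] (g a) := by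
  refine (computable_nat_rec (h := fun p : α × ℕ × σ => h (p.1, p.2.2)) hf hg (by fun_prop)).of_eq fun a => ?_
  induction f a with
  | zero => rfl
  | succ n ih => rw [Function.iterate_succ_apply', ← ih]

@[fun_prop] theorem computable_pow {f g : α → ℕ} (hf : Computable f) (hg : Computable g) :
    Computable fun x => f x ^ g x := by
  refine (computable_nat_rec (g := fun _ => 1) (h := fun p : α × ℕ × ℕ => p.2.2 * f p.1) hg
    (by fun_prop) (by fun_prop)).of_eq fun a => ?_
  induction g a with
  | zero => rfl
  | succ n ih => rw [pow_succ, ← ih]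

theorem computable_option_elim {o : α → Option β} {f : α → σ} {g : α × β → σ}
    (ho : Computable o) (hf : Computable f) (hg : Computable g) :
    Computable fun a => (o a).elim (f a) fun b => g (a, b) :=
  (Computable.option_casesOn (g := fun a b => g (a, b)) ho hf hg).of_eq fun a => by
    cases o a <;> rfl

theorem computable_foldl {l : α → List β} {s : α → σ} {h : α × σ × β → σ} (hl : Computable l)
    (hs : Computable s) (hh : Computable h) :
    Computable fun a => (l a).foldl (fun s b => h (a, s, b)) (s a) := by
  have key := computable_nat_rec (f := fun a => (l a).length) (g := s)
    (h := fun p : α × ℕ × σ => ((l p.1)[p.2.1]?).elim p.2.2 fun b => h (p.1, p.2.2, b))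
    (by fun_prop) hs
    (computable_option_elim (g := fun p : (α × ℕ × σ) × β => h (p.1.1, p.1.2.2, p.2))
      (by fun_prop) (by fun_prop) (by fun_prop))
  refine key.of_eq fun a => ?_
  have main : ∀ n ≤ (l a).length, (Nat.rec (s a) (fun n t => ((l a)[n]?).elim t fun b => h (a, t, b)) n : σ) = ((l a).take n).foldl (fun s b => h (a, s, b)) (s a) := by
    intro n hn
    induction n with
    | zero => simp
    | succ n ih =>
      have hn' : n < (l a).length := hn
      rw [List.take_succ_eq_append_getElem hn', List.foldl_append, ← ih hn'.le]
      simp [List.getElem?_eq_getElem hn']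
  have := main _ le_rfl
  rwa [List.take_length] at this

theorem computable_flatMap {l : α → List β} {h : α × β → List σ} (hl : Computable l)
    (hh : Computable h) : Computable fun a => (l a).flatMap fun b => h (a, b) := by
  refine (computable_foldl (s := fun _ => []) (h := fun p => p.2.1 ++ h (p.1, p.2.2)) hl
    (by fun_prop) (by fun_prop)).of_eq fun a => ?_
  have : ∀ (l : List β) (s : List σ), l.foldl (fun s b => s ++ h (a, b)) s =
      s ++ l.flatMap fun b => h (a, b) := by
    intro l
    induction l with
    | nil => simp
    | cons b l ih => intro s; simp [ih]
  simpa using this (l a) []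

theorem computable_map {l : α → List β} {h : α × β → σ} (hl : Computable l)
    (hh : Computable h) : Computable fun a => (l a).map fun b => h (a, b) := by
  refine (computable_flatMap (h := fun p => [h p]) hl (by fun_prop)).of_eq fun a => ?_
  rw [List.map_eq_flatMap]

theorem computable_foldr {l : α → List β} {s : α → σ} {h : α × σ × β → σ} (hl : Computable l)
    (hs : Computable s) (hh : Computable h) :
    Computable fun a => (l a).foldr (fun b s => h (a, s, b)) (s a) := by
  refine (computable_foldl (l := fun a => (l a).reverse) (by fun_prop) hs hh).of_eq fun a => ?_
  rw [List.foldl_reverse]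

/-! ## Semidecidable predicates -/

/-- A predicate is semidecidable if it is the projection of a decidable one. -/
def SemiDecidable (p : α → Prop) : Prop :=
  ∃ g : α × ℕ → Bool, Computable g ∧ ∀ a, p a ↔ ∃ n, g (a, n) = true

theorem SemiDecidable.of_eq {p q : α → Prop} (hp : SemiDecidable p) (h : ∀ a, p a ↔ q a) :
    SemiDecidable q := by
  obtain rfl : p = q := funext fun a => propext (h a)
  exact hp

theorem SemiDecidable.of_computable {g : α → Bool} (hg : Computable g) :
    SemiDecidable fun a => g a = true :=
  ⟨fun p => g p.1, by fun_prop, fun a => by simp⟩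

theorem SemiDecidable.comp {p : β → Prop} {f : α → β} (hp : SemiDecidable p)
    (hf : Computable f) : SemiDecidable fun a => p (f a) := by
  obtain ⟨g, hg, h⟩ := hp
  exact ⟨fun q => g (f q.1, q.2), by fun_prop, fun a => h (f a)⟩

/-- A witness and the stage that confirms it are searched for together, as one natural number
decoded to a pair. -/
theorem SemiDecidable.exists {p : α × β → Prop} (hp : SemiDecidable p) :
    SemiDecidable fun a => ∃ b, p (a, b) := by
  obtain ⟨g, hg, h⟩ := hp
  have hd : Computable (Encodable.decode : ℕ → Option (β × ℕ)) := Primrec.decode.to_comp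
  refine ⟨fun q => (Encodable.decode q.2 : Option (β × ℕ)).elim false
      fun r => g ((q.1, r.1), r.2),
    computable_option_elim (g := fun p : (α × ℕ) × (β × ℕ) => g ((p.1.1, p.2.1), p.2.2))
      (by fun_prop) (by fun_prop) (by fun_prop), fun a => ⟨?_, ?_⟩⟩
  · rintro ⟨b, hb⟩
    obtain ⟨n, hn⟩ := (h _).1 hb
    exact ⟨Encodable.encode (b, n), by simpa using hn⟩
  · rintro ⟨n, hn⟩
    cases hdec : (Encodable.decode n : Option (β × ℕ)) with
    | none => simp [hdec] at hn
    | some r =>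
      simp only [hdec] at hn
      exact ⟨r.1, (h _).2 ⟨r.2, hn⟩⟩

theorem SemiDecidable.and {p q : α → Prop} (hp : SemiDecidable p) (hq : SemiDecidable q) :
    SemiDecidable fun a => p a ∧ q a := by
  obtain ⟨f, hf, h⟩ := hp
  obtain ⟨g, hg, h'⟩ := hq
  have := SemiDecidable.exists (β := ℕ × ℕ) (SemiDecidable.of_computable
    (g := fun r : α × ℕ × ℕ => f (r.1, r.2.1) && g (r.1, r.2.2)) (by fun_prop))
  refine this.of_eq fun a => ?_
  rw [h, h']
  simp

/-- Bounded conjunction of a Boolean sequence. -/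
theorem computable_rec_band {f : α → ℕ} {g : α × ℕ → Bool} (hf : Computable f)
    (hg : Computable g) : ∃ b : α → Bool, Computable b ∧
      ∀ a, b a = true ↔ ∀ i < f a, g (a, i) = true := by
  refine ⟨_, computable_nat_rec (g := fun _ => true) (h := fun p => p.2.2 && g (p.1, p.2.1)) hf
    (by fun_prop) (by fun_prop), fun a => ?_⟩
  induction f a with
  | zero => simp
  | succ n ih =>
    simp only [Bool.and_eq_true, Nat.lt_succ_iff_lt_or_eq, or_imp, forall_and, forall_eq]
    rw [← ih]

/-- The confirming stages of the finitely many indices are packed into one list, which becomes the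
single witness. -/
theorem SemiDecidable.forall_lt {p : α × ℕ → Prop} {m : α → ℕ} (hp : SemiDecidable p)
    (hm : Computable m) : SemiDecidable fun a => ∀ i < m a, p (a, i) := by
  obtain ⟨g, hg, h⟩ := hp
  obtain ⟨b, hb, hb'⟩ := computable_rec_band (α := α × List ℕ) (f := fun q => m q.1)
    (g := fun q => g ((q.1.1, q.2), q.1.2.getD q.2 0)) (by fun_prop) (by fun_prop)
  refine (SemiDecidable.of_computable hb).exists.of_eq fun a => ⟨?_, fun H => ?_⟩
  · rintro ⟨l, hl⟩ i hi
    exact (h _).2 ⟨_, (hb' _).1 hl i hi⟩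
  · have : ∀ i, ∃ n, i < m a → g ((a, i), n) = true := fun i => by
      by_cases hi : i < m a
      · obtain ⟨n, hn⟩ := (h _).1 (H i hi)
        exact ⟨n, fun _ => hn⟩
      · exact ⟨0, fun h => (hi h).elim⟩
    choose n hn using this
    refine ⟨(List.range (m a)).map n, (hb' _).2 fun i hi => ?_⟩
    have hi' : i < m a := hi
    simpa [List.getD_eq_getElem?_getD, hi'] using hn i hi'

/-- Unbounded search through codes of pairs (value, confirming stage); the existence hypothesis
makes the search halt on every input. -/
theorem SemiDecidable.exists_choice {p : α × β → Prop} (hp : SemiDecidable p)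
    (h : ∀ a, ∃ b, p (a, b)) : ∃ f : α → β, Computable f ∧ ∀ a, p (a, f a) := by
  obtain ⟨g, hg, hg'⟩ := hp
  have hd : Computable (Encodable.decode : ℕ → Option (β × ℕ)) := Primrec.decode.to_comp
  let G : α → ℕ → Option β := fun a n => (Encodable.decode n : Option (β × ℕ)).elim none
    fun r => bif g ((a, r.1), r.2) then some r.1 else none
  have hG : Computable₂ G :=
    computable_option_elim (α := α × ℕ) (o := fun q => (Encodable.decode q.2 : Option (β × ℕ)))
      (g := fun p : (α × ℕ) × (β × ℕ) =>
        bif g ((p.1.1, p.2.1), p.2.2) then some p.2.1 else none)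
      (by fun_prop) (by fun_prop) (by fun_prop)
  have hsound : ∀ a n b, G a n = some b → p (a, b) := by
    intro a n b hb
    cases hdec : (Encodable.decode n : Option (β × ℕ)) with
    | none => simp only [G, hdec, Option.elim_none, reduceCtorEq] at hb
    | some r =>
      cases hc : g ((a, r.1), r.2) with
      | false => simp only [G, hdec, hc, Option.elim_some, cond_false, reduceCtorEq] at hb
      | true =>
        simp only [G, hdec, hc, Option.elim_some, cond_true, Option.some.injEq] at hb
        subst hb
        exact (hg' _).2 ⟨_, hc⟩
  have hdom : ∀ a, (Nat.rfindOpt (G a)).Dom := by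
    intro a
    obtain ⟨b, hb⟩ := h a
    obtain ⟨n, hn⟩ := (hg' _).1 hb
    exact Nat.rfindOpt_dom.2 ⟨Encodable.encode (b, n), b, by simp [G, hn]⟩
  refine ⟨fun a => (Nat.rfindOpt _).get (hdom a), ?_, fun a => ?_⟩
  · exact Partrec.of_eq_tot (Partrec.rfindOpt hG) fun a => Part.get_mem _
  · obtain ⟨n, hn⟩ := Nat.rfindOpt_spec (Part.get_mem (hdom a))
    exact hsound a n _ hn

theorem SemiDecidable.rePred {p : α → Prop} (hp : SemiDecidable p) : REPred p := by
  obtain ⟨g, hg, h⟩ := hp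
  let G : α → ℕ →. Bool := fun a n => Part.some (g (a, n))
  have : Partrec fun a => Nat.rfind (G a) := Partrec.rfind (p := G) hg.partrec
  refine this.dom_re.of_eq fun a => ?_
  rw [h]
  refine Nat.rfind_dom.trans ⟨?_, ?_⟩
  · rintro ⟨n, hn, -⟩
    exact ⟨n, (Part.mem_some_iff.1 hn).symm⟩
  · rintro ⟨n, hn⟩
    exact ⟨n, Part.mem_some_iff.2 hn.symm, fun _ => trivial⟩

end Computability

end KEP

end

noncomputable section

namespace KEP

/-! ## Arithmetic of rational codes -/

namespace RatCode

/-- Sum of rational codes. -/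
def add (p q : RatCode) : RatCode :=
  (p.1 * (q.2.2 + 1) + q.1 * (p.2.2 + 1), p.2.1 * (q.2.2 + 1) + q.2.1 * (p.2.2 + 1),
    p.2.2 * q.2.2 + p.2.2 + q.2.2)

/-- Product of rational codes. -/
def mul (p q : RatCode) : RatCode :=
  (p.1 * q.1 + p.2.1 * q.2.1, p.1 * q.2.1 + p.2.1 * q.1, p.2.2 * q.2.2 + p.2.2 + q.2.2)

/-- Negative of a rational code. -/
def neg (p : RatCode) : RatCode := (p.2.1, p.1, p.2.2)

/-- Strict order of rational codes. -/
def ltb (p q : RatCode) : Bool :=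
  decide (p.1 * (q.2.2 + 1) + q.2.1 * (p.2.2 + 1) < q.1 * (p.2.2 + 1) + p.2.1 * (q.2.2 + 1))

/-- The code of a natural number. -/
def ofNat (n : ℕ) : RatCode := (n, 0, 0)

/-- The code of `2⁻¹ ^ k`. -/
def halfPow (k : ℕ) : RatCode := (1, 0, 2 ^ k - 1)

@[simp] theorem val_add (p q : RatCode) : (add p q).val = p.val + q.val := by
  have h1 : ((p.2.2 : ℝ) + 1) ≠ 0 := by positivity
  have h2 : ((q.2.2 : ℝ) + 1) ≠ 0 := by positivity
  -- The last component of a code is the denominator minus one, and (c + 1)(d + 1) - 1 = cd + c + d.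
  have h3 : (p.2.2 * q.2.2 + p.2.2 + q.2.2 + 1 : ℝ) ≠ 0 := by positivity
  simp only [val, add]
  push_cast
  field_simp
  ring

@[simp] theorem val_mul (p q : RatCode) : (mul p q).val = p.val * q.val := by
  have h1 : ((p.2.2 : ℝ) + 1) ≠ 0 := by positivity
  have h2 : ((q.2.2 : ℝ) + 1) ≠ 0 := by positivity
  have h3 : (p.2.2 * q.2.2 + p.2.2 + q.2.2 + 1 : ℝ) ≠ 0 := by positivity
  simp only [val, mul]
  push_cast
  field_simp
  ring

@[simp] theorem val_neg (p : RatCode) : (neg p).val = -p.val := by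
  simp only [val, neg]
  ring

@[simp] theorem val_ofNat (n : ℕ) : (ofNat n).val = n := by simp [val, ofNat]

@[simp] theorem val_halfPow (k : ℕ) : (halfPow k).val = (2 : ℝ)⁻¹ ^ k := by
  have : 1 ≤ 2 ^ k := Nat.one_le_two_pow
  simp [val, halfPow, Nat.cast_sub this]

theorem ltb_iff (p q : RatCode) : ltb p q = true ↔ p.val < q.val := by
  have h1 : (0 : ℝ) < (p.2.2 : ℝ) + 1 := by positivity
  have h2 : (0 : ℝ) < (q.2.2 : ℝ) + 1 := by positivity
  rw [ltb, decide_eq_true_iff, val, val, div_lt_div_iff₀ h1 h2]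
  constructor
  · intro h
    have : ((p.1 * (q.2.2 + 1) + q.2.1 * (p.2.2 + 1) : ℕ) : ℝ) <
      ((q.1 * (p.2.2 + 1) + p.2.1 * (q.2.2 + 1) : ℕ) : ℝ) := by exact_mod_cast h
    push_cast at this
    linarith
  · intro h
    have : ((p.1 * (q.2.2 + 1) + q.2.1 * (p.2.2 + 1) : ℕ) : ℝ) <
      ((q.1 * (p.2.2 + 1) + p.2.1 * (q.2.2 + 1) : ℕ) : ℝ) := by
      push_cast
      linarith
    exact_mod_cast this

theorem exists_val_eq (r : ℚ) : ∃ q : RatCode, q.val = r := by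
  refine ⟨(r.num.toNat, (-r.num).toNat, r.den - 1), ?_⟩
  have h1 : ((r.num.toNat : ℝ) - ((-r.num).toNat : ℝ)) = r.num := by
    exact_mod_cast Int.toNat_sub_toNat_neg r.num
  have h2 : ((r.den - 1 : ℕ) : ℝ) + 1 = r.den := by
    rw [Nat.cast_sub r.den_pos]
    simp
  rw [val, h1, h2, Rat.cast_def]

theorem exists_between {x y : ℝ} (h : x < y) : ∃ q : RatCode, x < q.val ∧ q.val < y := by
  obtain ⟨r, h1, h2⟩ := exists_rat_btwn h
  obtain ⟨q, hq⟩ := exists_val_eq r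
  exact ⟨q, hq ▸ h1, hq ▸ h2⟩

end RatCode

section

variable {α β : Type*} [Primcodable α] [Primcodable β]

@[fun_prop] theorem computable_ratCode_add {f g : α → RatCode} (hf : Computable f)
    (hg : Computable g) : Computable fun a => RatCode.add (f a) (g a) := by
  unfold RatCode.add; fun_prop

@[fun_prop] theorem computable_ratCode_mul {f g : α → RatCode} (hf : Computable f)
    (hg : Computable g) : Computable fun a => RatCode.mul (f a) (g a) := by
  unfold RatCode.mul; fun_prop

@[fun_prop] theorem computable_ratCode_neg {f : α → RatCode} (hf : Computable f) :
    Computable fun a => RatCode.neg (f a) := by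
  unfold RatCode.neg; fun_prop

@[fun_prop] theorem computable_ratCode_ltb {f g : α → RatCode} (hf : Computable f)
    (hg : Computable g) : Computable fun a => RatCode.ltb (f a) (g a) := by
  unfold RatCode.ltb; fun_prop

@[fun_prop] theorem computable_ratCode_ofNat {f : α → ℕ} (hf : Computable f) :
    Computable fun a => RatCode.ofNat (f a) := by
  unfold RatCode.ofNat; fun_prop

@[fun_prop] theorem computable_ratCode_halfPow {f : α → ℕ} (hf : Computable f) :
    Computable fun a => RatCode.halfPow (f a) := by
  unfold RatCode.halfPow; fun_prop

/-! ## Computable real-valued functions -/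

/-- A real-valued function on a coded type is computable if its values can be approximated to any
prescribed precision. -/
def ComputableReal (x : α → ℝ) : Prop :=
  ∃ f : α × ℕ → RatCode, Computable f ∧ ∀ a k, |x a - (f (a, k)).val| < (2 : ℝ)⁻¹ ^ k

theorem exists_half_pow_lt {ε : ℝ} (h : 0 < ε) : ∃ k : ℕ, (2 : ℝ)⁻¹ ^ k < ε :=
  exists_pow_lt_of_lt_one h (by norm_num)

theorem ComputableReal.comp {x : β → ℝ} {f : α → β} (hx : ComputableReal x)
    (hf : Computable f) : ComputableReal fun a => x (f a) := by
  obtain ⟨g, hg, h⟩ := hx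
  exact ⟨fun p => g (f p.1, p.2), by fun_prop, fun a k => h (f a) k⟩

theorem ComputableReal.ratCode {r : α → RatCode} (hr : Computable r) :
    ComputableReal fun a => (r a).val :=
  ⟨fun p => r p.1, by fun_prop, fun a k => by simp⟩

theorem ComputableReal.natCast {r : α → ℕ} (hr : Computable r) :
    ComputableReal fun a => (r a : ℝ) := by
  simpa using ComputableReal.ratCode (r := fun a => RatCode.ofNat (r a)) (by fun_prop)

theorem ComputableReal.add {x y : α → ℝ} (hx : ComputableReal x) (hy : ComputableReal y) :
    ComputableReal fun a => x a + y a := by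
  obtain ⟨f, hf, h⟩ := hx
  obtain ⟨g, hg, h'⟩ := hy
  refine ⟨fun p => (f (p.1, p.2 + 1)).add (g (p.1, p.2 + 1)), by fun_prop, fun a k => ?_⟩
  have h1 := abs_lt.1 (h a (k + 1))
  have h2 := abs_lt.1 (h' a (k + 1))
  rw [pow_succ] at h1 h2
  rw [RatCode.val_add, abs_lt]
  constructor <;> linarith [h1.1, h1.2, h2.1, h2.2]

theorem ComputableReal.sum_range {x : α × ℕ → ℝ} {m : α → ℕ} (hx : ComputableReal x)
    (hm : Computable m) : ComputableReal fun a => ∑ i ∈ Finset.range (m a), x (a, i) := by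
  obtain ⟨f, hf, h⟩ := hx
  refine ⟨_, computable_nat_rec (α := α × ℕ) (f := fun p => m p.1)
    (g := fun _ => RatCode.ofNat 0)
    -- Each of the m summands is computed to precision 2^-(k+m); since m < 2^m, the total error
    -- stays below 2^-k.
    (h := fun p => p.2.2.add (f ((p.1.1, p.2.1), p.1.2 + m p.1.1)))
    (by fun_prop) (by fun_prop) (by fun_prop), fun a k => ?_⟩
  have main : ∀ n : ℕ, |(∑ i ∈ Finset.range n, x (a, i)) - RatCode.val (Nat.rec (RatCode.ofNat 0)
      (fun n s => s.add (f ((a, n), k + m a))) n)| ≤ n * (2 : ℝ)⁻¹ ^ (k + m a) := by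
    intro n
    induction n with
    | zero => simp
    | succ n ih =>
      rw [Finset.sum_range_succ, RatCode.val_add]
      have h1 := abs_le.1 ih
      have h2 := abs_lt.1 (h (a, n) (k + m a))
      push_cast
      rw [abs_le]
      constructor <;> linarith [h1.1, h1.2, h2.1, h2.2]
  refine (main (m a)).trans_lt ?_
  have hlt : ((m a : ℕ) : ℝ) < 2 ^ m a := by exact_mod_cast Nat.lt_two_pow_self
  calc ((m a : ℕ) : ℝ) * (2 : ℝ)⁻¹ ^ (k + m a) < 2 ^ m a * (2 : ℝ)⁻¹ ^ (k + m a) := by gcongr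
    _ = (2 : ℝ)⁻¹ ^ k := by
      rw [pow_add, mul_left_comm, ← mul_pow]
      norm_num

/-- A strict inequality is eventually visible in the approximations: at precision 2^-k it suffices
that they differ by more than 2 · 2^-k, and this happens once 2^-k is below a quarter of the gap. -/
theorem ComputableReal.lt {x y : α → ℝ} (hx : ComputableReal x) (hy : ComputableReal y) :
    SemiDecidable fun a => x a < y a := by
  obtain ⟨f, hf, h⟩ := hx
  obtain ⟨g, hg, h'⟩ := hy
  refine ⟨fun p => (((f p).add (RatCode.halfPow p.2)).add (RatCode.halfPow p.2)).ltb (g p),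
    by fun_prop, fun a => ?_⟩
  simp only [RatCode.ltb_iff, RatCode.val_add, RatCode.val_halfPow]
  constructor
  · intro hlt
    obtain ⟨k, hk⟩ := exists_half_pow_lt (ε := (y a - x a) / 4) (by linarith)
    have h1 := abs_lt.1 (h a k)
    have h2 := abs_lt.1 (h' a k)
    exact ⟨k, by linarith [h1.1, h2.2]⟩
  · rintro ⟨k, hk⟩
    have h1 := abs_lt.1 (h a k)
    have h2 := abs_lt.1 (h' a k)
    linarith [h1.2, h2.1]

/-- Searching for a rational q with q - 2^-k < x < q + 2^-k must succeed, since both conditions are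
semidecidable and rationals are dense. -/
theorem ComputableReal.of_semiDecidable {x : α → ℝ}
    (h1 : SemiDecidable fun p : α × RatCode => x p.1 < p.2.val)
    (h2 : SemiDecidable fun p : α × RatCode => p.2.val < x p.1) : ComputableReal x := by
  have h1' := h1.comp (α := (α × ℕ) × RatCode)
    (f := fun p => (p.1.1, p.2.add (RatCode.halfPow p.1.2))) (by fun_prop)
  have h2' := h2.comp (α := (α × ℕ) × RatCode)
    (f := fun p => (p.1.1, p.2.add (RatCode.neg (RatCode.halfPow p.1.2)))) (by fun_prop)
  obtain ⟨f, hf, h⟩ := (h1'.and h2').exists_choice (fun p => by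
    have : (0 : ℝ) < 2⁻¹ ^ p.2 := by positivity
    obtain ⟨q, hq1, hq2⟩ := RatCode.exists_between (x := x p.1 - 2⁻¹ ^ p.2) (y := x p.1 + 2⁻¹ ^ p.2)
      (by linarith)
    refine ⟨q, ?_, ?_⟩ <;>
      (simp only [RatCode.val_add, RatCode.val_neg, RatCode.val_halfPow]; linarith))
  refine ⟨f, hf, fun a k => ?_⟩
  obtain ⟨h3, h4⟩ := h (a, k)
  simp only [RatCode.val_add, RatCode.val_neg, RatCode.val_halfPow] at h3 h4
  rw [abs_lt]
  constructor <;> linarith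

end

/-! ## Arithmetic of rational `*`-polynomials -/

/-- Product of codes of Gaussian rationals. -/
def cmul (c d : RatCode × RatCode) : RatCode × RatCode :=
  ((c.1.mul d.1).add (c.2.mul d.2).neg, (c.1.mul d.2).add (c.2.mul d.1))

/-- The Gaussian rational with a given code. -/
def cval (c : RatCode × RatCode) : ℂ := ⟨c.1.val, c.2.val⟩

@[simp] theorem cval_cmul (c d : RatCode × RatCode) : cval (cmul c d) = cval c * cval d := by
  apply Complex.ext <;> simp [cval, cmul]; ring

theorem exists_cval_near (z : ℂ) {ε : ℝ} (hε : 0 < ε) : ∃ c, ‖z - cval c‖ < ε := by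
  obtain ⟨p, hp1, hp2⟩ := RatCode.exists_between (x := z.re - ε / 2) (y := z.re + ε / 2)
    (by linarith)
  obtain ⟨q, hq1, hq2⟩ := RatCode.exists_between (x := z.im - ε / 2) (y := z.im + ε / 2)
    (by linarith)
  refine ⟨(p, q), (Complex.norm_le_abs_re_add_abs_im _).trans_lt ?_⟩
  have h1 : |(z - cval (p, q)).re| < ε / 2 := by
    simp only [cval, Complex.sub_re, abs_lt]; constructor <;> linarith
  have h2 : |(z - cval (p, q)).im| < ε / 2 := by
    simp only [cval, Complex.sub_im, abs_lt]; constructor <;> linarith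
  linarith

namespace RatStarPoly

/-- Product of rational `*`-polynomials. -/
def mul (p q : RatStarPoly) : RatStarPoly :=
  p.flatMap fun s => q.map fun t => (cmul s.1 t.1, s.2 ++ t.2)

/-- Adjoint of a rational `*`-polynomial. -/
def adj (p : RatStarPoly) : RatStarPoly :=
  p.map fun t => ((t.1.1, t.1.2.neg), t.2.reverse.map fun l => (l.1, !l.2))

/-- A constant rational `*`-polynomial. -/
def const (c : RatCode × RatCode) : RatStarPoly := [(c, [])]

/-- The indeterminate `X i`. -/
def X (i : ℕ) : RatStarPoly := [((RatCode.ofNat 1, RatCode.ofNat 0), [(i, false)])]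

/-- The difference of rational `*`-polynomials. -/
def sub (p q : RatStarPoly) : RatStarPoly :=
  p ++ mul (const ((RatCode.ofNat 1).neg, RatCode.ofNat 0)) q

/-- The sum of a finite sequence of rational `*`-polynomials. -/
def sumRange (m : ℕ) (F : ℕ → RatStarPoly) : RatStarPoly := (List.range m).flatMap F

variable {C : Type*} [CStarAlgebra C] (a : ℕ → C)

theorem eval_eq (p : RatStarPoly) :
    p.eval a = (p.map fun t => cval t.1 • evalWord a t.2).sum := rfl

@[simp] theorem eval_nil : eval a [] = 0 := by simp [eval_eq]

theorem eval_cons (t : (RatCode × RatCode) × List (ℕ × Bool)) (p : RatStarPoly) :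
    eval a (t :: p) = cval t.1 • evalWord a t.2 + eval a p := by simp [eval_eq]

@[simp] theorem eval_append (p q : RatStarPoly) : eval a (p ++ q) = eval a p + eval a q := by
  simp [eval_eq]

@[simp] theorem eval_sumRange (m : ℕ) (F : ℕ → RatStarPoly) :
    eval a (sumRange m F) = ∑ i ∈ Finset.range m, eval a (F i) := by
  induction m with
  | zero => simp [sumRange]
  | succ m ih =>
    rw [Finset.sum_range_succ, ← ih]
    simp [sumRange, List.range_succ]

end RatStarPoly

section

variable {C : Type*} [CStarAlgebra C] (a : ℕ → C)

@[simp] theorem evalWord_nil : evalWord a [] = 1 := rfl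

theorem evalWord_cons (l : ℕ × Bool) (w : List (ℕ × Bool)) :
    evalWord a (l :: w) = (if l.2 then star (a l.1) else a l.1) * evalWord a w := by
  simp [evalWord]

theorem evalWord_append (v w : List (ℕ × Bool)) :
    evalWord a (v ++ w) = evalWord a v * evalWord a w := by
  simp [evalWord]

theorem evalWord_adj (w : List (ℕ × Bool)) :
    evalWord a (w.reverse.map fun l => (l.1, !l.2)) = star (evalWord a w) := by
  induction w with
  | nil => simp
  | cons l w ih =>
    rw [List.reverse_cons, List.map_append, evalWord_append, ih, evalWord_cons, star_mul]
    congr 1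
    rcases l with ⟨i, _ | _⟩ <;> simp [evalWord]

end

namespace RatStarPoly

variable {C : Type*} [CStarAlgebra C] (a : ℕ → C)

@[simp] theorem eval_const (c : RatCode × RatCode) : eval a (const c) = cval c • (1 : C) := by
  simp [eval_eq, const]

@[simp] theorem eval_X (i : ℕ) : eval a (X i) = a i := by
  have : (⟨1, 0⟩ : ℂ) = 1 := rfl
  simp [eval_eq, X, evalWord, cval, this]

@[simp] theorem eval_mul (p q : RatStarPoly) : eval a (mul p q) = eval a p * eval a q := by
  have key : ∀ (s : (RatCode × RatCode) × List (ℕ × Bool)) (q : RatStarPoly),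
      eval a (q.map fun t => (cmul s.1 t.1, s.2 ++ t.2)) =
        (cval s.1 • evalWord a s.2) * eval a q := by
    intro s q
    induction q with
    | nil => simp
    | cons t q ih =>
      rw [List.map_cons, eval_cons, eval_cons, ih, mul_add, cval_cmul, evalWord_append,
        smul_mul_smul_comm]
  induction p with
  | nil => simp [mul]
  | cons s p ih =>
    rw [eval_cons, add_mul, ← ih, ← key]
    simp [mul]

@[simp] theorem eval_adj (p : RatStarPoly) : eval a (adj p) = star (eval a p) := by
  induction p with
  | nil => simp [adj]
  | cons t p ih =>
    rw [eval_cons, star_add, ← ih, star_smul, ← evalWord_adj]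
    have : star (cval t.1) = cval (t.1.1, t.1.2.neg) := by
      apply Complex.ext <;> simp [cval]
    rw [this, adj, List.map_cons, eval_cons]
    rfl

@[simp] theorem eval_sub (p q : RatStarPoly) : eval a (sub p q) = eval a p - eval a q := by
  have : cval ((RatCode.ofNat 1).neg, RatCode.ofNat 0) = -1 := by
    apply Complex.ext <;> simp [cval]
  simp [sub, this, sub_eq_add_neg]

end RatStarPoly

section

variable {α β : Type*} [Primcodable α] [Primcodable β]

@[fun_prop] theorem computable_cmul {f g : α → RatCode × RatCode} (hf : Computable f)
    (hg : Computable g) : Computable fun a => cmul (f a) (g a) := by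
  unfold cmul; fun_prop

@[fun_prop] theorem computable_poly_mul {f g : α → RatStarPoly} (hf : Computable f)
    (hg : Computable g) : Computable fun a => RatStarPoly.mul (f a) (g a) := by
  have inner : Computable fun p : α × (RatCode × RatCode) × List (ℕ × Bool) =>
      ((g p.1).map fun t => (cmul p.2.1 t.1, p.2.2 ++ t.2) : List ((RatCode × RatCode) × List (ℕ × Bool))) :=
    computable_map (l := fun p : α × (RatCode × RatCode) × List (ℕ × Bool) => g p.1)
      (h := fun p : (α × (RatCode × RatCode) × List (ℕ × Bool)) ×
        (RatCode × RatCode) × List (ℕ × Bool) => (cmul p.1.2.1 p.2.1, p.1.2.2 ++ p.2.2))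
      (by fun_prop) (by fun_prop)
  have outer := computable_flatMap (l := f) hf inner
  exact outer

@[fun_prop] theorem computable_poly_adj {f : α → RatStarPoly} (hf : Computable f) :
    Computable fun a => RatStarPoly.adj (f a) := by
  unfold RatStarPoly.adj
  refine computable_map (h := fun p : α × (RatCode × RatCode) × List (ℕ × Bool) =>
    ((p.2.1.1, p.2.1.2.neg), p.2.2.reverse.map fun l : ℕ × Bool => (l.1, !l.2))) hf ?_
  refine computable_pair (by fun_prop) ?_
  exact computable_map (α := α × (RatCode × RatCode) × List (ℕ × Bool))
    (h := fun p : (α × (RatCode × RatCode) × List (ℕ × Bool)) × ℕ × Bool => (p.2.1, !p.2.2))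
    (by fun_prop) (by fun_prop)

@[fun_prop] theorem computable_poly_sub {f g : α → RatStarPoly} (hf : Computable f)
    (hg : Computable g) : Computable fun a => RatStarPoly.sub (f a) (g a) := by
  unfold RatStarPoly.sub; fun_prop

theorem computable_poly_sumRange {m : α → ℕ} {F : α × ℕ → RatStarPoly} (hm : Computable m)
    (hF : Computable F) : Computable fun a => RatStarPoly.sumRange (m a) fun i => F (a, i) := by
  unfold RatStarPoly.sumRange
  have : Computable List.range := Primrec.list_range.to_comp
  exact computable_flatMap (by fun_prop) hF

end

/-- The values of rational `*`-polynomials at a sequence are dense in the C*-algebra that it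
generates. -/
theorem topologicalClosure_adjoin_subset {C : Type*} [CStarAlgebra C] (a : ℕ → C) :
    ((StarAlgebra.adjoin ℂ (Set.range a)).topologicalClosure : Set C) ⊆
      closure (Set.range fun p : RatStarPoly => p.eval a) := by
  set D : Set C := closure (Set.range fun p : RatStarPoly => p.eval a)
  have hmul : ∀ x ∈ D, ∀ y ∈ D, x * y ∈ D := fun x hx y hy =>
    map_mem_closure₂ continuous_mul hx hy (by
      rintro _ ⟨p, rfl⟩ _ ⟨q, rfl⟩
      exact ⟨p.mul q, by simp⟩)
  have hsub : ∀ y ∈ StarAlgebra.adjoin ℂ (Set.range a), y ∈ D := by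
    intro y hy
    induction hy using StarAlgebra.adjoin_induction with
    | mem y hy =>
      obtain ⟨i, rfl⟩ := hy
      exact subset_closure ⟨RatStarPoly.X i, by simp⟩
    | algebraMap z =>
      rw [Metric.mem_closure_iff]
      intro ε hε
      -- The summand 1 keeps the denominator positive in the zero algebra, where ‖1‖ = 0.
      obtain ⟨c, hc⟩ := exists_cval_near z (ε := ε / (‖(1 : C)‖ + 1)) (by positivity)
      refine ⟨_, ⟨RatStarPoly.const c, rfl⟩, ?_⟩
      beta_reduce
      rw [dist_eq_norm, RatStarPoly.eval_const, Algebra.algebraMap_eq_smul_one, ← sub_smul,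
        norm_smul]
      rw [lt_div_iff₀ (by positivity)] at hc
      nlinarith [norm_nonneg (z - cval c), norm_nonneg (1 : C)]
    | add x y _ _ hx hy =>
      exact map_mem_closure₂ continuous_add hx hy (by
        rintro _ ⟨p, rfl⟩ _ ⟨q, rfl⟩
        exact ⟨p ++ q, by simp⟩)
    | mul x y _ _ hx hy => exact hmul x hx y hy
    | star x _ hx =>
      exact map_mem_closure continuous_star hx (by
        rintro _ ⟨p, rfl⟩
        exact ⟨p.adj, by simp⟩)
  exact closure_minimal hsub isClosed_closure

theorem IsPresentation.exists_near {C : Type*} [CStarAlgebra C] {a : ℕ → C}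
    (ha : IsPresentation a) (x : C) {ε : ℝ} (hε : 0 < ε) :
    ∃ p : RatStarPoly, ‖x - p.eval a‖ < ε := by
  have hx : x ∈ (StarAlgebra.adjoin ℂ (Set.range a)).topologicalClosure := by
    rw [show _ = _ from ha]
    trivial
  obtain ⟨_, ⟨p, rfl⟩, hp⟩ :=
    Metric.mem_closure_iff.1 (topologicalClosure_adjoin_subset a hx) ε hε
  exact ⟨p, by rwa [← dist_eq_norm]⟩

end KEP

end

noncomputable section

namespace KEP

/-! ## Functions computed by Turing machines are computable -/

section

variable {α β σ : Type*} [Primcodable α] [Primcodable β] [Primcodable σ]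

theorem computable_of_finite [Finite α] (f : α → σ) : Computable f :=
  (Primrec.dom_finite f).to_comp

theorem computable_fin_arrow {n : ℕ} {f : α → Fin n → σ} (h : ∀ i, Computable fun a => f a i) :
    Computable f := by
  have h1 : Computable fun v : List.Vector σ n => v.get := Primrec.vector_get'.to_comp
  refine (h1.comp (Computable.vector_ofFn (f := fun i a => f a i) h)).of_eq fun a => ?_
  funext i
  simp

theorem computable_fin_app {n : ℕ} {f : α → Fin n → σ} (hf : Computable f)
    (i : Fin n) : Computable fun a => f a i :=
  Computable.fin_app.comp hf (Computable.const i)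

theorem computable_update {n : ℕ} {f : α → Fin n → σ} {g : α → σ} (hf : Computable f)
    (hg : Computable g) (i : Fin n) : Computable fun a => Function.update (f a) i (g a) := by
  refine computable_fin_arrow fun j => ?_
  by_cases h : j = i
  · subst h; simpa using hg
  · simpa [h] using computable_fin_app hf j

/-- The values of the finitely many branches are tabulated in a vector, and the index selects an
entry. -/
theorem computable_finite_cases {Λ : Type*} [Primcodable Λ] [Finite Λ] {F : Λ → β → σ}
    (hF : ∀ l, Computable (F l)) {f : α → Λ} {g : α → β} (hf : Computable f) (hg : Computable g) :
    Computable fun a => F (f a) (g a) := by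
  obtain ⟨n, ⟨e⟩⟩ := Finite.exists_equiv_fin Λ
  have he : Computable e := computable_of_finite e
  have h1 : Computable fun b : β => List.Vector.ofFn fun i => F (e.symm i) b :=
    Computable.vector_ofFn fun i => hF _
  refine (Computable.vector_get.comp (h1.comp hg) (he.comp hf)).of_eq fun a => ?_
  simp

end

/-! ### Simulation of a multi-stack machine on coded configurations. -/

section TM2

open Turing

variable {K : Type} {Γ : K → Type} {Λ σ : Type}

/-- Configurations with coded symbols. -/
abbrev CodedCfg (Λ σ : Type) (n g : ℕ) : Type := Option Λ × σ × (Fin n → List (Fin (g + 1)))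

/-- The symbols that may be pushed on the stacks by a statement. -/
def pushable : TM2.Stmt Γ Λ σ → Set (Σ k, Γ k)
  | .push k f q => Set.range (fun v => ⟨k, f v⟩) ∪ pushable q
  | .peek _ _ q => pushable q
  | .pop _ _ q => pushable q
  | .load _ q => pushable q
  | .branch _ q₁ q₂ => pushable q₁ ∪ pushable q₂
  | .goto _ => ∅
  | .halt => ∅

theorem finite_pushable [Finite σ] (q : TM2.Stmt Γ Λ σ) : (pushable q).Finite := by
  induction q with
  | push k f q ih => exact (Set.finite_range _).union ih
  | peek _ _ q ih => exact ih
  | pop _ _ q ih => exact ih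
  | load _ q ih => exact ih
  | branch _ q₁ q₂ ih₁ ih₂ => exact ih₁.union ih₂
  | goto _ => exact Set.finite_empty
  | halt => exact Set.finite_empty

/-- The stack alphabets are arbitrary types, but only a finite set `P` of symbols matters in a run.
These receive distinct codes; all other symbols share the extra code `Fin.last g`. -/
theorem exists_code_injOn {X : Type*} {P : Set X} (hP : P.Finite) :
    ∃ (g : ℕ) (code : X → Fin (g + 1)), Set.InjOn code P := by
  classical
  have := hP.to_subtype
  obtain ⟨g, ⟨e⟩⟩ := Finite.exists_equiv_fin P
  refine ⟨g, fun x => if h : x ∈ P then (e ⟨x, h⟩).castSucc else Fin.last g, ?_⟩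
  intro x hx y hy hxy
  simpa [hx, hy] using hxy

variable {n g : ℕ} (e : K ≃ Fin n) (code : (Σ k, Γ k) → Fin (g + 1)) (P : Set (Σ k, Γ k))

/-- Stacks with coded symbols. -/
def encStk (S : ∀ k, List (Γ k)) : Fin n → List (Fin (g + 1)) :=
  fun i => (S (e.symm i)).map fun x => code ⟨e.symm i, x⟩

theorem encStk_apply (S : ∀ k, List (Γ k)) (k : K) :
    encStk e code S (e k) = (S k).map fun x => code ⟨k, x⟩ := by
  have : ∀ k', k' = k → ((S k').map fun x => code ⟨k', x⟩) = (S k).map fun x => code ⟨k, x⟩ := by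
    rintro _ rfl; rfl
  exact this _ (e.symm_apply_apply k)

theorem encStk_update [DecidableEq K] (S : ∀ k, List (Γ k)) (k : K) (l : List (Γ k)) :
    encStk e code (Function.update S k l) =
      Function.update (encStk e code S) (e k) (l.map fun x => code ⟨k, x⟩) := by
  funext i
  obtain ⟨j, rfl⟩ := e.surjective i
  rw [encStk_apply]
  by_cases h : j = k
  · subst h; simp
  · have : e j ≠ e k := fun h' => h (e.injective h')
    simp [h, this, encStk_apply]

/-- All symbols on the stacks belong to `P`. -/
def GoodStk (S : ∀ k, List (Γ k)) : Prop := ∀ k, ∀ x ∈ S k, (⟨k, x⟩ : Σ k, Γ k) ∈ P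

variable {P} in
theorem GoodStk.update [DecidableEq K] {S : ∀ k, List (Γ k)} (hS : GoodStk P S) {k : K} {l : List (Γ k)}
    (hl : ∀ x ∈ l, (⟨k, x⟩ : Σ k, Γ k) ∈ P) : GoodStk P (Function.update S k l) := by
  intro j x hx
  by_cases h : j = k
  · subst h
    rw [Function.update_self] at hx
    exact hl x hx
  · rw [Function.update_of_ne h] at hx
    exact hS j x hx

variable {code P}

/-- On stacks with symbols from `P` the code of the top symbol determines the symbol, so `f` factors
through the code. The domain of `f'` is finite, so its computability costs nothing. -/
theorem exists_coded_transition (hcode : Set.InjOn code P) (k : K)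
    (f : σ → Option (Γ k) → σ) : ∃ f' : σ × Option (Fin (g + 1)) → σ,
      ∀ v (S : ∀ k, List (Γ k)), GoodStk P S →
        f' (v, (encStk e code S (e k)).head?) = f v (S k).head? := by
  classical
  refine ⟨fun p => match p.2 with
    | none => f p.1 none
    | some c => if h : ∃ x : Γ k, (⟨k, x⟩ : Σ k, Γ k) ∈ P ∧ code ⟨k, x⟩ = c then
        f p.1 (some h.choose) else p.1, fun v S hS => ?_⟩
  rw [encStk_apply]
  cases hl : S k with
  | nil => simp
  | cons x l =>
    have hx : (⟨k, x⟩ : Σ k, Γ k) ∈ P := hS k x (by simp [hl])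
    have h : ∃ y : Γ k, (⟨k, y⟩ : Σ k, Γ k) ∈ P ∧ code ⟨k, y⟩ = code ⟨k, x⟩ := ⟨x, hx, rfl⟩
    have : h.choose = x := by
      have := hcode h.choose_spec.1 hx h.choose_spec.2
      simpa using this
    simp [h, this]

variable [DecidableEq K] [Primcodable σ] [Finite σ] [Primcodable Λ] [Finite Λ]

-- Induction on the statement. After coding, every function stored in a statement has a finite
-- domain and is computable for that reason; pushed symbols stay in `P` because `P` contains all
-- pushable ones.
omit [Finite Λ] in
theorem exists_computable_stepAux (hcode : Set.InjOn code P) (q : TM2.Stmt Γ Λ σ)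
    (hq : pushable q ⊆ P) : ∃ F : σ × (Fin n → List (Fin (g + 1))) →
      CodedCfg Λ σ n g, Computable F ∧
      ∀ v S, GoodStk P S → GoodStk P (TM2.stepAux q v S).stk ∧
        F (v, encStk e code S) = ((TM2.stepAux q v S).l, (TM2.stepAux q v S).var,
          encStk e code (TM2.stepAux q v S).stk) := by
  have hhead : Computable (List.head? : List (Fin (g + 1)) → _) := Primrec.list_head?.to_comp
  have htail : Computable (List.tail : List (Fin (g + 1)) → _) := Primrec.list_tail.to_comp
  have happ : ∀ i, Computable fun p : σ × (Fin n → List (Fin (g + 1))) => p.2 i :=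
    fun i => computable_fin_app (by fun_prop) i
  induction q with
  | push k f q ih =>
    obtain ⟨F, hF, h⟩ := ih (Set.subset_union_right.trans hq)
    have hf : Computable fun v => code ⟨k, f v⟩ := computable_of_finite _
    refine ⟨fun p => F (p.1, Function.update p.2 (e k) (code ⟨k, f p.1⟩ :: p.2 (e k))), ?_,
      fun v S hS => ?_⟩
    · have := computable_update (f := fun p : σ × (Fin n → List (Fin (g + 1))) => p.2)
        (g := fun p => code ⟨k, f p.1⟩ :: p.2 (e k)) (by fun_prop)
        (computable_cons (hf.comp Computable.fst) (happ _)) (e k)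
      fun_prop
    · have := h v (Function.update S k (f v :: S k)) (hS.update (by
        intro x hx
        rcases List.mem_cons.1 hx with rfl | hx
        · exact hq (Or.inl ⟨v, rfl⟩)
        · exact hS k x hx))
      rw [encStk_update, List.map_cons, ← encStk_apply] at this
      exact this
  | peek k f q ih =>
    obtain ⟨F, hF, h⟩ := ih hq
    obtain ⟨f', hf'⟩ := exists_coded_transition e hcode k f
    have hf'' : Computable fun p : σ × Option (Fin (g + 1)) => f' p :=
      computable_of_finite _
    have h1 : Computable fun p : σ × (Fin n → List (Fin (g + 1))) => (p.2 (e k)).head? :=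
      hhead.comp (happ _)
    refine ⟨fun p => F (f' (p.1, (p.2 (e k)).head?), p.2),
      hF.comp ((hf''.comp (computable_fst computable_id |>.pair h1)).pair
        (computable_snd computable_id)), fun v S hS => ?_⟩
    simp only [hf' v S hS]
    exact h _ S hS
  | pop k f q ih =>
    obtain ⟨F, hF, h⟩ := ih hq
    obtain ⟨f', hf'⟩ := exists_coded_transition e hcode k f
    have hf'' : Computable fun p : σ × Option (Fin (g + 1)) => f' p :=
      computable_of_finite _
    refine ⟨fun p => F (f' (p.1, (p.2 (e k)).head?),
      Function.update p.2 (e k) (p.2 (e k)).tail), ?_, fun v S hS => ?_⟩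
    · have h1 : Computable fun p : σ × (Fin n → List (Fin (g + 1))) => (p.2 (e k)).head? :=
        hhead.comp (happ _)
      have := computable_update (f := fun p : σ × (Fin n → List (Fin (g + 1))) => p.2)
        (g := fun p => (p.2 (e k)).tail) (by fun_prop) (htail.comp (happ _)) (e k)
      exact hF.comp ((hf''.comp (computable_fst computable_id |>.pair h1)).pair this)
    · have := h (f v (S k).head?) (Function.update S k (S k).tail) (hS.update fun x hx =>
        hS k x (List.mem_of_mem_tail hx))
      rw [encStk_update, List.map_tail, ← encStk_apply] at this
      simp only [hf' v S hS]
      exact this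
  | load f q ih =>
    obtain ⟨F, hF, h⟩ := ih hq
    have hf : Computable f := computable_of_finite _
    exact ⟨fun p => F (f p.1, p.2), by fun_prop, fun v S hS => h _ S hS⟩
  | branch f q₁ q₂ ih₁ ih₂ =>
    obtain ⟨F₁, hF₁, h₁⟩ := ih₁ (Set.subset_union_left.trans hq)
    obtain ⟨F₂, hF₂, h₂⟩ := ih₂ (Set.subset_union_right.trans hq)
    have hf : Computable f := computable_of_finite _
    refine ⟨fun p => bif f p.1 then F₁ p else F₂ p, by fun_prop, fun v S hS => ?_⟩
    cases hv : f v with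
    | true => simpa [hv] using h₁ v S hS
    | false => simpa [hv] using h₂ v S hS
  | goto f =>
    have hf : Computable f := computable_of_finite _
    exact ⟨fun p => (some (f p.1), p.1, p.2), by fun_prop, fun v S hS => ⟨hS, rfl⟩⟩
  | halt => exact ⟨fun p => (none, p.1, p.2), by fun_prop, fun v S hS => ⟨hS, rfl⟩⟩

/-- The coded form of a configuration. -/
def encCfg (code : (Σ k, Γ k) → Fin (g + 1)) (c : TM2.Cfg Γ Λ σ) : CodedCfg Λ σ n g :=
  (c.l, c.var, encStk e code c.stk)

/-- The step is made total by fixing halted configurations, so the result of a halting run does not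
depend on how many further steps are made. -/
theorem exists_computable_step (hcode : Set.InjOn code P) (m : Λ → TM2.Stmt Γ Λ σ)
    (hm : ∀ l, pushable (m l) ⊆ P) : ∃ F : CodedCfg Λ σ n g → CodedCfg Λ σ n g, Computable F ∧
      (∀ t, t.1 = none → F t = t) ∧
      ∀ c c', GoodStk P c.stk → TM2.step m c = some c' →
        GoodStk P c'.stk ∧ F (encCfg e code c) = encCfg e code c' := by
  choose F hF h using fun l => exists_computable_stepAux e hcode (m l) (hm l)
  refine ⟨fun t => t.1.elim t fun l => F l t.2, ?_, ?_, ?_⟩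
  · have h1 : Computable fun p : CodedCfg Λ σ n g × Λ => F p.2 p.1.2 :=
      computable_finite_cases hF (f := fun p : CodedCfg Λ σ n g × Λ => p.2)
        (g := fun p : CodedCfg Λ σ n g × Λ => p.1.2)
        Computable.snd (Computable.snd.comp Computable.fst)
    have h2 := computable_option_elim (o := fun t : CodedCfg Λ σ n g => t.1)
      (f := fun t : CodedCfg Λ σ n g => t) Computable.fst Computable.id h1
    exact h2
  · rintro ⟨l, v, T⟩ rfl
    rfl
  · rintro ⟨_ | l, v, S⟩ c' hS hc
    · simp at hc
    · rw [TM2.step, Option.some.injEq] at hc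
      subst hc
      exact h l v S hS

end TM2

theorem initList_stk (tm : Turing.FinTM2) (s : List (tm.Γ tm.k₀)) :
    (Turing.initList tm s).stk = Function.update (fun _ => []) tm.k₀ s := by
  funext k
  by_cases h : k = tm.k₀
  · subst h; simp [Turing.initList]
  · simp [Turing.initList, h]

theorem haltList_stk (tm : Turing.FinTM2) (s : List (tm.Γ tm.k₁)) :
    (Turing.haltList tm s).stk = Function.update (fun _ => []) tm.k₁ s := by
  funext k
  by_cases h : k = tm.k₁
  · subst h; simp [Turing.haltList]
  · simp [Turing.haltList, h]

/-- The value is found by searching for y and a number of steps after which the machine has halted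
with the coded encoding of y on the output stack. Comparing encodings means that only `encode`, not
`decode`, has to be computable. -/
theorem PolyTime.computable {α β Γ₁ Γ₂ : Type} [Primcodable α] [Primcodable β] [Primcodable Γ₁]
    [Primcodable Γ₂] [Finite Γ₁] [Finite Γ₂] {ea : Computability.Encoding α Γ₁}
    {eb : Computability.Encoding β Γ₂} {f : α → β} (h : PolyTime ea eb f)
    (hea : Computable ea.encode) (heb : Computable eb.encode) : Computable f := by
  classical
  obtain ⟨⟨⟨tm, inp, out⟩, time, hrun⟩⟩ := h
  dsimp only at hrun
  have := tm.σFin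
  have := tm.ΛFin
  have := tm.kFin
  let : Primcodable tm.σ := Primcodable.ofEquiv _ (Fintype.equivFin tm.σ)
  let : Primcodable tm.Λ := Primcodable.ofEquiv _ (Fintype.equivFin tm.Λ)
  let e : tm.K ≃ Fin (Fintype.card tm.K) := Fintype.equivFin tm.K
  -- `P` collects the symbols that statements can push, those of the input, and those that encode an
  -- output.
  let P : Set (Σ k, tm.Γ k) := ((⋃ l, pushable (tm.m l)) ∪ Set.range fun x : Γ₁ =>
    ⟨tm.k₀, inp.symm x⟩) ∪ Set.range fun x : Γ₂ => ⟨tm.k₁, out.symm x⟩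
  have hP : P.Finite := ((Set.finite_iUnion fun l => finite_pushable _).union
    (Set.finite_range _)).union (Set.finite_range _)
  obtain ⟨g, code, hcode⟩ := exists_code_injOn hP
  obtain ⟨F, hF, hF0, hF1⟩ := exists_computable_step e hcode tm.m fun l =>
    (Set.subset_iUnion (fun l => pushable (tm.m l)) l).trans
      (Set.subset_union_left.trans Set.subset_union_left)
  let cin : Γ₁ → Fin (g + 1) := fun x => code ⟨tm.k₀, inp.symm x⟩
  let cout : Γ₂ → Fin (g + 1) := fun x => code ⟨tm.k₁, out.symm x⟩
  have hcin : Computable cin := computable_of_finite _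
  have hcout : Computable cout := computable_of_finite _
  have hcout_inj : Function.Injective cout := by
    intro x y hxy
    have := hcode (Or.inr ⟨x, rfl⟩) (Or.inr ⟨y, rfl⟩) hxy
    simpa using this
  let init : α → CodedCfg tm.Λ tm.σ (Fintype.card tm.K) g := fun a =>
    (some tm.main, tm.initialState, Function.update (fun _ => []) (e tm.k₀)
      ((ea.encode a).map cin))
  have hinit : Computable init := by
    have := computable_update (f := fun _ : α => fun _ : Fin (Fintype.card tm.K) =>
      ([] : List (Fin (g + 1)))) (g := fun a => (ea.encode a).map cin) (Computable.const _)
      (computable_map (h := fun p => cin p.2) (by fun_prop) (by fun_prop)) (e tm.k₀)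
    fun_prop
  have hrun' : ∀ a, ∃ N, (F^[N] (init a)).1 = none ∧
      (F^[N] (init a)).2.2 (e tm.k₁) = (eb.encode (f a)).map cout := by
    intro a
    obtain ⟨⟨N, hN⟩, -⟩ := hrun a
    refine ⟨N, ?_⟩
    have key : ∀ (N : ℕ) (c : tm.Cfg), (flip Bind.bind tm.step)^[N]
        (some (Turing.initList tm ((ea.encode a).map inp.invFun))) = some c →
        GoodStk P c.stk ∧ F^[N] (init a) = encCfg e code c := by
      intro N
      induction N with
      | zero =>
        intro c hc
        have hc' := Option.some.inj hc
        subst hc'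
        unfold encCfg
        rw [initList_stk]
        constructor
        · refine GoodStk.update (fun k x hx => by simp at hx) ?_
          intro x hx
          obtain ⟨y, -, rfl⟩ := List.mem_map.1 hx
          exact Or.inl (Or.inr ⟨y, rfl⟩)
        · rw [encStk_update]
          simp only [Function.iterate_zero, id, init, List.map_map]
          rfl
      | succ N ih =>
        intro c hc
        rw [Function.iterate_succ_apply'] at hc
        cases hc0 : (flip Bind.bind tm.step)^[N]
          (some (Turing.initList tm ((ea.encode a).map inp.invFun))) with
        | none =>
          rw [hc0] at hc
          exact absurd hc (by rintro ⟨⟩)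
        | some c0 =>
          rw [hc0] at hc
          obtain ⟨h1, h2⟩ := ih c0 hc0
          obtain ⟨h3, h4⟩ := hF1 c0 c h1 hc
          exact ⟨h3, by rw [Function.iterate_succ_apply', h2, h4]⟩
    obtain ⟨-, h2⟩ := key N _ hN
    rw [h2]
    refine ⟨rfl, ?_⟩
    change encStk e code _ (e tm.k₁) = _
    rw [encStk_apply, haltList_stk]
    simp [cout, Function.comp_def]
  obtain ⟨run, hrunc, hrun_eq⟩ : ∃ run : α × ℕ → CodedCfg tm.Λ tm.σ (Fintype.card tm.K) g,
      Computable run ∧ ∀ a N, run (a, N) = F^[N] (init a) :=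
    ⟨fun q => F^[q.2] (init q.1), computable_iterate (f := fun q : α × ℕ => q.2)
      (g := fun q : α × ℕ => init q.1) (h := fun p => F p.2) (by fun_prop) (by fun_prop)
      (by fun_prop), fun _ _ => rfl⟩
  have hout : Computable fun y : β => (eb.encode y).map cout :=
    computable_map (h := fun p : β × Γ₂ => cout p.2) heb (by fun_prop)
  have hstk : Computable fun q : α × ℕ => (run q).2.2 (e tm.k₁) :=
    computable_fin_app (Computable.snd.comp (Computable.snd.comp hrunc)) _
  have hG : Computable fun q : (α × β) × ℕ => decide ((run (q.1.1, q.2)).1 = none) &&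
      decide ((run (q.1.1, q.2)).2.2 (e tm.k₁) = (eb.encode q.1.2).map cout) := by
    refine computable_band (computable_decide_eq (by fun_prop) (by fun_prop))
      (computable_decide_eq ?_ (hout.comp (by fun_prop)))
    exact hstk.comp (f := fun q => (run q).2.2 (e tm.k₁)) (by fun_prop)
  obtain ⟨f', hf', hspec⟩ := (SemiDecidable.of_computable hG).exists.exists_choice
    fun a => ⟨f a, by
      obtain ⟨N, h1, h2⟩ := hrun' a
      exact ⟨N, by simp [hrun_eq, h1, h2]⟩⟩
  refine hf'.of_eq fun a => ?_
  obtain ⟨N, hN⟩ := hspec a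
  rw [Bool.and_eq_true, decide_eq_true_iff, decide_eq_true_iff, hrun_eq] at hN
  obtain ⟨N', h1, h2⟩ := hrun' a
  have hfix : ∀ t, t.1 = none → ∀ j, F^[j] t = t := fun t ht j =>
    Function.iterate_fixed (hF0 t ht) j
  -- Both runs have halted and halted configurations are fixed, so the two step counts give the same
  -- configuration.
  have heq : F^[N] (init a) = F^[N'] (init a) := by
    rcases le_total N N' with h | h
    · obtain ⟨j, rfl⟩ := Nat.exists_eq_add_of_le' h
      rw [Function.iterate_add_apply, hfix _ hN.1]
    · obtain ⟨j, rfl⟩ := Nat.exists_eq_add_of_le' h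
      rw [Function.iterate_add_apply, hfix _ h1]
  have h3 : (eb.encode (f' a)).map cout = (eb.encode (f a)).map cout := by
    rw [← hN.2, ← h2, heq]
  exact eb.encode_injective (List.map_injective_iff.2 hcout_inj h3)

/-! ## The encodings are computable -/

theorem encodePosNum_eq (p : PosNum) : Computability.encodePosNum p =
    decide ((p : ℕ) % 2 = 1) :: Computability.encodeNat ((p : ℕ) / 2) := by
  have h : ∀ p : PosNum, Computability.encodePosNum p = Computability.encodeNat (p : ℕ) := by
    intro p
    rw [Computability.encodeNat, PosNum.of_to_nat]
    rfl
  cases p with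
  | one => rfl
  | bit0 p =>
    have h1 : ((p.bit0 : PosNum) : ℕ) % 2 = 0 := by simp only [PosNum.cast_bit0]; omega
    have h2 : ((p.bit0 : PosNum) : ℕ) / 2 = p := by simp only [PosNum.cast_bit0]; omega
    rw [h1, h2, ← h]
    rfl
  | bit1 p =>
    have h1 : ((p.bit1 : PosNum) : ℕ) % 2 = 1 := by simp only [PosNum.cast_bit1]; omega
    have h2 : ((p.bit1 : PosNum) : ℕ) / 2 = p := by simp only [PosNum.cast_bit1]; omega
    rw [h1, h2, ← h]
    rfl

/-- Digits are listed with the least significant first, so the encoding satisfies a recursion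
through n / 2. -/
theorem encodeNat_pos {n : ℕ} (hn : n ≠ 0) : Computability.encodeNat n =
    decide (n % 2 = 1) :: Computability.encodeNat (n / 2) := by
  have h : ((n : Num) : ℕ) = n := Num.to_of_nat n
  cases hp : (n : Num) with
  | zero => rw [hp] at h; exact absurd h.symm hn
  | pos p =>
    rw [hp] at h
    have h' : (p : ℕ) = n := h
    rw [Computability.encodeNat, hp, ← h']
    exact encodePosNum_eq p

theorem computable_encodeNat : Computable Computability.encodeNat := by
  have key : Computable₂ fun (_ : Unit) n => Computability.encodeNat n := by
    refine Computable.nat_strong_rec (fun (_ : Unit) n => Computability.encodeNat n)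
      -- Here `l` lists the values at 0, …, n - 1, so its length is n.
      (g := fun _ l => some (if l.length = 0 then [] else
        decide (l.length % 2 = 1) :: l.getD (l.length / 2) [])) ?_ ?_
    · change Computable fun p : Unit × List (List Bool) => _
      fun_prop
    · intro _ n
      by_cases hn : n = 0
      · subst hn; rfl
      · have : n / 2 < n := by omega
        rw [encodeNat_pos hn]
        simp [hn, List.getD_eq_getElem?_getD, this]
  have := key.comp (Computable.const ()) Computable.id
  exact this

theorem computable_encode_nat : Computable Computability.encodingNatBool.encode :=
  computable_encodeNat

theorem computable_encode_list : Computable (Computability.encodingList Bool).encode :=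
  Computable.id

theorem computable_encode_bool : Computable Computability.encodingBoolBool.encode :=
  computable_of_finite _

theorem computable_encode_prod {α β Γ₁ Γ₂ : Type} [Primcodable α] [Primcodable β] [Primcodable Γ₁]
    [Primcodable Γ₂] {ea : Computability.Encoding α Γ₁} {eb : Computability.Encoding β Γ₂}
    (hea : Computable ea.encode) (heb : Computable eb.encode) :
    Computable (Computability.encodingProd ea eb).encode := by
  have h1 : Computable fun x : α × β => ((ea.encode x.1).map Sum.inl : List (Γ₁ ⊕ Γ₂)) :=
    computable_map (h := fun p => Sum.inl p.2) (by fun_prop) (by fun_prop)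
  have h2 : Computable fun x : α × β => ((eb.encode x.2).map Sum.inr : List (Γ₁ ⊕ Γ₂)) :=
    computable_map (h := fun p => Sum.inr p.2) (by fun_prop) (by fun_prop)
  exact computable_append h1 h2

end KEP

end

noncomputable section

namespace KEP

/-! ## The ultrapower as a C*-algebra -/

section UltrapowerNorm

variable {U : Ultrafilter ℕ} {C : Type*} [CStarAlgebra C]

theorem mem_nullIdeal {x : ℕ →ᵇ C} :
    x ∈ nullIdeal U C ↔ ∀ ε > 0, ∀ᶠ m in (U : Filter ℕ), ‖x m‖ < ε := by
  change Tendsto (fun m => ‖x m‖) (U : Filter ℕ) (𝓝 0) ↔ _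
  rw [Metric.tendsto_nhds]
  simp

theorem isClosed_nullIdeal : IsClosed (nullIdeal U C : Set (ℕ →ᵇ C)) := by
  refine isClosed_of_closure_subset fun x hx => ?_
  refine mem_nullIdeal.2 fun ε hε => ?_
  obtain ⟨y, hy, hxy⟩ := Metric.mem_closure_iff.1 hx (ε / 2) (half_pos hε)
  filter_upwards [mem_nullIdeal.1 hy (ε / 2) (half_pos hε)] with m hm
  have h1 : ‖x m - y m‖ < ε / 2 := by
    rw [dist_eq_norm] at hxy
    exact ((x - y).norm_coe_le_norm m).trans_lt hxy
  have h2 := norm_add_le (x m - y m) (y m)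
  rw [sub_add_cancel] at h2
  linarith

/-- Replacing the terms of norm above `r` by zero does not change the class and gives a
representative of norm at most `r`. With `eventually_norm_lt` this identifies the quotient norm with
the limit of the norms along `U`. -/
theorem norm_mk_le {x : ℕ →ᵇ C} {r : ℝ} (hr : 0 ≤ r)
    (h : ∀ᶠ m in (U : Filter ℕ), ‖x m‖ ≤ r) :
    ‖(Submodule.Quotient.mk x : Ultrapower U C)‖ ≤ r := by
  classical
  let y : ℕ →ᵇ C := BoundedContinuousFunction.ofNormedAddCommGroupDiscrete
    (fun m => if ‖x m‖ ≤ r then x m else 0) r (fun m => by split_ifs <;> simp_all)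
  have hxy : (Submodule.Quotient.mk x : Ultrapower U C) = Submodule.Quotient.mk y := by
    rw [Submodule.Quotient.eq]
    refine mem_nullIdeal.2 fun ε hε => ?_
    filter_upwards [h] with m hm
    have : y m = x m := if_pos hm
    simp [this, hε]
  rw [hxy]
  refine (Submodule.Quotient.norm_mk_le _ _).trans ?_
  exact (BoundedContinuousFunction.norm_le hr).2 fun m => by
    change ‖if ‖x m‖ ≤ r then x m else 0‖ ≤ r
    split_ifs <;> simp_all

theorem eventually_norm_lt {x : ℕ →ᵇ C} {r : ℝ}
    (h : ‖(Submodule.Quotient.mk x : Ultrapower U C)‖ < r) :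
    ∀ᶠ m in (U : Filter ℕ), ‖x m‖ < r := by
  obtain ⟨y, hy, hyr⟩ := Submodule.Quotient.norm_mk_lt (Submodule.Quotient.mk x : Ultrapower U C)
    (sub_pos.2 h)
  rw [add_sub_cancel] at hyr
  have hxy : x - y ∈ nullIdeal U C := by
    rw [← Submodule.Quotient.eq, hy]
  filter_upwards [mem_nullIdeal.1 hxy _ (sub_pos.2 hyr)] with m hm
  have h1 := y.norm_coe_le_norm m
  have h2 := norm_add_le ((x - y) m) (y m)
  simp only [BoundedContinuousFunction.coe_sub, Pi.sub_apply, sub_add_cancel] at h2 hm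
  linarith

theorem eventually_lt_norm {x : ℕ →ᵇ C} {r : ℝ}
    (h : r < ‖(Submodule.Quotient.mk x : Ultrapower U C)‖) :
    ∀ᶠ m in (U : Filter ℕ), r < ‖x m‖ := by
  by_cases hr : 0 ≤ r
  · have : ¬ ∀ᶠ m in (U : Filter ℕ), ‖x m‖ ≤ r := fun h' => (norm_mk_le hr h').not_gt h
    rw [← Ultrafilter.eventually_not] at this
    simpa using this
  · exact Eventually.of_forall fun m => (not_le.1 hr).trans_le (norm_nonneg _)

variable (U C)

/-- The ultrapower is a C*-algebra with respect to the quotient norm. -/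
@[reducible] def ultrapowerCStarAlgebra : CStarAlgebra (Ultrapower U C) :=
  haveI : IsClosed (nullIdeal U C : Set (ℕ →ᵇ C)) := isClosed_nullIdeal
  letI : NormedRing (Ultrapower U C) :=
    { Submodule.Quotient.normedAddCommGroup (nullIdeal U C),
      (inferInstance : Ring (Ultrapower U C)) with
      norm_mul_le := by
        intro a b
        obtain ⟨x, rfl⟩ := Submodule.Quotient.mk_surjective _ a
        obtain ⟨y, rfl⟩ := Submodule.Quotient.mk_surjective _ b
        refine le_mul_of_forall_lt₀ fun r hr s hs => ?_
        refine norm_mk_le (x := x * y) (mul_nonneg ((norm_nonneg _).trans hr.le)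
          ((norm_nonneg _).trans hs.le)) ?_
        filter_upwards [eventually_norm_lt hr, eventually_norm_lt hs] with m h1 h2
        exact (norm_mul_le _ _).trans
          (mul_le_mul h1.le h2.le (norm_nonneg _) ((norm_nonneg _).trans hr.le)) }
  letI : NormedAlgebra ℂ (Ultrapower U C) :=
    { (inferInstance : Algebra ℂ (Ultrapower U C)) with
      norm_smul_le := by
        intro z a
        obtain ⟨x, rfl⟩ := Submodule.Quotient.mk_surjective _ a
        refine le_mul_of_forall_lt₀ fun r hr s hs => ?_
        refine norm_mk_le (x := z • x) (mul_nonneg ((norm_nonneg _).trans hr.le)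
          ((norm_nonneg _).trans hs.le)) ?_
        filter_upwards [eventually_norm_lt hs] with m h2
        exact (norm_smul_le _ _).trans
          (mul_le_mul hr.le h2.le (norm_nonneg _) ((norm_nonneg _).trans hr.le)) }
  haveI : CompleteSpace (Ultrapower U C) := Submodule.Quotient.completeSpace (nullIdeal U C)
  { (inferInstance : StarRing (Ultrapower U C)) with
    norm_mul_self_le := by
      intro a
      obtain ⟨x, rfl⟩ := Submodule.Quotient.mk_surjective _ a
      refine le_of_forall_gt_imp_ge_of_dense fun r hr => ?_
      have hr0 : 0 ≤ r := (norm_nonneg _).trans hr.le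
      -- If ‖x^*x‖ < r in the quotient, then ‖x m‖² < r along `U` by the C*-identity in `C`, which
      -- bounds the quotient norm of x by √r.
      have h := norm_mk_le (U := U) (x := x) (Real.sqrt_nonneg r) (by
        filter_upwards [eventually_norm_lt (x := star x * x) hr] with m hm
        refine Real.le_sqrt_of_sq_le ?_
        have : ‖star (x m) * x m‖ < r := hm
        rw [CStarRing.norm_star_mul_self] at this
        nlinarith)
      calc _ ≤ √r * √r := mul_self_le_mul_self (norm_nonneg _) h
        _ = r := Real.mul_self_sqrt hr0
    star_smul := by
      intro z a
      obtain ⟨x, rfl⟩ := Submodule.Quotient.mk_surjective _ a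
      exact congrArg (Ideal.Quotient.mk (nullIdeal U C)) (star_smul z x) }

variable {U C}

/-- Injective `*`-homomorphisms into ultrapowers are isometric: norms can be read off from
representing sequences. -/
theorem tendsto_norm_of_injective {A : Type*} [CStarAlgebra A]
    {φ : A →⋆ₐ[ℂ] Ultrapower U C} (hφ : Function.Injective φ) {a : A} {x : ℕ →ᵇ C}
    (hx : Ideal.Quotient.mk (nullIdeal U C) x = φ a) :
    Tendsto (fun m => ‖x m‖) (U : Filter ℕ) (𝓝 ‖a‖) := by
  let := ultrapowerCStarAlgebra U C
  have h : ‖φ a‖ = ‖a‖ := NonUnitalStarAlgHom.norm_map φ hφ a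
  rw [← hx] at h
  exact tendsto_order.2 ⟨fun r hr => eventually_lt_norm (hr.trans_eq h.symm),
    fun r hr => eventually_norm_lt (h.trans_lt hr)⟩

end UltrapowerNorm

end KEP

end

noncomputable section

namespace KEP

/-! ## Approximate strategies -/

section Expressions

variable {D E : Type*} [Ring D] [StarRing D] [Ring E] [StarRing E]

/-- The fourth power `(c^* c)^2` of the absolute value. -/
def absFour (c : D) : D := star c * c * (star c * c)

/-- The sum of a row of positive elements parametrized by `absFour`. -/
def rowSum (k : ℕ) (c : ℕ → D) : D := ∑ a ∈ Finset.range k, absFour (c a)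

/-- The commutator of `absFour c` and `absFour d`. -/
def absFourComm (c d : D) : D := absFour c * absFour d - absFour d * absFour c

/-- The operator `∑_s ∑_{a,b} D(x_s, y_s, a, b) (A^{1/2} B A^{1/2} + B^{1/2} A B^{1/2})` of a game,
where `(x_s, y_s)` are the sampled questions and the square roots are given separately. -/
def gameOp (N k : ℕ) (S : ℕ → ℕ × ℕ) (V : ℕ → ℕ → ℕ → ℕ → Bool) (rA A rB B : ℕ → ℕ → D) : D :=
  ∑ s ∈ Finset.range N, ∑ a ∈ Finset.range k, ∑ b ∈ Finset.range k,
    if V (S s).1 (S s).2 a b = true then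
      rA (S s).1 a * B (S s).2 b * rA (S s).1 a + rB (S s).2 b * A (S s).1 a * rB (S s).2 b
    else 0

/-- The operator of a game for positive elements parametrized by `absFour`. -/
def gameOpFour (N k : ℕ) (S : ℕ → ℕ × ℕ) (V : ℕ → ℕ → ℕ → ℕ → Bool) (c d : ℕ → ℕ → D) : D :=
  gameOp N k S V (fun x a => star (c x a) * c x a) (fun x a => absFour (c x a))
    (fun y b => star (d y b) * d y b) (fun y b => absFour (d y b))

variable (f : D →+* E) (hf : ∀ x, f (star x) = star (f x))

include hf

theorem map_absFour (c : D) : f (absFour c) = absFour (f c) := by simp [absFour, hf]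

theorem map_rowSum (k : ℕ) (c : ℕ → D) : f (rowSum k c) = rowSum k fun a => f (c a) := by
  simp [rowSum, map_absFour f hf]

theorem map_absFourComm (c d : D) : f (absFourComm c d) = absFourComm (f c) (f d) := by
  simp [absFourComm, map_absFour f hf]

theorem map_gameOpFour (N k : ℕ) (S : ℕ → ℕ × ℕ) (V : ℕ → ℕ → ℕ → ℕ → Bool) (c d : ℕ → ℕ → D) :
    f (gameOpFour N k S V c d) =
      gameOpFour N k S V (fun x a => f (c x a)) (fun y b => f (d y b)) := by
  simp only [gameOpFour, gameOp, map_sum, apply_ite f, map_add, map_mul, map_absFour f hf, map_zero,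
    hf]

end Expressions

section Continuity

variable {D : Type*} [CStarAlgebra D]

theorem continuous_absFour : Continuous (absFour : D → D) := by
  unfold absFour; fun_prop

theorem continuous_rowSum (k : ℕ) : Continuous (rowSum k : (ℕ → D) → D) := by
  unfold rowSum
  exact continuous_finsetSum _ fun a _ => continuous_absFour.comp (continuous_apply a)

theorem continuous_absFourComm : Continuous fun p : D × D => absFourComm p.1 p.2 := by
  have h1 : Continuous fun p : D × D => absFour p.1 := continuous_absFour.comp continuous_fst
  have h2 : Continuous fun p : D × D => absFour p.2 := continuous_absFour.comp continuous_snd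
  exact (h1.mul h2).sub (h2.mul h1)

theorem continuous_gameOpFour (N k : ℕ) (S : ℕ → ℕ × ℕ) (V : ℕ → ℕ → ℕ → ℕ → Bool) :
    Continuous fun p : (ℕ → ℕ → D) × (ℕ → ℕ → D) => gameOpFour N k S V p.1 p.2 := by
  unfold gameOpFour gameOp
  refine continuous_finsetSum _ fun s _ => continuous_finsetSum _ fun a _ =>
    continuous_finsetSum _ fun b _ => ?_
  split_ifs
  · unfold absFour
    fun_prop
  · exact continuous_const

end Continuity

/-- Families of elements that approximate a strategy with a commutator bound and a large value,
formulated by strict inequalities between norms of `*`-polynomials. -/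
structure IsApproxStrategy (n k N : ℕ) (S : ℕ → ℕ × ℕ) (V : ℕ → ℕ → ℕ → ℕ → Bool) (ε δ : ℝ)
    {D : Type*} [CStarAlgebra D] (c d : ℕ → ℕ → D) : Prop where
  left : ∀ x < n, ‖rowSum k (c x)‖ < 1
  -- The defect is bounded by ε² because an operator square root turns an error ε² into an error ε.
  left' : ∀ x < n, ‖1 - rowSum k (c x)‖ < ε ^ 2
  right : ∀ y < n, ‖rowSum k (d y)‖ < 1
  right' : ∀ y < n, ‖1 - rowSum k (d y)‖ < ε ^ 2
  -- The terms 4k²ε and 8Nk²ε pay for replacing the approximate POVMs by exact ones: 4ε for each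
  -- commutator and 8ε for each summand of the game operator.
  comm : ∀ x < n, ∀ y < n, ∑ a ∈ Finset.range k, ∑ b ∈ Finset.range k,
    ‖absFourComm (c x a) (d y b)‖ + 4 * k ^ 2 * ε < δ
  value : N + 8 * N * k ^ 2 * ε < ‖gameOpFour N k S V c d‖

section

variable {n k N : ℕ} {S : ℕ → ℕ × ℕ} {V : ℕ → ℕ → ℕ → ℕ → Bool} {ε δ : ℝ}
  {D : Type*} [CStarAlgebra D] {c d : ℕ → ℕ → D}

/-- Only entries with indices below `n` and `k` matter. `hV` ensures this for the game operator too,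
where sampled questions out of range contribute zero. -/
theorem IsApproxStrategy.congr (h : IsApproxStrategy n k N S V ε δ c d)
    (hV : ∀ x y a b, V x y a b = true → x < n ∧ y < n) {c' d' : ℕ → ℕ → D}
    (hc : ∀ x < n, ∀ a < k, c' x a = c x a) (hd : ∀ x < n, ∀ a < k, d' x a = d x a) :
    IsApproxStrategy n k N S V ε δ c' d' := by
  have h1 : ∀ x < n, rowSum k (c' x) = rowSum k (c x) := fun x hx =>
    Finset.sum_congr rfl fun a ha => by rw [hc x hx a (Finset.mem_range.1 ha)]
  have h2 : ∀ x < n, rowSum k (d' x) = rowSum k (d x) := fun x hx =>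
    Finset.sum_congr rfl fun a ha => by rw [hd x hx a (Finset.mem_range.1 ha)]
  refine ⟨fun x hx => h1 x hx ▸ h.left x hx, fun x hx => h1 x hx ▸ h.left' x hx,
    fun x hx => h2 x hx ▸ h.right x hx, fun x hx => h2 x hx ▸ h.right' x hx,
    fun x hx y hy => ?_, ?_⟩
  · refine lt_of_eq_of_lt (congrArg (· + 4 * (k : ℝ) ^ 2 * ε) ?_) (h.comm x hx y hy)
    refine Finset.sum_congr rfl fun a ha => Finset.sum_congr rfl fun b hb => ?_
    rw [hc x hx a (Finset.mem_range.1 ha), hd y hy b (Finset.mem_range.1 hb)]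
  · refine h.value.trans_eq (congrArg norm ?_)
    unfold gameOpFour gameOp
    refine Finset.sum_congr rfl fun s _ => Finset.sum_congr rfl fun a ha =>
      Finset.sum_congr rfl fun b hb => ?_
    split_ifs with hs
    · simp only [hc _ (hV _ _ _ _ hs).1 a (Finset.mem_range.1 ha),
        hd _ (hV _ _ _ _ hs).2 b (Finset.mem_range.1 hb)]
    · rfl

/-- The condition is open. Only convergence of norms is assumed, since the coordinates of an
ultrapower element need not converge themselves. -/
theorem IsApproxStrategy.eventually (h : IsApproxStrategy n k N S V ε δ c d) {ι E : Type*}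
    [CStarAlgebra E] {l : Filter ι} {c' d' : ι → ℕ → ℕ → E}
    (h1 : ∀ x, Tendsto (fun i => ‖rowSum k (c' i x)‖) l (𝓝 ‖rowSum k (c x)‖))
    (h2 : ∀ x, Tendsto (fun i => ‖1 - rowSum k (c' i x)‖) l (𝓝 ‖1 - rowSum k (c x)‖))
    (h3 : ∀ x, Tendsto (fun i => ‖rowSum k (d' i x)‖) l (𝓝 ‖rowSum k (d x)‖))
    (h4 : ∀ x, Tendsto (fun i => ‖1 - rowSum k (d' i x)‖) l (𝓝 ‖1 - rowSum k (d x)‖))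
    (h5 : ∀ x y a b, Tendsto (fun i => ‖absFourComm (c' i x a) (d' i y b)‖) l
      (𝓝 ‖absFourComm (c x a) (d y b)‖))
    (h6 : Tendsto (fun i => ‖gameOpFour N k S V (c' i) (d' i)‖) l
      (𝓝 ‖gameOpFour N k S V c d‖)) :
    ∀ᶠ i in l, IsApproxStrategy n k N S V ε δ (c' i) (d' i) := by
  have aux : ∀ {p : ℕ → ι → Prop}, (∀ x < n, ∀ᶠ i in l, p x i) → ∀ᶠ i in l, ∀ x < n, p x i := by
    intro p hp
    have := (Filter.eventually_all_finset (l := l) (p := p) (Finset.range n)).2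
      (fun x hx => hp x (Finset.mem_range.1 hx))
    simpa using this
  filter_upwards [aux fun x hx => (h1 x).eventually (gt_mem_nhds (h.left x hx)),
    aux fun x hx => (h2 x).eventually (gt_mem_nhds (h.left' x hx)),
    aux fun x hx => (h3 x).eventually (gt_mem_nhds (h.right x hx)),
    aux fun x hx => (h4 x).eventually (gt_mem_nhds (h.right' x hx)),
    aux fun x hx => aux fun y hy => ((tendsto_finsetSum (Finset.range k) fun a _ =>
      tendsto_finsetSum (Finset.range k) fun b _ => h5 x y a b).add_const _).eventually
        (gt_mem_nhds (h.comm x hx y hy)),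
    h6.eventually (lt_mem_nhds h.value)] with i g1 g2 g3 g4 g5 g6
  exact ⟨g1, g2, g3, g4, g5, g6⟩

/-- Approximate strategies in separable C*-algebras can be moved to locally universal ones. -/
theorem IsApproxStrategy.exists_of_locallyUniversal {A C : Type} [CStarAlgebra A] [Nontrivial A]
    [TopologicalSpace.SeparableSpace A] [CStarAlgebra C] (hC : LocallyUniversal C)
    {c d : ℕ → ℕ → A} (h : IsApproxStrategy n k N S V ε δ c d) :
    ∃ c' d' : ℕ → ℕ → C, IsApproxStrategy n k N S V ε δ c' d' := by
  obtain ⟨U, -, φ, hφ⟩ := hC A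
  let q : (ℕ →ᵇ C) →+* Ultrapower U C := Ideal.Quotient.mk (nullIdeal U C)
  have hq : ∀ x, q (star x) = star (q x) := fun x => (star_mk U C x).symm
  choose X hX using fun x a => Ideal.Quotient.mk_surjective (I := nullIdeal U C) (φ (c x a))
  choose Y hY using fun x a => Ideal.Quotient.mk_surjective (I := nullIdeal U C) (φ (d x a))
  -- Evaluation at a coordinate is a ring homomorphism that respects the involution, so it commutes
  -- with all expressions in the system.
  let ev : ℕ → (ℕ →ᵇ C) →+* C := fun m =>
    { toFun := fun x => x m
      map_one' := rfl
      map_mul' := fun _ _ => rfl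
      map_zero' := rfl
      map_add' := fun _ _ => rfl }
  have hev : ∀ m x, ev m (star x) = star (ev m x) := fun m x => rfl
  have hφs : ∀ x, (φ : A →+* Ultrapower U C) (star x) = star ((φ : A →+* Ultrapower U C) x) :=
    fun x => map_star φ x
  have key : ∀ (z : A) (w : ℕ →ᵇ C), q w = (φ : A →+* Ultrapower U C) z →
      Tendsto (fun m => ‖ev m w‖) (U : Filter ℕ) (𝓝 ‖z‖) := fun z w hw =>
    tendsto_norm_of_injective hφ hw
  have h1 : ∀ x, q (rowSum k (X x)) = (φ : A →+* Ultrapower U C) (rowSum k (c x)) := fun x => by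
    rw [map_rowSum q hq, map_rowSum _ hφs]
    exact congrArg _ (funext fun a => hX x a)
  have h3 : ∀ x, q (rowSum k (Y x)) = (φ : A →+* Ultrapower U C) (rowSum k (d x)) := fun x => by
    rw [map_rowSum q hq, map_rowSum _ hφs]
    exact congrArg _ (funext fun a => hY x a)
  obtain ⟨m, hm⟩ := (h.eventually (l := (U : Filter ℕ)) (c' := fun m x a => ev m (X x a))
    (d' := fun m x a => ev m (Y x a))
    (fun x => by simpa only [map_rowSum _ (hev _)] using key _ _ (h1 x))
    (fun x => by
      simpa only [map_rowSum _ (hev _), map_sub, map_one] using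
        key (1 - rowSum k (c x)) (1 - rowSum k (X x)) (by rw [map_sub, map_sub, h1, map_one, map_one]))
    (fun x => by simpa only [map_rowSum _ (hev _)] using key _ _ (h3 x))
    (fun x => by
      simpa only [map_rowSum _ (hev _), map_sub, map_one] using
        key (1 - rowSum k (d x)) (1 - rowSum k (Y x)) (by rw [map_sub, map_sub, h3, map_one, map_one]))
    (fun x y a b => by
      simpa only [map_absFourComm _ (hev _)] using
        key (absFourComm (c x a) (d y b)) (absFourComm (X x a) (Y y b)) (by
          rw [map_absFourComm q hq, map_absFourComm _ hφs]
          exact congrArg₂ _ (hX x a) (hY y b)))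
    (by
      simpa only [map_gameOpFour _ (hev _)] using
        key (gameOpFour N k S V c d) (gameOpFour N k S V X Y) (by
          rw [map_gameOpFour q hq, map_gameOpFour _ hφs]
          exact congrArg₂ _ (funext fun x => funext fun a => hX x a)
            (funext fun x => funext fun a => hY x a)))).exists
  exact ⟨_, _, hm⟩

/-- The array of rational `*`-polynomials with a given code. -/
def polyArray (G : List (List RatStarPoly)) (x a : ℕ) : RatStarPoly := (G.getD x []).getD a []

theorem exists_polyArray_eq (n k : ℕ) (p : ℕ → ℕ → RatStarPoly) :
    ∃ G, ∀ x < n, ∀ a < k, polyArray G x a = p x a :=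
  ⟨(List.range n).map fun x => (List.range k).map (p x), fun x hx a ha => by
    simp [polyArray, List.getD_eq_getElem?_getD, hx, ha]⟩

/-- Approximate strategies can be approximated by rational points of a presentation. -/
theorem IsApproxStrategy.exists_rational (h : IsApproxStrategy n k N S V ε δ c d)
    (hV : ∀ x y a b, V x y a b = true → x < n ∧ y < n) {a : ℕ → D} (ha : IsPresentation a) :
    ∃ G₁ G₂, IsApproxStrategy n k N S V ε δ (fun x i => (polyArray G₁ x i).eval a)
      (fun x i => (polyArray G₂ x i).eval a) := by
  have happrox : ∀ z : D, ∃ p : ℕ → RatStarPoly, Tendsto (fun j => (p j).eval a) atTop (𝓝 z) := by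
    intro z
    choose p hp using fun j : ℕ => ha.exists_near z (ε := 1 / ((j : ℝ) + 1)) (by positivity)
    refine ⟨p, ?_⟩
    rw [tendsto_iff_norm_sub_tendsto_zero]
    refine squeeze_zero (fun _ => norm_nonneg _) (fun j => ?_)
      tendsto_one_div_add_atTop_nhds_zero_nat
    rw [norm_sub_rev]
    exact (hp j).le
  choose p hp using fun x i => happrox (c x i)
  choose q hq using fun x i => happrox (d x i)
  have hp' : ∀ x, Tendsto (fun j i => (p x i j).eval a) atTop (𝓝 (c x)) := fun x =>
    tendsto_pi_nhds.2 fun i => hp x i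
  have hq' : ∀ x, Tendsto (fun j i => (q x i j).eval a) atTop (𝓝 (d x)) := fun x =>
    tendsto_pi_nhds.2 fun i => hq x i
  have hp'' : Tendsto (fun j x i => (p x i j).eval a) atTop (𝓝 c) := tendsto_pi_nhds.2 hp'
  have hq'' : Tendsto (fun j x i => (q x i j).eval a) atTop (𝓝 d) := tendsto_pi_nhds.2 hq'
  have h1 := fun x => ((continuous_rowSum k).tendsto (c x)).comp (hp' x)
  have h3 := fun x => ((continuous_rowSum k).tendsto (d x)).comp (hq' x)
  obtain ⟨j, hj⟩ := (h.eventually (l := atTop) (c' := fun j x i => (p x i j).eval a)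
    (d' := fun j x i => (q x i j).eval a)
    (fun x => (h1 x).norm) (fun x => ((h1 x).const_sub 1).norm)
    (fun x => (h3 x).norm) (fun x => ((h3 x).const_sub 1).norm)
    (fun x y i i' => ((continuous_absFourComm.tendsto (c x i, d y i')).comp
      ((hp x i).prodMk_nhds (hq y i'))).norm)
    (((continuous_gameOpFour N k S V).tendsto (c, d)).comp
      (hp''.prodMk_nhds hq'')).norm).exists
  obtain ⟨G₁, hG₁⟩ := exists_polyArray_eq n k fun x i => p x i j
  obtain ⟨G₂, hG₂⟩ := exists_polyArray_eq n k fun x i => q x i j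
  exact ⟨G₁, G₂, hj.congr hV (fun x hx i hi => by rw [hG₁ x hx i hi])
    (fun x hx i hi => by rw [hG₂ x hx i hi])⟩

end

end KEP

end

noncomputable section

namespace KEP

/-! ## States and square roots -/

section Ordered

variable {C : Type*} [CStarAlgebra C] [PartialOrder C] [StarOrderedRing C]

open scoped ComplexOrder in
/-- Norms of positive elements are approximated by states. -/
theorem exists_state_lt {V : C} (hV : 0 ≤ V) {r : ℝ} (hr : 0 ≤ r) (h : r < ‖V‖) :
    ∃ φ : C →ₚ[ℂ] ℂ, φ 1 = 1 ∧ r < (φ V).re := by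
  let K := ProperCone.positive ℝ C
  -- If r - V were positive, then ‖V‖ ≤ r. Hence Hahn–Banach gives a real functional that is
  -- nonnegative on the positive cone and negative at r - V.
  have hK : algebraMap ℝ C r - V ∉ K := by
    intro hmem
    have h1 : (0 : C) ≤ algebraMap ℝ C r - V := hmem
    exact absurd ((CStarAlgebra.norm_le_iff_le_algebraMap V hr hV).2 (sub_nonneg.1 h1)) (not_le.2 h)
  obtain ⟨f, hf, hf0⟩ := K.hyperplane_separation_point hK
  have hpos : ∀ x : C, 0 ≤ x → 0 ≤ f x := fun x hx => hf x hx
  have h1 : f (algebraMap ℝ C r) = r * f 1 := by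
    rw [Algebra.algebraMap_eq_smul_one, map_smul, smul_eq_mul]
  rw [map_sub, h1] at hf0
  -- If f 1 = 0, then V ≤ ‖V‖ · 1 forces f V ≤ 0, contrary to f (r - V) < 0.
  have hf1 : 0 < f 1 := by
    refine (hpos 1 zero_le_one).lt_of_ne fun h0 => ?_
    have h2 : V ≤ algebraMap ℝ C ‖V‖ := IsSelfAdjoint.le_algebraMap_norm_self
    have h3 := hpos _ (sub_nonneg.2 h2)
    rw [map_sub, Algebra.algebraMap_eq_smul_one, map_smul, ← h0] at h3
    simp only [smul_eq_mul, mul_zero] at h3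
    rw [← h0] at hf0
    linarith
  -- The functional is normalized at 1, extended to all of `C` through the real part, and then made
  -- complex linear.
  let g : Module.Dual ℝ C :=
    (f 1)⁻¹ • (f.toLinearMap ∘ₗ (selfAdjoint.submodule ℝ C).subtype ∘ₗ realPart)
  have hg : ∀ x : C, g x = (f 1)⁻¹ * f (realPart x : C) := fun x => rfl
  have hgsa : ∀ x : C, IsSelfAdjoint x → g.extendRCLike (𝕜 := ℂ) x = ((f 1)⁻¹ * f x : ℝ) := by
    intro x hx
    rw [Module.Dual.extendRCLike_apply, hg, hg, hx.coe_realPart]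
    have : (realPart ((RCLike.I : ℂ) • x : C) : C) = 0 := by
      change (realPart (Complex.I • x : C) : C) = 0
      rw [realPart_I_smul, hx.imaginaryPart]
      simp
    rw [this]
    simp
  refine ⟨PositiveLinearMap.mk₀ (g.extendRCLike (𝕜 := ℂ)) fun x hx => ?_, ?_, ?_⟩
  · rw [hgsa x hx.isSelfAdjoint, Complex.zero_le_real]
    exact mul_nonneg (inv_nonneg.2 hf1.le) (hpos x hx)
  · change g.extendRCLike (𝕜 := ℂ) 1 = 1
    rw [hgsa 1 (.one C), inv_mul_cancel₀ hf1.ne', Complex.ofReal_one]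
  · change r < (g.extendRCLike (𝕜 := ℂ) V).re
    rw [hgsa V hV.isSelfAdjoint, Complex.ofReal_re, inv_mul_eq_div, lt_div_iff₀ hf1]
    linarith

theorem sqrt_eq_cfc_sqrt {A : C} (hA : 0 ≤ A) : sqrt A = CFC.sqrt A := by
  rw [CFC.sqrt_eq_real_sqrt A hA, cfcₙ_eq_cfc (hf := Real.continuous_sqrt.continuousOn)]
  rfl

theorem sqrt_nonneg {A : C} (hA : 0 ≤ A) : 0 ≤ sqrt A := by
  rw [sqrt_eq_cfc_sqrt hA]; exact CFC.sqrt_nonneg A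

theorem sqrt_mul_sqrt {A : C} (hA : 0 ≤ A) : sqrt A * sqrt A = A := by
  rw [sqrt_eq_cfc_sqrt hA]; exact CFC.sqrt_mul_sqrt_self A hA

theorem sqrt_mul_self {A : C} (hA : 0 ≤ A) : sqrt (A * A) = A := by
  rw [sqrt_eq_cfc_sqrt hA.isSelfAdjoint.mul_self_nonneg]; exact CFC.sqrt_mul_self A hA

theorem sqrt_mono {A B : C} (hA : 0 ≤ A) (h : A ≤ B) : sqrt A ≤ sqrt B := by
  rw [sqrt_eq_cfc_sqrt hA, sqrt_eq_cfc_sqrt (hA.trans h)]; exact CFC.sqrt_le_sqrt A B h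

theorem map_sqrt {D : Type*} [CStarAlgebra D] (φ : C →⋆ₐ[ℂ] D) {A : C} (hA : 0 ≤ A) :
    φ (sqrt A) = sqrt (φ A) :=
  StarAlgHomClass.map_cfc φ Real.sqrt A Real.continuous_sqrt.continuousOn
    (AddMonoidHomClass.continuous_of_bound φ 1 fun a => by
      simpa using NonUnitalStarAlgHom.norm_apply_le φ a) hA.isSelfAdjoint
    (hA.isSelfAdjoint.map φ)

theorem norm_le_of_le_algebraMap {x : C} (hx : 0 ≤ x) {r : ℝ} (hr : 0 ≤ r)
    (h : x ≤ algebraMap ℝ C r) : ‖x‖ ≤ r :=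
  (CStarAlgebra.norm_le_iff_le_algebraMap x hr hx).2 h

/-- From h² ≤ A ≤ h² + ε² ≤ (h + ε)² operator monotonicity of the square root gives h ≤ A^{1/2} ≤ h
+ ε. No commutation of `A` and `h` is needed. -/
theorem norm_sqrt_sub_le {A h : C} (hh : 0 ≤ h) (h1 : h * h ≤ A) {ε : ℝ} (hε : 0 ≤ ε)
    (h2 : A ≤ h * h + algebraMap ℝ C (ε ^ 2)) : ‖sqrt A - h‖ ≤ ε := by
  have h0 : 0 ≤ h * h := hh.isSelfAdjoint.mul_self_nonneg
  have h3 : h ≤ sqrt A := by simpa only [sqrt_mul_self hh] using sqrt_mono h0 h1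
  have hε' : 0 ≤ algebraMap ℝ C ε := algebraMap_nonneg C hε
  have h4 : A ≤ (h + algebraMap ℝ C ε) * (h + algebraMap ℝ C ε) := by
    refine h2.trans ?_
    have h5 : (h + algebraMap ℝ C ε) * (h + algebraMap ℝ C ε) =
        h * h + algebraMap ℝ C (ε ^ 2) + (2 * ε) • h := by
      rw [Algebra.algebraMap_eq_smul_one, Algebra.algebraMap_eq_smul_one]
      simp only [add_mul, mul_add, smul_mul_assoc, mul_smul_comm, one_mul, mul_one]
      module
    rw [h5]
    exact le_add_of_nonneg_right (smul_nonneg (by positivity) hh)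
  have h6 := sqrt_mono (h0.trans h1) h4
  rw [sqrt_mul_self (add_nonneg hh hε')] at h6
  exact norm_le_of_le_algebraMap (sub_nonneg.2 h3) hε (sub_le_iff_le_add'.2 h6)

theorem isPOVM_iff {k : ℕ} {A : Fin k → C} : IsPOVM A ↔ (∀ a, 0 ≤ A a) ∧ ∑ a, A a = 1 := by
  simp only [IsPOVM, CStarAlgebra.nonneg_iff_eq_star_mul_self]

theorem absFour_nonneg (c : C) : 0 ≤ absFour c :=
  (IsSelfAdjoint.star_mul_self c).mul_self_nonneg

theorem symProd_nonneg {A B : C} (hA : 0 ≤ A) (hB : 0 ≤ B) :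
    0 ≤ sqrt A * B * sqrt A + sqrt B * A * sqrt B :=
  add_nonneg ((sqrt_nonneg hA).isSelfAdjoint.conjugate_nonneg hB)
    ((sqrt_nonneg hB).isSelfAdjoint.conjugate_nonneg hA)

end Ordered

/-! ## From strategies in C*-algebras to strategies on Hilbert spaces -/

section Hilbert

variable {𝔊 : NonlocalGame}

open scoped ComplexOrder InnerProductSpace in
/-- By the GNS construction, a strategy in a C*-algebra yields a strategy on a Hilbert space. -/
theorem Strategy.exists_hilbert {C : Type} [CStarAlgebra C] (σ : Strategy 𝔊 C) {δ : ℝ}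
    (hσ : σ.OpAlmostCommuting δ) :
    ∃ (H : Type) (_ : NormedAddCommGroup H) (_ : InnerProductSpace ℂ H) (_ : CompleteSpace H)
      (τ : Strategy 𝔊 (H →L[ℂ] H)), τ.OpAlmostCommuting δ ∧ τ.value = σ.value := by
  let _ := CStarAlgebra.spectralOrder C
  let _ := CStarAlgebra.spectralOrderedRing C
  let φ : C →ₚ[ℂ] ℂ := PositiveLinearMap.mk₀ σ.φ fun x hx => by
    obtain ⟨z, rfl⟩ := CStarAlgebra.nonneg_iff_eq_star_mul_self.1 hx
    exact Complex.nonneg_iff.2 ⟨(σ.isState.1 z).1, (σ.isState.1 z).2.symm⟩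
  let π := φ.gnsStarAlgHom
  let ξ : φ.GNS := ((φ.toPreGNS 1 : φ.PreGNS) : UniformSpace.Completion φ.PreGNS)
  let ψ : (φ.GNS →L[ℂ] φ.GNS) →ₗ[ℂ] ℂ :=
    { toFun := fun T => ⟪ξ, T ξ⟫_ℂ
      map_add' := fun S T => by simp [inner_add_right]
      map_smul' := fun c T => by simp [inner_smul_right] }
  have hψ : ∀ T, ψ T = ⟪ξ, T ξ⟫_ℂ := fun _ => rfl
  have hπ : ∀ c, ψ (π c) = σ.φ c := by
    intro c
    have h1 : π c ξ = ((φ.leftMulMapPreGNS c (φ.toPreGNS 1) : φ.PreGNS) :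
        UniformSpace.Completion φ.PreGNS) := φ.gnsNonUnitalStarAlgHom_apply_coe
    rw [hψ, h1]
    refine (UniformSpace.Completion.inner_coe _ _).trans ?_
    rw [PositiveLinearMap.preGNS_inner_def]
    change σ.φ (star (1 : C) * (c * 1)) = _
    simp
  have hψs : IsState ψ := by
    refine ⟨fun z => ?_, ?_⟩
    · have h1 : ψ (star z * z) = ⟪z ξ, z ξ⟫_ℂ := by
        rw [hψ, mul_apply_eq_comp, ContinuousLinearMap.star_eq_adjoint,
          ContinuousLinearMap.adjoint_inner_right]
      rw [h1, inner_self_eq_norm_sq_to_K]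
      exact ⟨by norm_cast; exact sq_nonneg _, by norm_cast⟩
    · rw [← map_one π, hπ, σ.isState.2]
  have hPOVM : ∀ A : Fin 𝔊.k → C, IsPOVM A → IsPOVM fun a => π (A a) := by
    refine fun A hA => ⟨fun a => ?_, ?_⟩
    · obtain ⟨z, hz⟩ := hA.1 a
      exact ⟨π z, by simp only [hz, map_mul, map_star]⟩
    · rw [← map_sum, hA.2, map_one]
  let τ : Strategy 𝔊 (φ.GNS →L[ℂ] φ.GNS) :=
    { A := fun x a => π (σ.A x a)
      B := fun y b => π (σ.B y b)
      φ := ψ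
      isMeasurement_A := fun x => hPOVM _ (σ.isMeasurement_A x)
      isMeasurement_B := fun y => hPOVM _ (σ.isMeasurement_B y)
      isState := hψs }
  refine ⟨φ.GNS, inferInstance, inferInstance, inferInstance, τ, fun x y => ?_, ?_⟩
  -- The GNS representation is contractive, so commutators do not grow.
  · refine lt_of_le_of_lt (Finset.sum_le_sum fun a _ => Finset.sum_le_sum fun b _ => ?_) (hσ x y)
    change ‖π _ * π _ - π _ * π _‖ ≤ _
    rw [← map_mul, ← map_mul, ← map_sub]
    exact NonUnitalStarAlgHom.norm_apply_le π _
  -- `*`-homomorphisms commute with the functional calculus, hence with `symProd`, and the vector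
  -- state of ξ pulls back to the given state.
  · have hcorr : ∀ x y a b, τ.corr x y a b = σ.corr x y a b := by
      intro x y a b
      have hA := (isPOVM_iff.1 (σ.isMeasurement_A x)).1 a
      have hB := (isPOVM_iff.1 (σ.isMeasurement_B y)).1 b
      have : symProd (τ.A x a) (τ.B y b) = π (symProd (σ.A x a) (σ.B y b)) := by
        simp only [symProd, map_smul, map_add, map_mul, map_sqrt π hA, map_sqrt π hB]
        rfl
      change (ψ _).re = _
      rw [this, hπ]
      rfl
    simp only [Strategy.value, hcorr]

theorem IsState.re_nonneg {C : Type*} [CStarAlgebra C] [PartialOrder C] [StarOrderedRing C]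
    {φ : C →ₗ[ℂ] ℂ} (hφ : IsState φ) {V : C} (hV : 0 ≤ V) : 0 ≤ (φ V).re := by
  obtain ⟨z, rfl⟩ := CStarAlgebra.nonneg_iff_eq_star_mul_self.1 hV
  exact (hφ.1 z).1

theorem IsState.re_mono {C : Type*} [CStarAlgebra C] [PartialOrder C] [StarOrderedRing C]
    {φ : C →ₗ[ℂ] ℂ} (hφ : IsState φ) {V W : C} (h : V ≤ W) : (φ V).re ≤ (φ W).re := by
  have := hφ.re_nonneg (sub_nonneg.2 h)
  rwa [map_sub, Complex.sub_re, sub_nonneg] at this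

theorem IsState.re_le_norm {C : Type*} [CStarAlgebra C] [PartialOrder C] [StarOrderedRing C]
    {φ : C →ₗ[ℂ] ℂ} (hφ : IsState φ) {V : C} (hV : IsSelfAdjoint V) : (φ V).re ≤ ‖V‖ := by
  have h1 := hφ.re_mono (IsSelfAdjoint.le_algebraMap_norm_self (a := V) hV)
  rwa [IsScalarTower.algebraMap_apply ℝ ℂ C, Algebra.algebraMap_eq_smul_one (A := C), map_smul,
    hφ.2, smul_eq_mul, mul_one, Complex.coe_algebraMap, Complex.ofReal_re] at h1

/-- Summing A^{1/2} B_b A^{1/2} over b gives A and then 1, and likewise for the other half, so the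
correlations form a probability distribution. This bounds the supremum that defines the commuting
value. -/
theorem Strategy.value_le_one {C : Type*} [CStarAlgebra C] (σ : Strategy 𝔊 C) : σ.value ≤ 1 := by
  let _ := CStarAlgebra.spectralOrder C
  let _ := CStarAlgebra.spectralOrderedRing C
  have hA := fun x => isPOVM_iff.1 (σ.isMeasurement_A x)
  have hB := fun x => isPOVM_iff.1 (σ.isMeasurement_B x)
  have hcorr : ∀ x y a b, 0 ≤ σ.corr x y a b := by
    intro x y a b
    refine σ.isState.re_nonneg ?_
    have := symProd_nonneg ((hA x).1 a) ((hB y).1 b)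
    have h2 : symProd (σ.A x a) (σ.B y b) = (2⁻¹ : ℝ) • (sqrt (σ.A x a) * σ.B y b * sqrt (σ.A x a) +
        sqrt (σ.B y b) * σ.A x a * sqrt (σ.B y b)) := by
      rw [symProd, ← Complex.coe_smul]; norm_num
    rw [h2]
    exact smul_nonneg (by norm_num) this
  have hsum : ∀ x y, ∑ a, ∑ b, σ.corr x y a b = 1 := by
    intro x y
    have : ∑ a, ∑ b, symProd (σ.A x a) (σ.B y b) = 1 := by
      simp only [symProd, ← Finset.smul_sum, Finset.sum_add_distrib, ← Finset.mul_sum,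
        ← Finset.sum_mul, (hB y).2, mul_one, sqrt_mul_sqrt ((hA x).1 _), (hA x).2]
      rw [Finset.sum_comm]
      simp only [← Finset.mul_sum, ← Finset.sum_mul, (hA x).2, mul_one,
        sqrt_mul_sqrt ((hB y).1 _), (hB y).2]
      rw [← two_smul ℂ (1 : C), smul_smul]
      norm_num
    simp only [Strategy.corr, ← Complex.re_sum, ← map_sum, this, σ.isState.2, Complex.one_re]
  calc σ.value ≤ ∑ x, ∑ y, 𝔊.prob x y * ∑ a, ∑ b, σ.corr x y a b := by
        refine Finset.sum_le_sum fun x _ => Finset.sum_le_sum fun y _ =>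
          mul_le_mul_of_nonneg_left (Finset.sum_le_sum fun a _ => Finset.sum_le_sum fun b _ => ?_)
            (𝔊.prob_nonneg x y)
        have := hcorr x y a b
        split_ifs <;> simp [this]
    _ = 1 := by simp only [hsum, mul_one, 𝔊.sum_prob]

theorem Strategy.value_le_opCommutingValue {C : Type} [CStarAlgebra C] (σ : Strategy 𝔊 C) {δ : ℝ}
    (hσ : σ.OpAlmostCommuting δ) : σ.value ≤ opCommutingValue δ 𝔊 := by
  obtain ⟨H, i1, i2, i3, τ, hτ, hv⟩ := σ.exists_hilbert hσ
  rw [← hv]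
  refine le_csSup ⟨1, ?_⟩ ⟨H, i1, i2, i3, τ, hτ, rfl⟩
  rintro v ⟨H, _, _, _, τ, -, rfl⟩
  exact τ.value_le_one

end Hilbert

end KEP

end

noncomputable section

namespace KEP

/-! ## Soundness of approximate strategies -/

/-- A presentation of the distribution and of the predicate of a game by a sampler with `N` seeds
and a predicate on natural numbers. -/
structure NonlocalGame.IsSampledBy (𝔊 : NonlocalGame) (N : ℕ) (S : ℕ → ℕ × ℕ)
    (V : ℕ → ℕ → ℕ → ℕ → Bool) : Prop where
  prob_eq : ∀ x y : Fin 𝔊.n, 𝔊.prob x y =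
    (((Finset.range N).filter fun s => S s = ((x : ℕ), (y : ℕ))).card : ℝ) / (N : ℝ)
  lt_of_eq_true : ∀ x y a b, V x y a b = true → x < 𝔊.n ∧ y < 𝔊.n
  eq_D : ∀ (x y : Fin 𝔊.n) (a b : Fin 𝔊.k), V x y a b = 𝔊.D x y a b

section Sampled

variable {𝔊 : NonlocalGame} {N : ℕ} {S : ℕ → ℕ × ℕ} {V : ℕ → ℕ → ℕ → ℕ → Bool}

/-- The seeds are sorted by the pair of questions they produce; pairs out of range contribute
nothing because `V` is false there. -/
theorem NonlocalGame.IsSampledBy.sum_eq (h : 𝔊.IsSampledBy N S V) (F : ℕ → ℕ → ℕ → ℕ → ℝ) :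
    (N : ℝ) * ∑ x, ∑ y, 𝔊.prob x y * ∑ a, ∑ b, (if 𝔊.D x y a b then 1 else 0) * F x y a b =
      ∑ s ∈ Finset.range N, ∑ a ∈ Finset.range 𝔊.k, ∑ b ∈ Finset.range 𝔊.k,
        if V (S s).1 (S s).2 a b = true then F (S s).1 (S s).2 a b else 0 := by
  let g : ℕ × ℕ → ℝ := fun q => ∑ a ∈ Finset.range 𝔊.k, ∑ b ∈ Finset.range 𝔊.k,
    if V q.1 q.2 a b = true then F q.1 q.2 a b else 0
  have hg0 : ∀ q, ¬ (q.1 < 𝔊.n ∧ q.2 < 𝔊.n) → g q = 0 := fun q hq =>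
    Finset.sum_eq_zero fun a _ => Finset.sum_eq_zero fun b _ =>
      if_neg fun h1 => hq (h.lt_of_eq_true _ _ _ _ h1)
  have hg : ∀ q, g q = ∑ x : Fin 𝔊.n, ∑ y : Fin 𝔊.n,
      if q = ((x : ℕ), (y : ℕ)) then g (x, y) else 0 := by
    rintro ⟨p, q⟩
    by_cases hq : p < 𝔊.n ∧ q < 𝔊.n
    · rw [Finset.sum_eq_single ⟨p, hq.1⟩, Finset.sum_eq_single ⟨q, hq.2⟩]
      · simp
      · intro y _ hy
        rw [if_neg]
        simpa [Fin.ext_iff, eq_comm] using hy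
      · simp
      · intro x _ hx
        refine Finset.sum_eq_zero fun y _ => if_neg ?_
        simp only [Prod.mk.injEq, not_and]
        intro h1
        exact absurd (Fin.ext h1.symm) hx
      · simp
    · rw [hg0 _ hq]
      refine (Finset.sum_eq_zero fun x _ => Finset.sum_eq_zero fun y _ => if_neg ?_).symm
      rintro h1
      obtain ⟨rfl, rfl⟩ := Prod.mk.inj h1
      exact hq ⟨x.2, y.2⟩
  change _ = ∑ s ∈ Finset.range N, g (S s)
  rw [Finset.sum_congr rfl fun s (_ : s ∈ Finset.range N) => hg (S s)]
  symm
  rw [Finset.sum_comm, Finset.mul_sum]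
  refine Finset.sum_congr rfl fun x _ => ?_
  rw [Finset.sum_comm, Finset.mul_sum]
  refine Finset.sum_congr rfl fun y _ => ?_
  rw [← Finset.sum_filter, Finset.sum_const, nsmul_eq_mul, ← mul_assoc, h.prob_eq]
  have hN : (N : ℝ) * ((((Finset.range N).filter fun s => S s = ((x : ℕ), (y : ℕ))).card : ℝ) / N) =
      ((Finset.range N).filter fun s => S s = ((x : ℕ), (y : ℕ))).card := by
    rcases Nat.eq_zero_or_pos N with rfl | hN
    · simp
    · field_simp
  rw [hN]
  refine congrArg _ ?_
  simp only [g, Finset.sum_range, h.eq_D, ite_mul, one_mul, zero_mul]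

/-- The factor `N` turns probabilities into seed counts, and 2 cancels the 1/2 in `symProd`. -/
theorem Strategy.value_eq {C : Type*} [CStarAlgebra C] (h : 𝔊.IsSampledBy N S V)
    (σ : Strategy 𝔊 C) {A B : ℕ → ℕ → C} (hA : ∀ x a, σ.A x a = A x a)
    (hB : ∀ y b, σ.B y b = B y b) :
    2 * N * σ.value = (σ.φ (gameOp N 𝔊.k S V (fun x a => sqrt (A x a)) A
      (fun y b => sqrt (B y b)) B)).re := by
  have h1 : σ.value = ∑ x, ∑ y, 𝔊.prob x y * ∑ a, ∑ b, (if 𝔊.D x y a b then 1 else 0) *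
      (fun x y a b => (σ.φ (symProd (A x a) (B y b))).re) x y a b := by
    simp only [Strategy.value, Strategy.corr, hA, hB]
  rw [mul_assoc, h1, h.sum_eq fun x y a b => (σ.φ (symProd (A x a) (B y b))).re, gameOp]
  simp only [map_sum, Complex.re_sum, Finset.mul_sum, apply_ite σ.φ, apply_ite Complex.re, map_zero,
    Complex.zero_re]
  refine Finset.sum_congr rfl fun s _ => Finset.sum_congr rfl fun a _ =>
    Finset.sum_congr rfl fun b _ => ?_
  split_ifs
  · rw [symProd, map_smul, smul_eq_mul]
    have : (2⁻¹ : ℂ) = ((2⁻¹ : ℝ) : ℂ) := by push_cast; rfl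
    rw [this, Complex.re_ofReal_mul]
    ring
  · simp

end Sampled

/-! ### Correction of approximate POVMs and the resulting errors. -/

section POVM

variable {C : Type*} [CStarAlgebra C]

/-- The correction of the positive elements `absFour (c a)` to a POVM. -/
def povmOf (k : ℕ) (c : ℕ → C) (a : ℕ) : C :=
  absFour (c a) + (k : ℝ)⁻¹ • (1 - rowSum k c)

theorem sum_povmOf {k : ℕ} (hk : k ≠ 0) (c : ℕ → C) :
    ∑ a ∈ Finset.range k, povmOf k c a = 1 := by
  simp only [povmOf, Finset.sum_add_distrib, Finset.sum_const, Finset.card_range]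
  rw [← Nat.cast_smul_eq_nsmul ℝ, smul_smul, mul_inv_cancel₀ (Nat.cast_ne_zero.2 hk), one_smul]
  exact add_sub_cancel _ _

variable [PartialOrder C] [StarOrderedRing C]

theorem rowSum_nonneg (k : ℕ) (c : ℕ → C) : 0 ≤ rowSum k c :=
  Finset.sum_nonneg fun _ _ => absFour_nonneg _

/-- The positive contraction `A` is close to `h ^ 2`, and its square root is close to `h`. -/
structure IsClose (ε : ℝ) (h A : C) : Prop where
  nonneg : 0 ≤ A
  norm_root : ‖h‖ ≤ 1
  norm_sqrt : ‖sqrt A‖ ≤ 1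
  norm_le : ‖A‖ ≤ 1
  norm_sq : ‖h * h‖ ≤ 1
  root_sub : ‖sqrt A - h‖ ≤ ε
  sub : ‖A - h * h‖ ≤ ε

/-- The defect 1 - rowSum is positive because ‖rowSum‖ < 1, so each answer may receive an equal
share of it. Thus A = h² + E with 0 ≤ E ≤ ε², and `norm_sqrt_sub_le` applies. The norm bounds follow
from A ≤ 1, as A is one summand of a POVM. -/
theorem isClose_povmOf {k : ℕ} {c : ℕ → C} {ε : ℝ} (hε : 0 ≤ ε) (hε1 : ε ≤ 1)
    (h1 : ‖rowSum k c‖ < 1) (h2 : ‖1 - rowSum k c‖ < ε ^ 2) {a : ℕ} (ha : a < k) :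
    IsClose ε (star (c a) * c a) (povmOf k c a) := by
  have hk : k ≠ 0 := by omega
  have hk1 : (1 : ℝ) ≤ k := by exact_mod_cast Nat.one_le_iff_ne_zero.2 hk
  have hkinv : (k : ℝ)⁻¹ ≤ 1 := inv_le_one_of_one_le₀ hk1
  have hS1 : rowSum k c ≤ 1 := (CStarAlgebra.norm_le_one_iff_of_nonneg _ (rowSum_nonneg k c)).1 h1.le
  have hE : 0 ≤ (k : ℝ)⁻¹ • (1 - rowSum k c) := smul_nonneg (by positivity) (sub_nonneg.2 hS1)
  have hEn : ‖(k : ℝ)⁻¹ • (1 - rowSum k c)‖ ≤ ε ^ 2 := by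
    rw [norm_smul, Real.norm_of_nonneg (by positivity)]
    exact (mul_le_of_le_one_left (norm_nonneg _) hkinv).trans h2.le
  have hA : 0 ≤ povmOf k c a := add_nonneg (absFour_nonneg _) hE
  have hA1 : ‖povmOf k c a‖ ≤ 1 := by
    refine (CStarAlgebra.norm_le_one_iff_of_nonneg _ hA).2 ?_
    rw [← sum_povmOf hk c]
    exact Finset.single_le_sum (f := povmOf k c) (fun b _ => add_nonneg (absFour_nonneg _) hE)
      (Finset.mem_range.2 ha)
  have hh : 0 ≤ star (c a) * c a := star_mul_self_nonneg _
  have hle : star (c a) * c a * (star (c a) * c a) ≤ povmOf k c a := le_add_of_nonneg_right hE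
  have hsq : ‖star (c a) * c a * (star (c a) * c a)‖ ≤ 1 :=
    (CStarAlgebra.norm_le_norm_of_nonneg_of_le (absFour_nonneg _) hle).trans hA1
  refine ⟨hA, ?_, ?_, hA1, hsq, ?_, ?_⟩
  · have := CStarRing.norm_star_mul_self (x := star (c a) * c a)
    rw [hh.isSelfAdjoint.star_eq] at this
    nlinarith [norm_nonneg (star (c a) * c a)]
  · have := CStarRing.norm_star_mul_self (x := sqrt (povmOf k c a))
    rw [(sqrt_nonneg hA).isSelfAdjoint.star_eq, sqrt_mul_sqrt hA] at this
    nlinarith [norm_nonneg (sqrt (povmOf k c a))]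
  · refine norm_sqrt_sub_le hh hle hε ?_
    refine add_le_add_right ?_ _
    exact (CStarAlgebra.norm_le_iff_le_algebraMap _ (by positivity) hE).1 hEn
  · have : povmOf k c a - star (c a) * c a * (star (c a) * c a) =
        (k : ℝ)⁻¹ • (1 - rowSum k c) := add_sub_cancel_left _ _
    rw [this]
    nlinarith

omit [PartialOrder C] [StarOrderedRing C] in
theorem norm_mul_le_of_le' {a b : C} {s t : ℝ} (ha : ‖a‖ ≤ s) (hb : ‖b‖ ≤ t) :
    ‖a * b‖ ≤ s * t :=
  (norm_mul_le _ _).trans (mul_le_mul ha hb (norm_nonneg _) ((norm_nonneg _).trans ha))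

omit [PartialOrder C] [StarOrderedRing C] in
theorem norm_mul_mul_sub_le {ε : ℝ} {x y z x' y' z' : C} (hy : ‖y‖ ≤ 1)
    (hz : ‖z‖ ≤ 1) (hx' : ‖x'‖ ≤ 1) (hy' : ‖y'‖ ≤ 1) (h1 : ‖x - x'‖ ≤ ε) (h2 : ‖y - y'‖ ≤ ε)
    (h3 : ‖z - z'‖ ≤ ε) : ‖x * y * z - x' * y' * z'‖ ≤ 3 * ε := by
  have e : x * y * z - x' * y' * z' =
      (x - x') * y * z + x' * (y - y') * z + x' * y' * (z - z') := by noncomm_ring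
  rw [e]
  refine (norm_add₃_le).trans ?_
  have := norm_mul_le_of_le' (norm_mul_le_of_le' h1 hy) hz
  have := norm_mul_le_of_le' (norm_mul_le_of_le' hx' h2) hz
  have := norm_mul_le_of_le' (norm_mul_le_of_le' hx' hy') h3
  linarith

-- Each of the two products in the commutator changes by at most 2ε when its factors are replaced
-- one at a time.
omit [StarOrderedRing C] in
theorem IsClose.norm_comm_le {ε : ℝ} {h A g B : C} (hA : IsClose ε h A) (hB : IsClose ε g B) :
    ‖A * B - B * A‖ ≤ ‖h * h * (g * g) - g * g * (h * h)‖ + 4 * ε := by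
  have e : A * B - B * A = (h * h * (g * g) - g * g * (h * h)) + ((A - h * h) * B +
      h * h * (B - g * g)) - ((B - g * g) * A + g * g * (A - h * h)) := by noncomm_ring
  rw [e]
  have h1 := norm_sub_le ((h * h * (g * g) - g * g * (h * h)) + ((A - h * h) * B +
      h * h * (B - g * g))) ((B - g * g) * A + g * g * (A - h * h))
  have h2 := norm_add_le (h * h * (g * g) - g * g * (h * h)) ((A - h * h) * B +
      h * h * (B - g * g))
  have h3 := norm_add_le ((A - h * h) * B) (h * h * (B - g * g))
  have h4 := norm_add_le ((B - g * g) * A) (g * g * (A - h * h))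
  have := norm_mul_le_of_le' hA.sub hB.norm_le
  have := norm_mul_le_of_le' hA.norm_sq hB.sub
  have := norm_mul_le_of_le' hB.sub hA.norm_le
  have := norm_mul_le_of_le' hB.norm_sq hA.sub
  linarith

-- Each of the two triple products telescopes into three errors of size ε; the total 6ε is rounded
-- up to 8ε.
omit [StarOrderedRing C] in
theorem IsClose.norm_symm_sub_le {ε : ℝ} {h A g B : C} (hA : IsClose ε h A) (hB : IsClose ε g B) :
    ‖(sqrt A * B * sqrt A + sqrt B * A * sqrt B) - (h * (g * g) * h + g * (h * h) * g)‖ ≤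
      8 * ε := by
  have h1 := norm_mul_mul_sub_le hB.norm_le hA.norm_sqrt hA.norm_root hB.norm_sq hA.root_sub hB.sub
    hA.root_sub
  have h2 := norm_mul_mul_sub_le hA.norm_le hB.norm_sqrt hB.norm_root hA.norm_sq hB.root_sub hA.sub
    hB.root_sub
  rw [add_sub_add_comm]
  have h3 := (norm_nonneg _).trans hA.sub
  refine (norm_add_le _ _).trans ?_
  linarith

end POVM

open scoped ComplexOrder in
/-- An approximate strategy in a C*-algebra shows that the value of the game is large. -/
theorem IsApproxStrategy.lt_opCommutingValue {𝔊 : NonlocalGame} {N : ℕ} {S : ℕ → ℕ × ℕ}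
    {V : ℕ → ℕ → ℕ → ℕ → Bool} (hG : 𝔊.IsSampledBy N S V) {ε δ : ℝ} (hε : 0 < ε) (hε1 : ε ≤ 1)
    {C : Type} [CStarAlgebra C] {c d : ℕ → ℕ → C}
    (h : IsApproxStrategy 𝔊.n 𝔊.k N S V ε δ c d) : 1 / 2 < opCommutingValue δ 𝔊 := by
  let _ := CStarAlgebra.spectralOrder C
  let _ := CStarAlgebra.spectralOrderedRing C
  -- With no answers the game operator is zero and cannot have norm above `N`. A positive number of
  -- answers is needed to spread the defect.
  have hk : 𝔊.k ≠ 0 := by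
    intro hk
    have := h.value
    simp only [hk, gameOpFour, gameOp, Finset.range_zero, Finset.sum_empty, Finset.sum_const_zero,
      norm_zero] at this
    have h0 : (0 : ℝ) ≤ N := N.cast_nonneg
    norm_num at this
    linarith
  have hA : ∀ x < 𝔊.n, ∀ a < 𝔊.k, IsClose ε (star (c x a) * c x a) (povmOf 𝔊.k (c x) a) :=
    fun x hx a ha => isClose_povmOf hε.le hε1 (h.left x hx) (h.left' x hx) ha
  have hB : ∀ x < 𝔊.n, ∀ a < 𝔊.k, IsClose ε (star (d x a) * d x a) (povmOf 𝔊.k (d x) a) :=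
    fun x hx a ha => isClose_povmOf hε.le hε1 (h.right x hx) (h.right' x hx) ha
  set W := gameOp N 𝔊.k S V (fun x a => sqrt (povmOf 𝔊.k (c x) a)) (fun x a => povmOf 𝔊.k (c x) a)
    (fun y b => sqrt (povmOf 𝔊.k (d y) b)) (fun y b => povmOf 𝔊.k (d y) b) with hW
  have hW0 : 0 ≤ W := by
    refine Finset.sum_nonneg fun s _ => Finset.sum_nonneg fun a ha => Finset.sum_nonneg fun b hb => ?_
    split_ifs with hv
    · obtain ⟨hx, hy⟩ := hG.lt_of_eq_true _ _ _ _ hv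
      exact symProd_nonneg (hA _ hx _ (Finset.mem_range.1 ha)).nonneg
        (hB _ hy _ (Finset.mem_range.1 hb)).nonneg
    · exact le_rfl
  have hWd : ‖W - gameOpFour N 𝔊.k S V c d‖ ≤ 8 * N * 𝔊.k ^ 2 * ε := by
    rw [hW, gameOpFour, gameOp, gameOp]
    simp only [← Finset.sum_sub_distrib]
    refine (norm_sum_le_of_le (f := fun s => _) (n := fun _ => 𝔊.k * (𝔊.k * (8 * ε))) _
      fun s _ => ?_).trans_eq ?_
    · refine (norm_sum_le_of_le (f := fun s => _) (n := fun _ => 𝔊.k * (8 * ε)) _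
        fun a ha => ?_).trans_eq ?_
      · refine (norm_sum_le_of_le (f := fun s => _) (n := fun _ => 8 * ε) _
          fun b hb => ?_).trans_eq ?_
        · split_ifs with hv
          · obtain ⟨hx, hy⟩ := hG.lt_of_eq_true _ _ _ _ hv
            exact (hA _ hx _ (Finset.mem_range.1 ha)).norm_symm_sub_le
              (hB _ hy _ (Finset.mem_range.1 hb))
          · rw [sub_zero, norm_zero]
            positivity
        · simp
      · simp
    · simp only [Finset.sum_const, Finset.card_range, nsmul_eq_mul]
      ring
  have hWn : (N : ℝ) < ‖W‖ := by
    -- The slack in `value` is exactly the bound on the distance between the two game operators.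
    have h1 := h.value
    have h2 := norm_sub_norm_le (gameOpFour N 𝔊.k S V c d) W
    rw [norm_sub_rev] at h2
    linarith
  obtain ⟨φ, hφ1, hφ⟩ := exists_state_lt hW0 N.cast_nonneg hWn
  have hPOVM : ∀ c : ℕ → ℕ → C, (∀ x < 𝔊.n, ∀ a < 𝔊.k, IsClose ε (star (c x a) * c x a)
      (povmOf 𝔊.k (c x) a)) → ∀ x : Fin 𝔊.n, IsPOVM fun a : Fin 𝔊.k => povmOf 𝔊.k (c x) a := by
    refine fun c hc x => isPOVM_iff.2 ⟨fun a => (hc x x.2 a a.2).nonneg, ?_⟩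
    rw [← Finset.sum_range, sum_povmOf hk]
  let σ : Strategy 𝔊 C :=
    { A := fun x a => povmOf 𝔊.k (c x) a
      B := fun y b => povmOf 𝔊.k (d y) b
      φ := φ.toLinearMap
      isMeasurement_A := hPOVM c hA
      isMeasurement_B := hPOVM d hB
      isState := by
        refine ⟨fun z => ?_, hφ1⟩
        have := Complex.nonneg_iff.1 (map_nonneg φ (star_mul_self_nonneg z))
        exact ⟨this.1, this.2.symm⟩ }
  have hval : 2 * N * σ.value = (φ W).re := σ.value_eq hG
    (A := fun x a => povmOf 𝔊.k (c x) a) (B := fun y b => povmOf 𝔊.k (d y) b)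
    (fun _ _ => rfl) (fun _ _ => rfl)
  have hσ : σ.OpAlmostCommuting δ := by
    intro x y
    refine lt_of_le_of_lt ?_ (h.comm x x.2 y y.2)
    rw [Finset.sum_range]
    simp only [Finset.sum_range]
    have h4 : (4 * 𝔊.k ^ 2 * ε : ℝ) = ∑ a : Fin 𝔊.k, ∑ b : Fin 𝔊.k, 4 * ε := by
      simp only [Finset.sum_const, Finset.card_univ, Fintype.card_fin, nsmul_eq_mul]
      ring
    rw [h4, ← Finset.sum_add_distrib]
    refine Finset.sum_le_sum fun a _ => ?_
    rw [← Finset.sum_add_distrib]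
    exact Finset.sum_le_sum fun b _ => (hA x x.2 a a.2).norm_comm_le (hB y y.2 b b.2)
  refine lt_of_lt_of_le ?_ (σ.value_le_opCommutingValue hσ)
  have hN : (0 : ℝ) < N := by
    -- For N = 0 the value formula gives φ(W) = 0, contradicting φ(W) > N.
    refine N.cast_nonneg.lt_of_ne fun hN => ?_
    rw [← hN] at hval hφ
    simp only [mul_zero, zero_mul] at hval
    linarith
  by_contra hle
  have : 2 * N * σ.value ≤ N := by nlinarith
  linarith

end KEP

end

noncomputable section

namespace KEP

/-! ## Completeness of approximate strategies -/

theorem IsApproxStrategy.of_map {n k N : ℕ} {S : ℕ → ℕ × ℕ} {V : ℕ → ℕ → ℕ → ℕ → Bool} {ε δ : ℝ}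
    {D E : Type*} [CStarAlgebra D] [CStarAlgebra E] (f : D →+* E)
    (hf : ∀ x, f (star x) = star (f x)) (hfn : ∀ x, ‖f x‖ = ‖x‖) {c d : ℕ → ℕ → D}
    (h : IsApproxStrategy n k N S V ε δ (fun x a => f (c x a)) fun x a => f (d x a)) :
    IsApproxStrategy n k N S V ε δ c d := by
  refine ⟨fun x hx => ?_, fun x hx => ?_, fun x hx => ?_, fun x hx => ?_, fun x hx y hy => ?_, ?_⟩
  · simpa only [← map_rowSum f hf, hfn] using h.left x hx
  · have := h.left' x hx
    rwa [← map_rowSum f hf, ← map_one f, ← map_sub, hfn] at this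
  · simpa only [← map_rowSum f hf, hfn] using h.right x hx
  · have := h.right' x hx
    rwa [← map_rowSum f hf, ← map_one f, ← map_sub, hfn] at this
  · simpa only [← map_absFourComm f hf, hfn] using h.comm x hx y hy
  · simpa only [← map_gameOpFour f hf, hfn] using h.value

/-- The closed `*`-subalgebra generated by the countably many entries is separable, and the
inclusion is isometric. -/
theorem IsApproxStrategy.exists_separable {n k N : ℕ} {S : ℕ → ℕ × ℕ}
    {V : ℕ → ℕ → ℕ → ℕ → Bool} {ε δ : ℝ} {D : Type} [CStarAlgebra D] [Nontrivial D]
    {c d : ℕ → ℕ → D} (h : IsApproxStrategy n k N S V ε δ c d) :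
    ∃ (A : Type) (_ : CStarAlgebra A) (_ : Nontrivial A) (_ : TopologicalSpace.SeparableSpace A)
      (c' d' : ℕ → ℕ → A), IsApproxStrategy n k N S V ε δ c' d' := by
  let s : ℕ → D := fun i =>
    let p := (Denumerable.eqv ((ℕ ⊕ ℕ) × ℕ)).symm i
    p.1.elim (fun x => c x p.2) fun y => d y p.2
  let B := (StarAlgebra.adjoin ℂ (Set.range s)).topologicalClosure
  have hmem : ∀ i, s i ∈ B := fun i =>
    StarSubalgebra.le_topologicalClosure _ (StarAlgebra.subset_adjoin ℂ _ ⟨i, rfl⟩)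
  have hc : ∀ x a, c x a ∈ B := fun x a => by
    simpa [s] using hmem (Denumerable.eqv ((ℕ ⊕ ℕ) × ℕ) (.inl x, a))
  have hd : ∀ x a, d x a ∈ B := fun x a => by
    simpa [s] using hmem (Denumerable.eqv ((ℕ ⊕ ℕ) × ℕ) (.inr x, a))
  have hB : IsClosed (B : Set D) := StarSubalgebra.isClosed_topologicalClosure _
  let _ : CStarAlgebra B := StarSubalgebra.cstarAlgebra B
  have hsep : TopologicalSpace.IsSeparable (B : Set D) := by
    refine TopologicalSpace.IsSeparable.mono ?_ (topologicalClosure_adjoin_subset s)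
    exact ((Set.countable_range _).isSeparable).closure
  refine ⟨B, inferInstance, inferInstance, hsep.separableSpace, fun x a => ⟨c x a, hc x a⟩,
    fun x a => ⟨d x a, hd x a⟩, ?_⟩
  exact IsApproxStrategy.of_map (B.subtype : B →+* D) (fun _ => rfl) (fun _ => rfl) h

theorem sqrt_smul {C : Type*} [CStarAlgebra C] [PartialOrder C] [StarOrderedRing C] {A : C}
    (hA : 0 ≤ A) {r : ℝ} (hr : 0 ≤ r) : sqrt (r • A) = √r • sqrt A := by
  have : r • A = (√r • sqrt A) * (√r • sqrt A) := by
    rw [smul_mul_smul_comm, sqrt_mul_sqrt hA, Real.mul_self_sqrt hr]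
  rw [this, sqrt_mul_self (smul_nonneg (Real.sqrt_nonneg r) (sqrt_nonneg hA))]

/-- Strategies of large value yield approximate strategies. -/
theorem Strategy.exists_isApproxStrategy {𝔊 : NonlocalGame} {N : ℕ} {S : ℕ → ℕ × ℕ}
    {V : ℕ → ℕ → ℕ → ℕ → Bool} (hG : 𝔊.IsSampledBy N S V) {D : Type} [CStarAlgebra D]
    (σ : Strategy 𝔊 D) {δ : ℝ} (hσ : σ.OpAlmostCommuting δ) (hv : 1 / 2 < σ.value) :
    ∃ (m : ℕ) (c d : ℕ → ℕ → D),
      IsApproxStrategy 𝔊.n 𝔊.k N S V (1 / ((m : ℝ) + 1)) δ c d := by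
  let _ := CStarAlgebra.spectralOrder D
  let _ := CStarAlgebra.spectralOrderedRing D
  let A : ℕ → ℕ → D := fun x a => if h : x < 𝔊.n ∧ a < 𝔊.k then σ.A ⟨x, h.1⟩ ⟨a, h.2⟩ else 0
  let B : ℕ → ℕ → D := fun x a => if h : x < 𝔊.n ∧ a < 𝔊.k then σ.B ⟨x, h.1⟩ ⟨a, h.2⟩ else 0
  have hAσ : ∀ (x : Fin 𝔊.n) (a : Fin 𝔊.k), σ.A x a = A x a := fun x a => by simp [A]
  have hBσ : ∀ (x : Fin 𝔊.n) (a : Fin 𝔊.k), σ.B x a = B x a := fun x a => by simp [B]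
  have hA := fun x => isPOVM_iff.1 (σ.isMeasurement_A x)
  have hB := fun x => isPOVM_iff.1 (σ.isMeasurement_B x)
  have hA0 : ∀ x a, 0 ≤ A x a := fun x a => by
    simp only [A]; split_ifs; exacts [(hA _).1 _, le_rfl]
  have hB0 : ∀ x a, 0 ≤ B x a := fun x a => by
    simp only [B]; split_ifs; exacts [(hB _).1 _, le_rfl]
  have hA1 : ∀ x < 𝔊.n, ∑ a ∈ Finset.range 𝔊.k, A x a = 1 := fun x hx => by
    rw [Finset.sum_range, ← (hA ⟨x, hx⟩).2]
    exact Finset.sum_congr rfl fun a _ => (hAσ ⟨x, hx⟩ a).symm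
  have hB1 : ∀ x < 𝔊.n, ∑ a ∈ Finset.range 𝔊.k, B x a = 1 := fun x hx => by
    rw [Finset.sum_range, ← (hB ⟨x, hx⟩).2]
    exact Finset.sum_congr rfl fun a _ => (hBσ ⟨x, hx⟩ a).symm
  set W := gameOp N 𝔊.k S V (fun x a => sqrt (A x a)) A (fun y b => sqrt (B y b)) B with hW
  have hW0 : IsSelfAdjoint W := by
    refine (?_ : 0 ≤ W).isSelfAdjoint
    refine Finset.sum_nonneg fun s _ => Finset.sum_nonneg fun a _ => Finset.sum_nonneg fun b _ => ?_
    split_ifs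
    exacts [symProd_nonneg (hA0 _ _) (hB0 _ _), le_rfl]
  have hN : (0 : ℝ) < N := by
    rcases Nat.eq_zero_or_pos N with rfl | h
    · exfalso
      have h1 := 𝔊.sum_prob
      simp [hG.prob_eq] at h1
    · exact_mod_cast h
  have hWn : (N : ℝ) < ‖W‖ := by
    have h1 := σ.value_eq hG hAσ hBσ
    have h2 := σ.isState.re_le_norm hW0
    rw [← h1] at h2
    nlinarith
  -- Scaling a POVM by 1 - ε²/2 gives row sums of norm below 1 with a defect ε²/2, strictly below
  -- the allowed ε².
  let r : ℝ → ℝ := fun ε => 1 - ε ^ 2 / 2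
  have hlim := tendsto_one_div_add_atTop_nhds_zero_nat (𝕜 := ℝ)
  -- At ε = 0 this is N < ‖W‖ and the next condition is the commutator bound; both are strict, so by
  -- continuity they survive for small ε. The operator scales by r².
  have e1 : ∀ᶠ m : ℕ in atTop, N + 8 * N * 𝔊.k ^ 2 * (1 / ((m : ℝ) + 1)) <
      r (1 / ((m : ℝ) + 1)) ^ 2 * ‖W‖ := by
    have c1 : Continuous fun ε : ℝ => N + 8 * N * 𝔊.k ^ 2 * ε := by fun_prop
    have c2 : Continuous fun ε : ℝ => r ε ^ 2 * ‖W‖ := by fun_prop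
    refine ((c1.tendsto 0).comp hlim).eventually_lt ((c2.tendsto 0).comp hlim) ?_
    simpa [r] using hWn
  have e2 : ∀ᶠ m : ℕ in atTop, ∀ x y : Fin 𝔊.n,
      ∑ a, ∑ b, ‖σ.A x a * σ.B y b - σ.B y b * σ.A x a‖ +
        4 * 𝔊.k ^ 2 * (1 / ((m : ℝ) + 1)) < δ := by
    refine Filter.eventually_all.2 fun x => Filter.eventually_all.2 fun y => ?_
    have c1 : Continuous fun ε : ℝ => ∑ a, ∑ b, ‖σ.A x a * σ.B y b - σ.B y b * σ.A x a‖ +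
        4 * 𝔊.k ^ 2 * ε := by fun_prop
    refine ((c1.tendsto 0).comp hlim).eventually_lt_const ?_
    simpa using hσ x y
  obtain ⟨m, hm1, hm2⟩ := (e1.and e2).exists
  -- Fourth roots of the scaled elements: for c = (rA)^{1/4} one has c^*c = (rA)^{1/2} and `absFour
  -- c` = rA.
  refine ⟨m, fun x a => sqrt (sqrt (r (1 / ((m : ℝ) + 1)) • A x a)),
    fun x a => sqrt (sqrt (r (1 / ((m : ℝ) + 1)) • B x a)), ?_⟩
  set ε : ℝ := 1 / ((m : ℝ) + 1)
  have hε : 0 < ε := by positivity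
  have hε1 : ε ≤ 1 := by
    refine (div_le_one (by positivity)).2 ?_
    linarith [m.cast_nonneg (α := ℝ)]
  have hr0 : 0 < r ε := by simp only [r]; nlinarith
  have hr1 : r ε < 1 := by simp only [r]; nlinarith
  have root : ∀ X : D, 0 ≤ X → star (sqrt (sqrt (r ε • X))) * sqrt (sqrt (r ε • X)) =
      √(r ε) • sqrt X := fun X hX => by
    have h1 : 0 ≤ sqrt (r ε • X) := sqrt_nonneg (smul_nonneg hr0.le hX)
    rw [(sqrt_nonneg h1).isSelfAdjoint.star_eq, sqrt_mul_sqrt h1, sqrt_smul hX hr0.le]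
  have four : ∀ X : D, 0 ≤ X → absFour (sqrt (sqrt (r ε • X))) = r ε • X := fun X hX => by
    rw [absFour, root X hX, smul_mul_smul_comm, Real.mul_self_sqrt hr0.le, sqrt_mul_sqrt hX]
  have row : ∀ X : ℕ → ℕ → D, (∀ x a, 0 ≤ X x a) → ∀ x,
      ∑ a ∈ Finset.range 𝔊.k, X x a = 1 →
      ‖rowSum 𝔊.k (fun a => sqrt (sqrt (r ε • X x a)))‖ < 1 ∧
      ‖1 - rowSum 𝔊.k (fun a => sqrt (sqrt (r ε • X x a)))‖ < ε ^ 2 := by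
    intro X hX x hx
    have h1 : rowSum 𝔊.k (fun a => sqrt (sqrt (r ε • X x a))) = r ε • (1 : D) := by
      simp only [rowSum, four _ (hX _ _), ← Finset.smul_sum, hx]
    have h2 : ‖(1 : D)‖ ≤ 1 := (CStarAlgebra.norm_le_one_iff_of_nonneg 1 zero_le_one).2 le_rfl
    have h3 : (1 : D) - r ε • (1 : D) = (ε ^ 2 / 2) • (1 : D) := by simp only [r]; module
    rw [h1, h3, norm_smul, norm_smul, Real.norm_of_nonneg hr0.le,
      Real.norm_of_nonneg (by positivity)]
    exact ⟨by nlinarith [norm_nonneg (1 : D)], by nlinarith [norm_nonneg (1 : D), sq_pos_of_pos hε]⟩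
  refine ⟨fun x hx => (row A hA0 x (hA1 x hx)).1, fun x hx => (row A hA0 x (hA1 x hx)).2,
    fun x hx => (row B hB0 x (hB1 x hx)).1, fun x hx => (row B hB0 x (hB1 x hx)).2,
    fun x hx y hy => ?_, ?_⟩
  · refine lt_of_le_of_lt ?_ (hm2 ⟨x, hx⟩ ⟨y, hy⟩)
    rw [Finset.sum_range]
    simp only [Finset.sum_range]
    refine add_le_add_left (Finset.sum_le_sum fun a _ => Finset.sum_le_sum fun b _ => ?_) _
    have h1 : absFourComm (sqrt (sqrt (r ε • A x a))) (sqrt (sqrt (r ε • B y b))) =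
        (r ε * r ε) • (A x a * B y b - B y b * A x a) := by
      rw [absFourComm, four _ (hA0 _ _), four _ (hB0 _ _), smul_mul_smul_comm, smul_mul_smul_comm,
        smul_sub]
    rw [h1, norm_smul, Real.norm_of_nonneg (by positivity), hAσ, hBσ]
    exact mul_le_of_le_one_left (norm_nonneg _) (by nlinarith)
  · refine hm1.trans_le ?_
    have h1 : gameOpFour N 𝔊.k S V (fun x a => sqrt (sqrt (r ε • A x a)))
        (fun x a => sqrt (sqrt (r ε • B x a))) = (r ε ^ 2) • W := by
      rw [hW, gameOpFour, gameOp, gameOp, Finset.smul_sum]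
      refine Finset.sum_congr rfl fun s _ => ?_
      rw [Finset.smul_sum]
      refine Finset.sum_congr rfl fun a _ => ?_
      rw [Finset.smul_sum]
      refine Finset.sum_congr rfl fun b _ => ?_
      rw [smul_ite, smul_zero]
      refine if_congr Iff.rfl ?_ rfl
      simp only [root _ (hA0 _ _), root _ (hB0 _ _), four _ (hA0 _ _), four _ (hB0 _ _),
        smul_mul_assoc, mul_smul_comm, smul_smul, smul_add]
      have : √(r ε) * (r ε * √(r ε)) = r ε ^ 2 := by
        rw [mul_left_comm, Real.mul_self_sqrt hr0.le, sq]
      rw [this]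
    rw [h1, norm_smul, Real.norm_of_nonneg (by positivity)]

/-- A game of large value has an approximate strategy in a separable C*-algebra. -/
theorem NonlocalGame.IsSampledBy.exists_isApproxStrategy {𝔊 : NonlocalGame} {N : ℕ}
    {S : ℕ → ℕ × ℕ} {V : ℕ → ℕ → ℕ → ℕ → Bool} (hG : 𝔊.IsSampledBy N S V) {δ : ℝ}
    (h : opCommutingValue δ 𝔊 = 1) :
    ∃ (m : ℕ) (A : Type) (_ : CStarAlgebra A) (_ : Nontrivial A)
      (_ : TopologicalSpace.SeparableSpace A) (c d : ℕ → ℕ → A),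
      IsApproxStrategy 𝔊.n 𝔊.k N S V (1 / ((m : ℝ) + 1)) δ c d := by
  -- The supremum of the empty set is 0, so value 1 guarantees that a strategy exists.
  have hne : {v : ℝ | ∃ (H : Type) (_ : NormedAddCommGroup H) (_ : InnerProductSpace ℂ H)
      (_ : CompleteSpace H) (σ : Strategy 𝔊 (H →L[ℂ] H)),
        σ.OpAlmostCommuting δ ∧ v = σ.value}.Nonempty := by
    by_contra hne
    rw [opCommutingValue, Set.not_nonempty_iff_eq_empty.1 hne, Real.sSup_empty] at h
    exact zero_ne_one h
  obtain ⟨_, ⟨H, _, _, _, σ, hσ, rfl⟩, hv⟩ :=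
    exists_lt_of_lt_csSup hne (h.symm ▸ one_half_lt_one : (1 / 2 : ℝ) < opCommutingValue δ 𝔊)
  obtain ⟨m, c, d, hcd⟩ := σ.exists_isApproxStrategy hG hσ hv
  have : Nontrivial (H →L[ℂ] H) := by
    refine nontrivial_of_ne 1 0 fun h1 => ?_
    have h2 := σ.isState.2
    rw [h1, map_zero] at h2
    exact zero_ne_one h2
  exact ⟨m, hcd.exists_separable⟩

end KEP

end

noncomputable section

namespace KEP

/-! ## Recognizing approximate strategies -/

namespace RatStarPoly

/-- `absFour` for rational `*`-polynomials. -/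
def absFour (p : RatStarPoly) : RatStarPoly := mul (mul (adj p) p) (mul (adj p) p)

/-- The polynomial of a pair of questions and a pair of answers in `gameOpFour`. -/
def symm (p q : RatStarPoly) : RatStarPoly :=
  mul (mul (mul (adj p) p) (absFour q)) (mul (adj p) p) ++
    mul (mul (mul (adj q) q) (absFour p)) (mul (adj q) q)

variable {C : Type*} [CStarAlgebra C] (a : ℕ → C)

@[simp] theorem eval_absFour (p : RatStarPoly) : eval a (absFour p) = KEP.absFour (eval a p) := by
  simp [absFour, KEP.absFour]

theorem eval_symm (p q : RatStarPoly) : eval a (symm p q) =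
    star (eval a p) * eval a p * KEP.absFour (eval a q) * (star (eval a p) * eval a p) +
    star (eval a q) * eval a q * KEP.absFour (eval a p) * (star (eval a q) * eval a q) := by
  simp [symm]

variable {α : Type*} [Primcodable α]

@[fun_prop] theorem computable_absFour {f : α → RatStarPoly} (hf : Computable f) :
    Computable fun x => absFour (f x) := by
  have := computable_poly_mul (computable_poly_adj hf) hf
  exact computable_poly_mul this this

@[fun_prop] theorem computable_symm {f g : α → RatStarPoly} (hf : Computable f)
    (hg : Computable g) : Computable fun x => symm (f x) (g x) := by
  have h1 := computable_poly_mul (computable_poly_adj hf) hf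
  have h2 := computable_poly_mul (computable_poly_adj hg) hg
  exact computable_append
    (computable_poly_mul (computable_poly_mul h1 (computable_absFour hg)) h1)
    (computable_poly_mul (computable_poly_mul h2 (computable_absFour hf)) h2)

end RatStarPoly

/-- All expressions are norms of rational `*`-polynomials computed from the codes, so each clause is
a strict inequality of computable reals under bounded quantifiers. -/
theorem semiDecidable_isApproxStrategy {C : Type*} [CStarAlgebra C] {a : ℕ → C}
    (ha : ComputableReal fun p : RatStarPoly => ‖p.eval a‖) {α : Type*} [Primcodable α]
    {n k N : α → ℕ} (hn : Computable n) (hk : Computable k) (hN : Computable N)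
    {S : α × ℕ → ℕ × ℕ} (hS : Computable S) {V : α × ℕ × ℕ × ℕ × ℕ → Bool} (hV : Computable V)
    {e : α → RatCode} (he : Computable e) {δ : α → ℝ} (hδ : ComputableReal δ)
    {P Q : α × ℕ × ℕ → RatStarPoly} (hP : Computable P) (hQ : Computable Q) :
    SemiDecidable fun z => IsApproxStrategy (n z) (k z) (N z) (fun s => S (z, s))
      (fun x y i j => V (z, x, y, i, j)) (e z).val (δ z) (fun x i => (P (z, x, i)).eval a)
      (fun y j => (Q (z, y, j)).eval a) := by
  have hrow : ∀ R : α × ℕ × ℕ → RatStarPoly, Computable R →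
      ∃ F : α × ℕ → RatStarPoly, Computable F ∧
        ∀ z x, (F (z, x)).eval a = rowSum (k z) fun i => (R (z, x, i)).eval a := by
    intro R hR
    refine ⟨_, computable_poly_sumRange (α := α × ℕ) (m := fun p => k p.1)
      (F := fun p : (α × ℕ) × ℕ => (R (p.1.1, p.1.2, p.2)).absFour) (by fun_prop) (by fun_prop),
      fun z x => ?_⟩
    simp [rowSum]
  have hgame : ∃ F : α → RatStarPoly, Computable F ∧ ∀ z, (F z).eval a = gameOpFour (N z) (k z)
      (fun s => S (z, s)) (fun x y i j => V (z, x, y, i, j)) (fun x i => (P (z, x, i)).eval a)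
      (fun y j => (Q (z, y, j)).eval a) := by
    have c1 : Computable fun p : ((α × ℕ) × ℕ) × ℕ =>
        (bif V (p.1.1.1, (S p.1.1).1, (S p.1.1).2, p.1.2, p.2) then
          RatStarPoly.symm (P (p.1.1.1, (S p.1.1).1, p.1.2)) (Q (p.1.1.1, (S p.1.1).2, p.2))
        else ([] : RatStarPoly)) := by fun_prop
    have c2 := computable_poly_sumRange (α := (α × ℕ) × ℕ) (m := fun p => k p.1.1)
      (by fun_prop) c1
    have c3 := computable_poly_sumRange (α := α × ℕ) (m := fun p => k p.1) (by fun_prop) c2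
    have c4 := computable_poly_sumRange (α := α) hN c3
    refine ⟨_, c4, fun z => ?_⟩
    simp only [RatStarPoly.eval_sumRange, gameOpFour, gameOp]
    refine Finset.sum_congr rfl fun s _ => Finset.sum_congr rfl fun i _ =>
      Finset.sum_congr rfl fun j _ => ?_
    cases V (z, (S (z, s)).1, (S (z, s)).2, i, j) <;> simp [RatStarPoly.eval_symm]
  have hcomm : ∃ F : (((α × ℕ) × ℕ) × ℕ) × ℕ → RatStarPoly, Computable F ∧ ∀ z x y i j,
      (F ((((z, x), y), i), j)).eval a =
        absFourComm ((P (z, x, i)).eval a) ((Q (z, y, j)).eval a) := by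
    have c1 : Computable fun p : (((α × ℕ) × ℕ) × ℕ) × ℕ =>
        (P (p.1.1.1.1, p.1.1.1.2, p.1.2)).absFour := by fun_prop
    have c2 : Computable fun p : (((α × ℕ) × ℕ) × ℕ) × ℕ =>
        (Q (p.1.1.1.1, p.1.1.2, p.2)).absFour := by fun_prop
    refine ⟨_, computable_poly_sub (computable_poly_mul c1 c2) (computable_poly_mul c2 c1),
      fun z x y i j => ?_⟩
    simp [absFourComm]
  obtain ⟨FP, hFP, hFP'⟩ := hrow P hP
  obtain ⟨FQ, hFQ, hFQ'⟩ := hrow Q hQ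
  obtain ⟨G, hG, hG'⟩ := hgame
  obtain ⟨K, hK, hK'⟩ := hcomm
  have hone : cval (RatCode.ofNat 1, RatCode.ofNat 0) = 1 := by
    apply Complex.ext <;> simp [cval]
  have s1 : ∀ F : α × ℕ → RatStarPoly, Computable F →
      SemiDecidable fun z => ∀ x < n z, ‖(F (z, x)).eval a‖ < 1 := fun F hF =>
    SemiDecidable.forall_lt (p := fun p : α × ℕ => ‖(F p).eval a‖ < 1)
      (by
        have := (ha.comp hF).lt (ComputableReal.natCast (r := fun _ : α × ℕ => 1) (by fun_prop))
        simpa using this) hn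
  have s2 : ∀ F : α × ℕ → RatStarPoly, Computable F →
      SemiDecidable fun z => ∀ x < n z, ‖1 - (F (z, x)).eval a‖ < (e z).val ^ 2 := fun F hF =>
    SemiDecidable.forall_lt (p := fun p : α × ℕ => ‖1 - (F p).eval a‖ < (e p.1).val ^ 2)
      (by
        have c1 : Computable fun p : α × ℕ => RatStarPoly.sub
          (RatStarPoly.const (RatCode.ofNat 1, RatCode.ofNat 0)) (F p) := by fun_prop
        have := (ha.comp c1).lt (ComputableReal.ratCode
          (r := fun p : α × ℕ => (e p.1).mul (e p.1)) (by fun_prop))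
        simpa [hone, sq] using this) hn
  have s3 : SemiDecidable fun z => ∀ x < n z, ∀ y < n z,
      ∑ i ∈ Finset.range (k z), ∑ j ∈ Finset.range (k z), ‖(K ((((z, x), y), i), j)).eval a‖ +
        4 * k z ^ 2 * (e z).val < δ z := by
    refine SemiDecidable.forall_lt (p := fun p : α × ℕ => ∀ y < n p.1,
      ∑ i ∈ Finset.range (k p.1), ∑ j ∈ Finset.range (k p.1), ‖(K (((p, y), i), j)).eval a‖ +
        4 * k p.1 ^ 2 * (e p.1).val < δ p.1) ?_ hn
    refine SemiDecidable.forall_lt (p := fun p : (α × ℕ) × ℕ =>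
      ∑ i ∈ Finset.range (k p.1.1), ∑ j ∈ Finset.range (k p.1.1), ‖(K ((p, i), j)).eval a‖ +
        4 * k p.1.1 ^ 2 * (e p.1.1).val < δ p.1.1) ?_ (by fun_prop)
    have c1 := ComputableReal.sum_range (ha.comp hK) (m := fun p => k p.1.1.1) (by fun_prop)
    have c2 := ComputableReal.sum_range c1 (m := fun p => k p.1.1) (by fun_prop)
    have c3 := ComputableReal.ratCode (r := fun p : (α × ℕ) × ℕ =>
      (RatCode.ofNat (4 * k p.1.1 ^ 2)).mul (e p.1.1)) (by fun_prop)
    have c4 := (c2.add c3).lt (hδ.comp (f := fun p : (α × ℕ) × ℕ => p.1.1) (by fun_prop))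
    simpa using c4
  have s4 : SemiDecidable fun z => N z + 8 * N z * k z ^ 2 * (e z).val < ‖(G z).eval a‖ := by
    have c3 := ComputableReal.ratCode (r := fun z =>
      (RatCode.ofNat (8 * N z * k z ^ 2)).mul (e z)) (by fun_prop)
    have := ((ComputableReal.natCast hN).add c3).lt (ha.comp hG)
    simpa using this
  refine ((s1 FP hFP).and ((s2 FP hFP).and ((s1 FQ hFQ).and ((s2 FQ hFQ).and
    (s3.and s4))))).of_eq fun z => ?_
  simp only [hFP', hFQ', hG', hK']
  exact ⟨fun h => ⟨h.1, h.2.1, h.2.2.1, h.2.2.2.1, h.2.2.2.2.1, h.2.2.2.2.2⟩,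
    fun h => ⟨h.left, h.left', h.right, h.right', h.comm, h.value⟩⟩

/-! ## Languages in the complexity class are recursively enumerable -/

open Computability in
theorem IsEfficient.exists_computable {𝔊 : List Bool → NonlocalGame} (h : IsEfficient 𝔊) :
    ∃ (N : List Bool → ℕ) (S : List Bool × ℕ → ℕ × ℕ)
      (V : List Bool × ℕ × ℕ × ℕ × ℕ → Bool),
      Computable (fun z => (𝔊 z).n) ∧ Computable (fun z => (𝔊 z).k) ∧ Computable N ∧
      Computable S ∧ Computable V ∧ ∀ z, (𝔊 z).IsSampledBy (N z) (fun s => S (z, s))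
        fun x y a b => V (z, x, y, a, b) := by
  obtain ⟨N, S, V, h1, h2, h3, h4, h5⟩ := h
  have c1 : Computable fun z => ((𝔊 z).n, (𝔊 z).k, N z) := h1.computable computable_encode_list
    (computable_encode_prod computable_encode_nat
      (computable_encode_prod computable_encode_nat computable_encode_nat))
  have c2 : Computable S := h2.computable
    (computable_encode_prod computable_encode_list computable_encode_nat)
    (computable_encode_prod computable_encode_nat computable_encode_nat)
  have c3 : Computable V := h3.computable
    (computable_encode_prod computable_encode_list (computable_encode_prod computable_encode_nat
      (computable_encode_prod computable_encode_nat (computable_encode_prod computable_encode_nat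
        computable_encode_nat)))) computable_encode_bool
  have cn : Computable fun z => (𝔊 z).n := computable_fst c1
  -- The range checks on the questions are built into the predicate, so it is false on questions
  -- outside the game.
  refine ⟨N, S, fun p => decide (p.2.1 < (𝔊 p.1).n) && (decide (p.2.2.1 < (𝔊 p.1).n) && V p), cn,
    computable_fst (computable_snd c1), computable_snd (computable_snd c1), c2, ?_, fun z =>
    ⟨h4 z, fun x y a b hxy => ?_, fun x y a b => ?_⟩⟩
  · have c4 : Computable fun p : List Bool × ℕ × ℕ × ℕ × ℕ => (𝔊 p.1).n :=
      cn.comp Computable.fst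
    fun_prop
  · simp only [Bool.and_eq_true, decide_eq_true_eq] at hxy
    exact ⟨hxy.1, hxy.2.1⟩
  · simp [h5]

theorem rePred_of_existsLocallyUniversalComputable (h : ExistsLocallyUniversalComputable)
    {δ : ℕ → ℝ} (hδ : IsComputableRealSeq δ) {L : Set (List Bool)} (hL : L ∈ MIPcoDeltaOp δ) :
    REPred fun z : List Bool => z ∈ L := by
  obtain ⟨C, _, hC, a, ha, f, hf, hf'⟩ := h
  have hnorm : ComputableReal fun p : RatStarPoly => ‖p.eval a‖ := ⟨f, hf, hf'⟩
  have hδ' : ComputableReal δ := hδ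
  obtain ⟨𝔊, hG, hL1, hL2⟩ := hL
  obtain ⟨N, S, V, cn, ck, cN, cS, cV, hs⟩ := hG.exists_computable
  have hlen : Computable fun p : List Bool × List (List RatStarPoly) × List (List RatStarPoly) × ℕ =>
    p.1.length := by fun_prop
  have hpoly : ∀ G : List Bool × List (List RatStarPoly) × List (List RatStarPoly) × ℕ →
      List (List RatStarPoly), Computable G → Computable fun p :
        (List Bool × List (List RatStarPoly) × List (List RatStarPoly) × ℕ) × ℕ × ℕ =>
        polyArray (G p.1) p.2.1 p.2.2 := by
    intro G hG
    unfold polyArray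
    fun_prop
  have key := semiDecidable_isApproxStrategy hnorm
    (α := List Bool × List (List RatStarPoly) × List (List RatStarPoly) × ℕ)
    (n := fun p => (𝔊 p.1).n) (k := fun p => (𝔊 p.1).k) (N := fun p => N p.1)
    (cn.comp Computable.fst) (ck.comp Computable.fst) (cN.comp Computable.fst)
    (S := fun q => S (q.1.1, q.2)) (by fun_prop) (V := fun q => V (q.1.1, q.2)) (by fun_prop)
    -- The slack is ε = 1/(m + 1), where m is the last component of the searched witness.
    (e := fun p => ((1, 0, p.2.2.2) : RatCode)) (by fun_prop)
    (δ := fun p => δ p.1.length) (hδ'.comp hlen)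
    (hpoly (fun p => p.2.1) (by fun_prop)) (hpoly (fun p => p.2.2.1) (by fun_prop))
  have key2 := SemiDecidable.exists key
  refine (key2.of_eq fun z => ?_).rePred
  have he : ∀ m : ℕ, RatCode.val (1, 0, m) = 1 / ((m : ℝ) + 1) := fun m => by
    simp [RatCode.val]
  simp only [he]
  constructor
  · rintro ⟨⟨G₁, G₂, m⟩, h⟩
    by_contra hz
    have h1 := IsApproxStrategy.lt_opCommutingValue (hs z) (by positivity)
      ((div_le_one (by positivity)).2 (by linarith [m.cast_nonneg (α := ℝ)])) h
    exact absurd (hL2 z hz) (not_le.2 h1)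
  · intro hz
    obtain ⟨m, A, _, _, _, c, d, hcd⟩ := (hs z).exists_isApproxStrategy (hL1 z hz)
    obtain ⟨c', d', hcd'⟩ := hcd.exists_of_locallyUniversal hC
    obtain ⟨G₁, G₂, hG⟩ := hcd'.exists_rational (hs z).lt_of_eq_true ha
    exact ⟨(G₁, G₂, m), hG⟩

end KEP

end

noncomputable section

namespace KEP

/-! ## Words in Cuntz families -/

/-- The index in `{0, 1}` of the generator that is named by a natural number. -/
def genBit (i : ℕ) : ℕ := if i = 0 then 0 else 1

theorem genBit_lt (i : ℕ) : genBit i < 2 := by unfold genBit; split_ifs <;> omega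

/-- The partial action of a letter on `ℕ` by `n ↦ 2 n + i` and its inverse. -/
def actLetter (l : ℕ × Bool) (n : ℕ) : Option ℕ :=
  if l.2 = true then (if n % 2 = genBit l.1 then some (n / 2) else none)
  else some (2 * n + genBit l.1)

/-- The partial action of a word on `ℕ`. -/
def actWord (w : List (ℕ × Bool)) (m : ℕ) : Option ℕ :=
  w.foldr (fun l o => o.bind (actLetter l)) (some m)

@[simp] theorem actWord_nil (m : ℕ) : actWord [] m = some m := rfl

theorem actWord_cons (l : ℕ × Bool) (w : List (ℕ × Bool)) (m : ℕ) :
    actWord (l :: w) m = (actWord w m).bind (actLetter l) := rfl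

theorem actLetter_bounds {l : ℕ × Bool} {m n : ℕ} (h : actLetter l m = some n) :
    m < 2 * (n + 1) ∧ n < 2 * (m + 1) := by
  have := genBit_lt l.1
  unfold actLetter at h
  split_ifs at h <;> simp only [Option.some.injEq] at h <;> omega

/-- Each letter appends or removes one binary digit, so a word shifts the dyadic level by at most
its length. -/
theorem actWord_bounds {w : List (ℕ × Bool)} {m n : ℕ} (h : actWord w m = some n) :
    m < 2 ^ w.length * (n + 1) ∧ n < 2 ^ w.length * (m + 1) := by
  induction w generalizing n with
  | nil => simp at h; subst h; simp
  | cons l w ih =>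
    rw [actWord_cons, Option.bind_eq_some_iff] at h
    obtain ⟨r, hr, h⟩ := h
    obtain ⟨h1, h2⟩ := ih hr
    obtain ⟨h3, h4⟩ := actLetter_bounds h
    rw [List.length_cons, pow_succ]
    constructor
    · calc m < 2 ^ w.length * (r + 1) := h1
        _ ≤ 2 ^ w.length * (2 * (n + 1)) := Nat.mul_le_mul_left _ h3
        _ = _ := by ring
    · calc n < 2 * (r + 1) := h4
        _ ≤ 2 * (2 ^ w.length * (m + 1)) := Nat.mul_le_mul_left _ h2
        _ = _ := by ring

/-! ### Averaging over dyadic levels in a Cuntz family. -/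

section Cuntz

variable {C : Type*} [CStarAlgebra C]

/-- The sequence of generators of a Cuntz family. -/
def cuntzSeq (s : Fin 2 → C) (i : ℕ) : C := s ⟨genBit i, genBit_lt i⟩

/-- The product of the generators along the binary expansion of a positive number. -/
def binProd (s : Fin 2 → C) (n : ℕ) : C :=
  if n < 2 then 1 else s ⟨n % 2, Nat.mod_lt _ two_pos⟩ * binProd s (n / 2)
termination_by n

theorem binProd_one (s : Fin 2 → C) : binProd s 1 = 1 := by rw [binProd]; simp

theorem binProd_two_mul_add (s : Fin 2 → C) {n : ℕ} (hn : 1 ≤ n) {i : ℕ} (hi : i < 2) :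
    binProd s (2 * n + i) = s ⟨i, hi⟩ * binProd s n := by
  rw [binProd, if_neg (by omega)]
  have h1 : (2 * n + i) % 2 = i := by omega
  have h2 : (2 * n + i) / 2 = n := by omega
  simp only [h1, h2]

variable {s : Fin 2 → C} (hs : CuntzRelations s)

include hs

/-- For n ≥ 2 the product has a leftmost generator, named by the last digit of n, which an adjoint
letter cancels or annihilates. This fails at n = 1, where the product is 1. -/
theorem CuntzRelations.letter_mul_binProd (l : ℕ × Bool) {n : ℕ} (hn : 2 ≤ n) :
    (if l.2 then star (cuntzSeq s l.1) else cuntzSeq s l.1) * binProd s n =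
      (actLetter l n).elim 0 (binProd s) := by
  obtain ⟨i, b⟩ := l
  cases b
  · simp only [Bool.false_eq_true, if_false, actLetter, Option.elim_some]
    exact (binProd_two_mul_add s (by omega) (genBit_lt i)).symm
  · have h1 : 2 * (n / 2) + n % 2 = n := Nat.div_add_mod n 2
    have h2 := binProd_two_mul_add s (n := n / 2) (by omega) (Nat.mod_lt n two_pos)
    rw [h1] at h2
    simp only [if_true, actLetter]
    rw [h2, ← mul_assoc, cuntzSeq, hs.1]
    simp only [Fin.mk.injEq, eq_comm (a := genBit i)]
    split_ifs <;> simp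

/-- Starting at level |w| + j leaves at least j levels after the word, so no letter is applied below
level one. The parameter j makes the induction work. -/
theorem CuntzRelations.word_mul_binProd (w : List (ℕ × Bool)) (j : ℕ) {m : ℕ}
    (hm : 2 ^ (w.length + j) ≤ m) :
    evalWord (cuntzSeq s) w * binProd s m = (actWord w m).elim 0 (binProd s) ∧
      ∀ n, actWord w m = some n → 2 ^ j ≤ n := by
  induction w generalizing j with
  | nil => simpa using hm
  | cons l w ih =>
    obtain ⟨h1, h2⟩ := ih (j + 1) (by rwa [List.length_cons, add_right_comm] at hm)
    rw [evalWord_cons, mul_assoc, h1, actWord_cons]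
    cases hw : actWord w m with
    | none => simp
    | some r =>
      have hr : 2 ^ (j + 1) ≤ r := h2 r hw
      have hj : 1 ≤ 2 ^ j := Nat.one_le_two_pow
      rw [pow_succ] at hr
      refine ⟨hs.letter_mul_binProd l (by omega), fun n hn => ?_⟩
      have := (actLetter_bounds hn).1
      omega

omit hs in
theorem sum_Ico_two_mul {A : Type*} [AddCommMonoid A] (f : ℕ → A) {a b : ℕ} (h : a ≤ b) :
    ∑ m ∈ Finset.Ico (2 * a) (2 * b), f m =
      ∑ n ∈ Finset.Ico a b, (f (2 * n) + f (2 * n + 1)) := by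
  induction b, h using Nat.le_induction with
  | base => simp
  | succ b hb ih =>
    rw [Finset.sum_Ico_succ_top hb, ← ih, show 2 * (b + 1) = 2 * b + 1 + 1 by ring,
      Finset.sum_Ico_succ_top (by omega), Finset.sum_Ico_succ_top (by omega), add_assoc]

/-- The indices 2n and 2n + 1 refine n: passing to the next level conjugates the previous sum by the
two generators, and s₀s₀^* + s₁s₁^* = 1. -/
theorem CuntzRelations.sum_level (l : ℕ) :
    ∑ m ∈ Finset.Ico (2 ^ l) (2 ^ (l + 1)), binProd s m * star (binProd s m) = 1 := by
  induction l with
  | zero => simp [binProd_one]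
  | succ l ih =>
    rw [pow_succ', pow_succ' 2 (l + 1), sum_Ico_two_mul _ (Nat.pow_le_pow_right two_pos (by omega))]
    have h1 : ∀ n ∈ Finset.Ico (2 ^ l) (2 ^ (l + 1)),
        binProd s (2 * n) * star (binProd s (2 * n)) +
          binProd s (2 * n + 1) * star (binProd s (2 * n + 1)) =
        s 0 * (binProd s n * star (binProd s n)) * star (s 0) +
          s 1 * (binProd s n * star (binProd s n)) * star (s 1) := by
      intro n hn
      have hn1 : 1 ≤ n := Nat.one_le_two_pow.trans (Finset.mem_Ico.1 hn).1
      have e0 := binProd_two_mul_add s hn1 (i := 0) two_pos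
      have e1 := binProd_two_mul_add s hn1 (i := 1) one_lt_two
      rw [add_zero] at e0
      rw [e0, e1]
      simp only [star_mul, mul_assoc]
      rfl
    rw [Finset.sum_congr rfl h1, Finset.sum_add_distrib, ← Finset.sum_mul, ← Finset.sum_mul,
      ← Finset.mul_sum, ← Finset.mul_sum, ih, mul_one, mul_one, ← hs.2, Fin.sum_univ_two]

theorem CuntzRelations.sum_Ico (M N : ℕ) :
    ∑ m ∈ Finset.Ico (2 ^ M) (2 ^ (M + N)), binProd s m * star (binProd s m) = (N : C) := by
  induction N with
  | zero => simp
  | succ N ih =>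
    rw [← Finset.sum_Ico_consecutive _ (Nat.pow_le_pow_right two_pos (Nat.le_add_right M N))
      (Nat.pow_le_pow_right two_pos (by omega : M + N ≤ M + (N + 1))), ih, ← add_assoc,
      hs.sum_level, Nat.cast_succ]

omit hs in
theorem norm_le_one_of_star_mul_self {x : C} (h : star x * x = 1) : ‖x‖ ≤ 1 := by
  have h1 := CStarRing.norm_star_mul_self (x := x)
  rw [h] at h1
  rcases subsingleton_or_nontrivial C with hC | hC
  · rw [Subsingleton.elim x 0, norm_zero]; exact zero_le_one
  · rw [CStarRing.norm_one] at h1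
    nlinarith [norm_nonneg x]

omit hs in
theorem norm_one_le : ‖(1 : C)‖ ≤ 1 := norm_le_one_of_star_mul_self (by simp)

theorem CuntzRelations.norm_gen_le (i : Fin 2) : ‖s i‖ ≤ 1 :=
  norm_le_one_of_star_mul_self (by rw [hs.1, if_pos rfl])

theorem CuntzRelations.norm_evalWord_le (w : List (ℕ × Bool)) :
    ‖evalWord (cuntzSeq s) w‖ ≤ 1 := by
  induction w with
  | nil => exact norm_one_le
  | cons l w ih =>
    rw [evalWord_cons]
    have h1 : ‖if l.2 then star (cuntzSeq s l.1) else cuntzSeq s l.1‖ ≤ 1 := by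
      split_ifs
      · rw [norm_star]; exact hs.norm_gen_le _
      · exact hs.norm_gen_le _
    simpa using norm_mul_le_of_le' h1 ih

theorem CuntzRelations.norm_binProd_le (n : ℕ) : ‖binProd s n‖ ≤ 1 := by
  induction n using Nat.strong_induction_on with
  | _ n ih =>
    rw [binProd]
    split_ifs with hn
    · exact norm_one_le
    · simpa using norm_mul_le_of_le' (hs.norm_gen_le ⟨n % 2, Nat.mod_lt _ two_pos⟩)
        (ih (n / 2) (by omega))

/-- The indices of a range of levels. -/
abbrev levels (M N : ℕ) : Finset ℕ := Finset.Ico (2 ^ M) (2 ^ (M + N))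

/-- On many levels, words act like partial permutations up to boundary terms. -/
theorem CuntzRelations.norm_word_sub_le (w : List (ℕ × Bool)) {M : ℕ} (hM : w.length ≤ M) (N : ℕ) :
    ‖(N : ℝ) • evalWord (cuntzSeq s) w - ∑ m ∈ levels M N, ∑ n ∈ levels M N,
      if actWord w m = some n then binProd s n * star (binProd s m) else 0‖ ≤ 2 * w.length := by
  classical
  let _ := CStarAlgebra.spectralOrder C
  let _ := CStarAlgebra.spectralOrderedRing C
  let P : ℕ → C := fun m => binProd s m * star (binProd s m)
  have hP : ∀ m, 0 ≤ P m := fun m => mul_star_self_nonneg _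
  -- The discrepancy comes only from indices in the window that the word moves out of it.
  let bad := (levels M N).filter fun m => ∃ n, actWord w m = some n ∧ n ∉ levels M N
  have h1 : (N : ℝ) • evalWord (cuntzSeq s) w =
      ∑ m ∈ levels M N, evalWord (cuntzSeq s) w * P m := by
    rw [← Finset.mul_sum, hs.sum_Ico M N, Nat.cast_smul_eq_nsmul, nsmul_eq_mul', ]
  have h2 : ∀ m ∈ levels M N, evalWord (cuntzSeq s) w * P m - ∑ n ∈ levels M N,
      (if actWord w m = some n then binProd s n * star (binProd s m) else 0) =
      if ∃ n, actWord w m = some n ∧ n ∉ levels M N then evalWord (cuntzSeq s) w * P m else 0 := by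
    intro m hm
    have hmM : 2 ^ (w.length + 0) ≤ m :=
      (Nat.pow_le_pow_right two_pos (by omega)).trans (Finset.mem_Ico.1 hm).1
    have h3 := (hs.word_mul_binProd w 0 hmM).1
    have h4 : evalWord (cuntzSeq s) w * P m =
        (actWord w m).elim 0 (binProd s) * star (binProd s m) := by
      rw [← h3, mul_assoc]
    cases hw : actWord w m with
    | none => rw [h4, hw]; simp
    | some r =>
      rw [hw] at h4
      simp only [Option.elim_some] at h4
      by_cases hr : r ∈ levels M N
      · rw [if_neg (by simpa using hr), Finset.sum_eq_single r]
        · simp [h4]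
        · intro n _ hn
          exact if_neg fun h => hn (Option.some.inj h).symm
        · exact fun h => absurd hr h
      · rw [if_pos ⟨r, rfl, hr⟩, Finset.sum_eq_zero, sub_zero]
        intro n hn
        exact if_neg fun h => hr (by rw [Option.some.inj h]; exact hn)
  rw [h1, ← Finset.sum_sub_distrib, Finset.sum_congr rfl h2, ← Finset.sum_filter, ← Finset.mul_sum]
  have h5 : ‖∑ m ∈ bad, P m‖ ≤ 2 * w.length := by
    refine norm_le_of_le_algebraMap (Finset.sum_nonneg fun m _ => hP m) (by positivity) ?_
    -- Such indices lie in the first or the last |w| levels, whose projections sum to at most 2|w|.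
    -- Truncated subtraction also covers the case N < |w|.
    have hsub : bad ⊆ levels M w.length ∪ levels (M + (N - w.length)) (N - (N - w.length)) := by
      intro m hm
      obtain ⟨hm, n, hn, hnW⟩ := Finset.mem_filter.1 hm
      obtain ⟨b1, b2⟩ := actWord_bounds hn
      rw [Finset.mem_Ico] at hm
      rw [Finset.mem_Ico, not_and_or, not_le, not_lt] at hnW
      rw [Finset.mem_union, Finset.mem_Ico, Finset.mem_Ico]
      have hMN : M + (N - w.length) + (N - (N - w.length)) = M + N := by omega
      rw [hMN]
      rcases hnW with hnW | hnW
      · refine Or.inl ⟨hm.1, b1.trans_le ?_⟩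
        rw [pow_add, mul_comm]
        exact Nat.mul_le_mul_right _ hnW
      · refine Or.inr ⟨?_, hm.2⟩
        by_contra hlt
        rw [not_le] at hlt
        rcases le_total w.length N with hL | hL
        · have h6 : 2 ^ w.length * (m + 1) ≤ 2 ^ w.length * 2 ^ (M + (N - w.length)) :=
            Nat.mul_le_mul_left _ hlt
          rw [← pow_add] at h6
          have h7 : w.length + (M + (N - w.length)) = M + N := by omega
          rw [h7] at h6
          omega
        · rw [Nat.sub_eq_zero_of_le hL, add_zero] at hlt
          omega
    calc ∑ m ∈ bad, P m
        ≤ ∑ m ∈ levels M w.length ∪ levels (M + (N - w.length)) (N - (N - w.length)), P m :=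
          Finset.sum_le_sum_of_subset_of_nonneg hsub fun m _ _ => hP m
      _ ≤ ∑ m ∈ levels M w.length, P m +
          ∑ m ∈ levels (M + (N - w.length)) (N - (N - w.length)), P m := by
          rw [← Finset.sum_union_inter]
          exact le_add_of_nonneg_right (Finset.sum_nonneg fun m _ => hP m)
      _ = algebraMap ℝ C (w.length + ((N - (N - w.length) : ℕ) : ℝ)) := by
          rw [hs.sum_Ico, hs.sum_Ico, map_add, map_natCast, map_natCast]
      _ ≤ algebraMap ℝ C (2 * w.length) := by
          refine algebraMap_mono C ?_
          have : ((N - (N - w.length) : ℕ) : ℝ) ≤ w.length := by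
            exact_mod_cast (by omega : N - (N - w.length) ≤ w.length)
          linarith
  exact (norm_mul_le_of_le' (hs.norm_evalWord_le w) h5).trans_eq (one_mul _)

/-- The matrix coefficients of a rational `*`-polynomial in the representation on `ℓ²(ℕ)` that is
given by the partial action of words. -/
def matCoef (h : RatStarPoly) (n m : ℕ) : ℂ :=
  (h.map fun t => if actWord t.2 m = some n then cval t.1 else 0).sum

/-- A bound for the boundary terms of a rational `*`-polynomial. -/
def boundaryBound (h : RatStarPoly) : ℕ :=
  (h.map fun t => (t.1.1.1 + t.1.1.2.1 + (t.1.2.1 + t.1.2.2.1)) * (2 * t.2.length)).sum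

omit hs in
theorem abs_val_le (q : RatCode) : |q.val| ≤ q.1 + q.2.1 := by
  have h1 : (1 : ℝ) ≤ q.2.2 + 1 := by linarith [(q.2.2).cast_nonneg (α := ℝ)]
  rw [RatCode.val, abs_div, abs_of_pos (by linarith : (0 : ℝ) < q.2.2 + 1)]
  refine (div_le_self (abs_nonneg _) h1).trans ?_
  refine (abs_sub _ _).trans ?_
  simp

omit hs in
theorem norm_cval_le (c : RatCode × RatCode) :
    ‖cval c‖ ≤ ((c.1.1 + c.1.2.1 + (c.2.1 + c.2.2.1) : ℕ) : ℝ) := by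
  refine (Complex.norm_le_abs_re_add_abs_im _).trans ?_
  push_cast
  exact add_le_add (abs_val_le _) (abs_val_le _)

theorem CuntzRelations.norm_poly_sub_le (h : RatStarPoly) {M : ℕ}
    (hM : ∀ t ∈ h, t.2.length ≤ M) (N : ℕ) :
    ‖(N : ℝ) • h.eval (cuntzSeq s) - ∑ m ∈ levels M N, ∑ n ∈ levels M N,
      matCoef h n m • (binProd s n * star (binProd s m))‖ ≤ boundaryBound h := by
  induction h with
  | nil => simp [matCoef, boundaryBound]
  | cons t h ih =>
    have h1 := hs.norm_word_sub_le t.2 (hM t (by simp)) N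
    have h2 := ih fun t ht => hM t (by simp [ht])
    have e : (N : ℝ) • RatStarPoly.eval (cuntzSeq s) (t :: h) - ∑ m ∈ levels M N,
        ∑ n ∈ levels M N, matCoef (t :: h) n m • (binProd s n * star (binProd s m)) =
        cval t.1 • ((N : ℝ) • evalWord (cuntzSeq s) t.2 - ∑ m ∈ levels M N, ∑ n ∈ levels M N,
          if actWord t.2 m = some n then binProd s n * star (binProd s m) else 0) +
        ((N : ℝ) • RatStarPoly.eval (cuntzSeq s) h - ∑ m ∈ levels M N, ∑ n ∈ levels M N,
          matCoef h n m • (binProd s n * star (binProd s m))) := by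
      simp only [matCoef, List.map_cons, List.sum_cons, add_smul, ite_smul, zero_smul,
        Finset.sum_add_distrib, RatStarPoly.eval_cons, smul_add, smul_sub, Finset.smul_sum,
        smul_ite, smul_zero, smul_comm (N : ℝ) (cval t.1)]
      abel
    rw [e]
    refine (norm_add_le _ _).trans ?_
    rw [norm_smul]
    have h3 : (boundaryBound (t :: h) : ℝ) =
        ((t.1.1.1 + t.1.1.2.1 + (t.1.2.1 + t.1.2.2.1) : ℕ) : ℝ) * (2 * t.2.length) +
          boundaryBound h := by
      simp [boundaryBound]
    rw [h3]
    exact add_le_add (mul_le_mul (norm_cval_le _) h1 (norm_nonneg _) (Nat.cast_nonneg _)) h2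

/-- An upper bound for the norm of a polynomial in a Cuntz family from an approximate decomposition
of the matrix `q - T` as a square. -/
theorem CuntzRelations.norm_eval_le [PartialOrder C] [StarOrderedRing C] (h : RatStarPoly) {M : ℕ}
    (hM : ∀ t ∈ h, t.2.length ≤ M) (N : ℕ) (h0 : 0 ≤ h.eval (cuntzSeq s)) {q η : ℝ} (hq : 0 ≤ q)
    (G : ℕ → ℕ → ℂ)
    (hG : ∀ n ∈ levels M N, ∀ m ∈ levels M N, ‖(if n = m then (q : ℂ) else 0) - matCoef h n m -
      ∑ k ∈ levels M N, star (G k n) * G k m‖ ≤ η) :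
    N * ‖h.eval (cuntzSeq s)‖ ≤ N * q + (levels M N).card ^ 2 * η + boundaryBound h := by
  set W := levels M N with hW
  -- With q - T = G^*G, the elements v_k satisfy ∑ (q - T)_{nm} U_n U_m^* = ∑ v_k v_k^*, which is
  -- positive in any Cuntz family.
  let v : ℕ → C := fun k => ∑ n ∈ W, star (G k n) • binProd s n
  have hv : ∀ k, v k * star (v k) = ∑ m ∈ W, ∑ n ∈ W,
      (star (G k n) * G k m) • (binProd s n * star (binProd s m)) := by
    intro k
    simp only [v, star_sum, star_smul, star_star, Finset.sum_mul_sum, smul_mul_smul_comm]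
    rw [Finset.sum_comm]
  set X := ∑ m ∈ W, ∑ n ∈ W, matCoef h n m • (binProd s n * star (binProd s m)) with hX
  -- `R` is the total error in Nq - Nh = ∑ v_k v_k^* + R; it consists of the entrywise errors, at
  -- most η each, and the boundary terms.
  set R : C := (N * q : ℝ) • (1 : C) - (N : ℝ) • h.eval (cuntzSeq s) - ∑ k ∈ W, v k * star (v k)
    with hR
  have hq1 : (N * q : ℝ) • (1 : C) = ∑ m ∈ W, ∑ n ∈ W,
      (if n = m then (q : ℂ) else 0) • (binProd s n * star (binProd s m)) := by
    have : ∀ m ∈ W, ∑ n ∈ W, (if n = m then (q : ℂ) else 0) • (binProd s n * star (binProd s m)) =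
        q • (binProd s m * star (binProd s m)) := by
      intro m hm
      rw [Finset.sum_eq_single m]
      · simp
      · intro n _ hn
        rw [if_neg hn, zero_smul]
      · exact fun h => absurd hm h
    rw [Finset.sum_congr rfl this, ← Finset.smul_sum, hs.sum_Ico, mul_comm, mul_smul,
      Nat.cast_smul_eq_nsmul, nsmul_one]
  have hR1 : R = ∑ m ∈ W, ∑ n ∈ W, ((if n = m then (q : ℂ) else 0) - matCoef h n m -
      ∑ k ∈ W, star (G k n) * G k m) • (binProd s n * star (binProd s m)) -
      ((N : ℝ) • h.eval (cuntzSeq s) - X) := by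
    have h3 : ∑ k ∈ W, v k * star (v k) = ∑ m ∈ W, ∑ n ∈ W,
        (∑ k ∈ W, star (G k n) * G k m) • (binProd s n * star (binProd s m)) := by
      simp only [hv, Finset.sum_smul]
      rw [Finset.sum_comm]
      refine Finset.sum_congr rfl fun m _ => ?_
      rw [Finset.sum_comm]
    rw [hR, hq1, h3, hX]
    simp only [sub_smul, Finset.sum_sub_distrib]
    abel
  have hUU : ∀ n m, ‖binProd s n * star (binProd s m)‖ ≤ 1 := fun n m => by
    simpa using norm_mul_le_of_le' (hs.norm_binProd_le n)
      ((norm_star (binProd s m)).trans_le (hs.norm_binProd_le m))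
  have hRn : ‖R‖ ≤ W.card ^ 2 * η + boundaryBound h := by
    rw [hR1]
    refine (norm_sub_le _ _).trans (add_le_add ?_ (hs.norm_poly_sub_le h hM N))
    refine (norm_sum_le_of_le W (n := fun _ => W.card * η) fun m hm => ?_).trans_eq ?_
    · refine (norm_sum_le_of_le W (n := fun _ => η) fun n hn => ?_).trans_eq ?_
      · rw [norm_smul]
        exact (mul_le_of_le_one_right (norm_nonneg _) (hUU n m)).trans (hG n hn m hm)
      · simp
    · simp only [Finset.sum_const, nsmul_eq_mul]
      ring
  have hsa : IsSelfAdjoint R := by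
    refine IsSelfAdjoint.sub (IsSelfAdjoint.sub ?_ ?_) ?_
    · exact (IsSelfAdjoint.all (N * q : ℝ)).smul (IsSelfAdjoint.one C)
    · exact (IsSelfAdjoint.all (N : ℝ)).smul h0.isSelfAdjoint
    · exact (Finset.sum_nonneg fun k _ => mul_star_self_nonneg (v k)).isSelfAdjoint
  -- Dropping the positive sum leaves Nh ≤ Nq - R ≤ Nq + ‖R‖, where self-adjointness of `R` is used.
  have hle : (N : ℝ) • h.eval (cuntzSeq s) ≤ algebraMap ℝ C (N * q + ‖R‖) := by
    have h1 : -R ≤ algebraMap ℝ C ‖R‖ := by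
      have := IsSelfAdjoint.le_algebraMap_norm_self (a := -R) hsa.neg
      rwa [norm_neg] at this
    have h2 : (N : ℝ) • h.eval (cuntzSeq s) =
        algebraMap ℝ C (N * q) + -R - ∑ k ∈ W, v k * star (v k) := by
      rw [hR, Algebra.algebraMap_eq_smul_one]
      abel
    rw [h2, map_add]
    exact (sub_le_self _ (Finset.sum_nonneg fun k _ => mul_star_self_nonneg (v k))).trans
      (add_le_add_right h1 _)
  have h4 := norm_le_of_le_algebraMap (smul_nonneg N.cast_nonneg h0)
    (add_nonneg (mul_nonneg N.cast_nonneg hq) (norm_nonneg R)) hle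
  rw [norm_smul, Real.norm_of_nonneg N.cast_nonneg] at h4
  linarith

end Cuntz

end KEP

end

noncomputable section

namespace KEP

/-! ## The representation of the Cuntz relations on `ℓ²(ℕ)` -/

section Representation

open scoped InnerProductSpace

/-- The Hilbert space `ℓ²(ℕ)`. -/
abbrev EllTwo : Type := lp (fun _ : ℕ => ℂ) 2

/-- The standard basis of `ℓ²(ℕ)`. -/
def stdBasis : HilbertBasis ℕ ℂ EllTwo := default

theorem inner_stdBasis (m n : ℕ) : ⟪stdBasis m, stdBasis n⟫_ℂ = if m = n then 1 else 0 :=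
  orthonormal_iff_ite.1 stdBasis.orthonormal m n

theorem ext_inner_stdBasis {x y : EllTwo} (h : ∀ n, ⟪stdBasis n, x⟫_ℂ = ⟪stdBasis n, y⟫_ℂ) :
    x = y := by
  refine stdBasis.repr.injective (lp.ext (funext fun n => ?_))
  rw [stdBasis.repr_apply_apply, stdBasis.repr_apply_apply, h]

theorem ext_stdBasis {A B : EllTwo →L[ℂ] EllTwo} (h : ∀ n, A (stdBasis n) = B (stdBasis n)) :
    A = B := by
  refine ContinuousLinearMap.ext_on (s := Set.range stdBasis) ?_ ?_
  · rw [dense_iff_closure_eq, ← Submodule.topologicalClosure_coe, stdBasis.dense_span]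
    rfl
  · rintro _ ⟨n, rfl⟩
    exact h n

theorem orthonormal_stdBasis_comp (i : Fin 2) :
    Orthonormal ℂ fun n : ℕ => stdBasis (2 * n + i) :=
  stdBasis.orthonormal.comp _ fun m n h => by
    have : 2 * m + (i : ℕ) = 2 * n + i := h
    omega

/-- The isometry `e_n ↦ e_{2 n + i}` of `ℓ²(ℕ)`. -/
def stdGen (i : Fin 2) : EllTwo →L[ℂ] EllTwo :=
  (orthonormal_stdBasis_comp i).orthogonalFamily.linearIsometry.toContinuousLinearMap

theorem stdGen_apply (i : Fin 2) (n : ℕ) : stdGen i (stdBasis n) = stdBasis (2 * n + i) := by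
  have h1 : stdBasis n = lp.single 2 n (1 : ℂ) := by
    have := stdBasis.repr_self n
    rw [← stdBasis.repr_symm_single n]
    rfl
  rw [h1]
  refine ((orthonormal_stdBasis_comp i).orthogonalFamily.linearIsometry_apply_single
    (1 : ℂ)).trans ?_
  simp

theorem star_stdGen_apply (i : Fin 2) (m : ℕ) :
    star (stdGen i) (stdBasis m) = if m % 2 = i then stdBasis (m / 2) else 0 := by
  refine ext_inner_stdBasis fun n => ?_
  rw [ContinuousLinearMap.star_eq_adjoint, ContinuousLinearMap.adjoint_inner_right, stdGen_apply,
    inner_stdBasis]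
  have hi := i.2
  by_cases h : m % 2 = i
  · rw [if_pos h, inner_stdBasis]
    refine if_congr ?_ rfl rfl
    omega
  · rw [if_neg h, inner_zero_right, if_neg]
    omega

theorem cuntzRelations_stdGen : CuntzRelations stdGen := by
  constructor
  · intro i j
    refine ext_stdBasis fun n => ?_
    rw [mul_apply_eq_comp, stdGen_apply, star_stdGen_apply]
    have hi := i.2
    have hj := j.2
    by_cases h : i = j
    · subst h
      rw [if_pos (by omega), if_pos rfl, show (2 * n + (i : ℕ)) / 2 = n by omega]
      rfl
    · rw [if_neg h, if_neg]
      · rfl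
      · intro h1
        exact h (Fin.ext (by omega))
  · refine ext_stdBasis fun n => ?_
    rw [Fin.sum_univ_two, _root_.add_apply, mul_apply_eq_comp, mul_apply_eq_comp,
      star_stdGen_apply, star_stdGen_apply]
    rcases Nat.mod_two_eq_zero_or_one n with h | h
    · simp only [h, Fin.val_zero, Fin.val_one, if_true, zero_ne_one, if_false, map_zero, add_zero,
        stdGen_apply]
      rw [show 2 * (n / 2) = n by omega]
      rfl
    · simp only [h, Fin.val_zero, Fin.val_one, if_true, one_ne_zero, if_false, map_zero, zero_add,
        stdGen_apply]
      rw [show 2 * (n / 2) + 1 = n by omega]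
      rfl

theorem evalWord_stdGen_apply (w : List (ℕ × Bool)) (m : ℕ) :
    evalWord (cuntzSeq stdGen) w (stdBasis m) = (actWord w m).elim 0 stdBasis := by
  induction w with
  | nil => rfl
  | cons l w ih =>
    rw [evalWord_cons, mul_apply_eq_comp, ih, actWord_cons]
    cases actWord w m with
    | none => simp
    | some r =>
      obtain ⟨i, b⟩ := l
      cases b
      · simp [actLetter, cuntzSeq, stdGen_apply]
      · simp only [if_true, cuntzSeq, Option.elim_some, star_stdGen_apply, actLetter,
          Option.bind_some]
        split_ifs <;> rfl

theorem inner_eval_stdGen (h : RatStarPoly) (n m : ℕ) :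
    ⟪stdBasis n, h.eval (cuntzSeq stdGen) (stdBasis m)⟫_ℂ = matCoef h n m := by
  induction h with
  | nil => simp [matCoef]
  | cons t h ih =>
    rw [RatStarPoly.eval_cons, _root_.add_apply, inner_add_right, ih,
      _root_.smul_apply, inner_smul_right, evalWord_stdGen_apply]
    simp only [matCoef, List.map_cons, List.sum_cons]
    congr 1
    cases actWord t.2 m with
    | none => simp
    | some r =>
      simp only [Option.elim_some, inner_stdBasis, Option.some.injEq, eq_comm (a := n)]
      split_ifs <;> simp

theorem eval_map {C D : Type*} [CStarAlgebra C] [CStarAlgebra D] (φ : C →⋆ₐ[ℂ] D) (a : ℕ → C)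
    (p : RatStarPoly) : φ (p.eval a) = p.eval fun i => φ (a i) := by
  have hw : ∀ w, φ (evalWord a w) = evalWord (fun i => φ (a i)) w := by
    intro w
    induction w with
    | nil => simp
    | cons l w ih =>
      rw [evalWord_cons, evalWord_cons, map_mul, ih]
      split_ifs <;> simp [map_star]
  induction p with
  | nil => simp
  | cons t p ih => simp [RatStarPoly.eval_cons, hw, ih]

variable {O : Type} [CStarAlgebra O] {s : Fin 2 → O}

/-- The universal property maps O₂ to operators on ℓ²(ℕ), and `*`-homomorphisms are contractive. -/
theorem IsCuntzAlgebraTwo.norm_eval_stdGen_le (hO : IsCuntzAlgebraTwo O s) (h : RatStarPoly) :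
    ‖h.eval (cuntzSeq stdGen)‖ ≤ ‖h.eval (cuntzSeq s)‖ := by
  obtain ⟨φ, hφ, -⟩ := hO.existsUnique_hom (EllTwo →L[ℂ] EllTwo) stdGen cuntzRelations_stdGen
  have : h.eval (cuntzSeq stdGen) = φ (h.eval (cuntzSeq s)) := by
    rw [eval_map]
    exact congrArg (fun a => RatStarPoly.eval a h) (funext fun i => (hφ _).symm)
  rw [this]
  exact NonUnitalStarAlgHom.norm_apply_le φ _

/-- The quadratic form of `q - T`, where `T` is the matrix of a rational `*`-polynomial. -/
def gapForm (h : RatStarPoly) (q : ℝ) (W : Finset ℕ) (ξ : ℕ → ℂ) : ℂ :=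
  ∑ n ∈ W, ∑ m ∈ W, star (ξ n) * ((if n = m then (q : ℂ) else 0) - matCoef h n m) * ξ m

theorem algebraMap_real_apply (q : ℝ) (x : EllTwo) :
    algebraMap ℝ (EllTwo →L[ℂ] EllTwo) q x = (q : ℂ) • x := by
  rw [IsScalarTower.algebraMap_apply ℝ ℂ, Algebra.algebraMap_eq_smul_one, _root_.smul_apply]
  rfl

theorem gapForm_eq (h : RatStarPoly) (q : ℝ) (W : Finset ℕ) (ξ : ℕ → ℂ) :
    gapForm h q W ξ = ⟪∑ n ∈ W, ξ n • stdBasis n, (algebraMap ℝ (EllTwo →L[ℂ] EllTwo) q -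
      h.eval (cuntzSeq stdGen)) (∑ n ∈ W, ξ n • stdBasis n)⟫_ℂ := by
  rw [gapForm, sum_inner]
  refine Finset.sum_congr rfl fun n _ => ?_
  rw [map_sum, inner_sum]
  refine Finset.sum_congr rfl fun m _ => ?_
  rw [map_smul, inner_smul_left, inner_smul_right, _root_.sub_apply, inner_sub_right,
    inner_eval_stdGen, algebraMap_real_apply, inner_smul_right, inner_stdBasis, starRingEnd_apply]
  split_ifs <;> ring

/-- The form is that of a compression of q - T, whose real part is nonnegative by Cauchy–Schwarz
once ‖T‖ ≤ q. -/
theorem gapForm_re_nonneg {h : RatStarPoly} {q : ℝ} (hq : ‖h.eval (cuntzSeq stdGen)‖ ≤ q)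
    (W : Finset ℕ) (ξ : ℕ → ℂ) : 0 ≤ (gapForm h q W ξ).re := by
  rw [gapForm_eq]
  set x := ∑ n ∈ W, ξ n • stdBasis n
  have h1 : ⟪x, (algebraMap ℝ (EllTwo →L[ℂ] EllTwo) q - h.eval (cuntzSeq stdGen)) x⟫_ℂ =
      ((q * ‖x‖ ^ 2 : ℝ) : ℂ) - ⟪x, h.eval (cuntzSeq stdGen) x⟫_ℂ := by
    rw [_root_.sub_apply, inner_sub_right, algebraMap_real_apply, inner_smul_right,
      inner_self_eq_norm_sq_to_K]
    simp
  rw [h1, Complex.sub_re, Complex.ofReal_re, sub_nonneg]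
  have h2 := (h.eval (cuntzSeq stdGen)).le_opNorm x
  calc (⟪x, h.eval (cuntzSeq stdGen) x⟫_ℂ).re ≤ ‖⟪x, h.eval (cuntzSeq stdGen) x⟫_ℂ‖ :=
        Complex.re_le_norm _
    _ ≤ ‖x‖ * ‖h.eval (cuntzSeq stdGen) x‖ := norm_inner_le_norm _ _
    _ ≤ q * ‖x‖ ^ 2 := by
        have := mul_le_mul_of_nonneg_right hq (norm_nonneg x)
        nlinarith [norm_nonneg x]

open scoped ComplexOrder MatrixOrder in
/-- If the quadratic form of `q - T` is nonnegative then `q - T` is a square. -/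
theorem exists_eq_sum_of_gapForm_nonneg {h : RatStarPoly}
    (h0 : IsSelfAdjoint (h.eval (cuntzSeq stdGen))) {q : ℝ} {W : Finset ℕ}
    (hW : ∀ ξ, 0 ≤ (gapForm h q W ξ).re) : ∃ G : ℕ → ℕ → ℂ, ∀ n ∈ W, ∀ m ∈ W,
      (if n = m then (q : ℂ) else 0) - matCoef h n m = ∑ k ∈ W, star (G k n) * G k m := by
  let Q : Matrix W W ℂ := fun n m => (if (n : ℕ) = m then (q : ℂ) else 0) - matCoef h n m
  have hherm : ∀ n m, star (matCoef h n m) = matCoef h m n := by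
    intro n m
    rw [← inner_eval_stdGen, ← inner_eval_stdGen, ← starRingEnd_apply, inner_conj_symm,
      ← ContinuousLinearMap.adjoint_inner_left, ← ContinuousLinearMap.star_eq_adjoint, h0.star_eq]
  have hQ : Q.IsHermitian := by
    ext n m
    change star ((if (m : ℕ) = n then (q : ℂ) else 0) - matCoef h m n) =
      (if (n : ℕ) = m then (q : ℂ) else 0) - matCoef h n m
    rw [star_sub, hherm, apply_ite star, star_zero, ← starRingEnd_apply, Complex.conj_ofReal]
    simp only [eq_comm]
  have hform : ∀ x : W → ℂ, star x ⬝ᵥ Q.mulVec x =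
      gapForm h q W fun n => if hn : n ∈ W then x ⟨n, hn⟩ else 0 := by
    intro x
    simp only [gapForm, dotProduct, Matrix.mulVec, Finset.mul_sum, Pi.star_apply]
    rw [← Finset.sum_coe_sort W]
    refine Finset.sum_congr rfl fun n _ => ?_
    rw [← Finset.sum_coe_sort W]
    refine Finset.sum_congr rfl fun m _ => ?_
    simp [Q, mul_assoc]
  have hpos : Q.PosSemidef := by
    refine Matrix.PosSemidef.of_dotProduct_mulVec_nonneg hQ fun x => ?_
    have him : (star x ⬝ᵥ Q.mulVec x).im = 0 := hQ.im_star_dotProduct_mulVec_self x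
    rw [Complex.nonneg_iff]
    exact ⟨by rw [hform]; exact hW _, him.symm⟩
  -- Positive semidefinite matrices are the positive elements of a matrix algebra, hence of the form
  -- G^*G.
  obtain ⟨G, hG⟩ := CStarAlgebra.nonneg_iff_eq_star_mul_self.1 hpos.nonneg
  refine ⟨fun k n => if hk : k ∈ W ∧ n ∈ W then G ⟨k, hk.1⟩ ⟨n, hk.2⟩ else 0,
    fun n hn m hm => ?_⟩
  have h1 : Q ⟨n, hn⟩ ⟨m, hm⟩ = (star G * G) ⟨n, hn⟩ ⟨m, hm⟩ := by rw [hG]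
  refine h1.trans ?_
  rw [Matrix.mul_apply, ← Finset.sum_coe_sort W]
  refine Finset.sum_congr rfl fun k _ => ?_
  simp [hn, hm, Matrix.star_apply]

end Representation

end KEP

end

noncomputable section

namespace KEP

/-! ## Computations with Gaussian rationals -/

/-- Codes of Gaussian rational numbers. -/
abbrev GaussCode : Type := RatCode × RatCode

/-- Sum of Gaussian codes. -/
def cadd (c d : GaussCode) : GaussCode := (c.1.add d.1, c.2.add d.2)

/-- Negative of a Gaussian code. -/
def cneg (c : GaussCode) : GaussCode := (c.1.neg, c.2.neg)

/-- Complex conjugate of a Gaussian code. -/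
def cconj (c : GaussCode) : GaussCode := (c.1, c.2.neg)

/-- The Gaussian code of a rational number. -/
def cofRat (q : RatCode) : GaussCode := (q, RatCode.ofNat 0)

/-- The square of the absolute value of a Gaussian code. -/
def cnormSq (c : GaussCode) : RatCode := (c.1.mul c.1).add (c.2.mul c.2)

/-- Finite sums of Gaussian codes. -/
def csum (m : ℕ) (F : ℕ → GaussCode) : GaussCode :=
  Nat.rec (cofRat (RatCode.ofNat 0)) (fun n s => cadd s (F n)) m

@[simp] theorem cval_cadd (c d : GaussCode) : cval (cadd c d) = cval c + cval d := by
  apply Complex.ext <;> simp [cval, cadd]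

@[simp] theorem cval_cneg (c : GaussCode) : cval (cneg c) = -cval c := by
  apply Complex.ext <;> simp [cval, cneg]

@[simp] theorem cval_cconj (c : GaussCode) : cval (cconj c) = star (cval c) := by
  apply Complex.ext <;> simp [cval, cconj]

@[simp] theorem cval_cofRat (q : RatCode) : cval (cofRat q) = (q.val : ℂ) := by
  apply Complex.ext <;> simp [cval, cofRat]

theorem val_cnormSq (c : GaussCode) : (cnormSq c).val = ‖cval c‖ ^ 2 := by
  rw [← Complex.normSq_eq_norm_sq, Complex.normSq_apply]
  simp [cnormSq, cval]

@[simp] theorem cval_csum (m : ℕ) (F : ℕ → GaussCode) :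
    cval (csum m F) = ∑ i ∈ Finset.range m, cval (F i) := by
  induction m with
  | zero => simp [csum]
  | succ m ih => rw [Finset.sum_range_succ, ← ih, ← cval_cadd]; rfl

section Computable

variable {α : Type*} [Primcodable α]

@[fun_prop] theorem computable_cadd {f g : α → GaussCode} (hf : Computable f) (hg : Computable g) :
    Computable fun a => cadd (f a) (g a) := by unfold cadd; fun_prop

@[fun_prop] theorem computable_cneg {f : α → GaussCode} (hf : Computable f) :
    Computable fun a => cneg (f a) := by unfold cneg; fun_prop

@[fun_prop] theorem computable_cconj {f : α → GaussCode} (hf : Computable f) :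
    Computable fun a => cconj (f a) := by unfold cconj; fun_prop

@[fun_prop] theorem computable_cofRat {f : α → RatCode} (hf : Computable f) :
    Computable fun a => cofRat (f a) := by unfold cofRat; fun_prop

@[fun_prop] theorem computable_cnormSq {f : α → GaussCode} (hf : Computable f) :
    Computable fun a => cnormSq (f a) := by unfold cnormSq; fun_prop

theorem computable_csum {m : α → ℕ} {F : α × ℕ → GaussCode} (hm : Computable m)
    (hF : Computable F) : Computable fun a => csum (m a) fun i => F (a, i) := by
  have key := computable_nat_rec (f := m) (g := fun _ => cofRat (RatCode.ofNat 0))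
    (h := fun p : α × ℕ × GaussCode => cadd p.2.2 (F (p.1, p.2.1))) hm (by fun_prop) (by fun_prop)
  exact key

end Computable

/-- The code of a matrix coefficient. -/
def matCode (h : RatStarPoly) (n m : ℕ) : GaussCode :=
  h.foldr (fun t s => if actWord t.2 m = some n then cadd t.1 s else s) (cofRat (RatCode.ofNat 0))

theorem cval_matCode (h : RatStarPoly) (n m : ℕ) : cval (matCode h n m) = matCoef h n m := by
  induction h with
  | nil => simp [matCode, matCoef]
  | cons t h ih =>
    simp only [matCode, matCoef, List.foldr_cons, List.map_cons, List.sum_cons] at ih ⊢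
    split_ifs <;> simp [ih]

section Computable

variable {α : Type*} [Primcodable α]

@[fun_prop] theorem computable_genBit {f : α → ℕ} (hf : Computable f) :
    Computable fun a => genBit (f a) := by unfold genBit; fun_prop

theorem computable_actLetter {f : α → ℕ × Bool} {g : α → ℕ} (hf : Computable f)
    (hg : Computable g) : Computable fun a => actLetter (f a) (g a) := by
  unfold actLetter; fun_prop

@[fun_prop] theorem computable_actWord {f : α → List (ℕ × Bool)} {g : α → ℕ} (hf : Computable f)
    (hg : Computable g) : Computable fun a => actWord (f a) (g a) := by
  have h1 : Computable fun p : (α × Option ℕ × (ℕ × Bool)) × ℕ => actLetter p.1.2.2 p.2 :=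
    computable_actLetter (by fun_prop) (by fun_prop)
  have h2 := computable_option_elim (o := fun p : α × Option ℕ × (ℕ × Bool) => p.2.1)
    (f := fun _ => (none : Option ℕ)) (by fun_prop) (by fun_prop) h1
  refine (computable_foldr (s := fun a => some (g a)) hf (by fun_prop) h2).of_eq fun a => ?_
  unfold actWord
  congr 1
  funext l o
  cases o <;> rfl

@[fun_prop] theorem computable_matCode {f : α → RatStarPoly} {n m : α → ℕ} (hf : Computable f)
    (hn : Computable n) (hm : Computable m) : Computable fun a => matCode (f a) (n a) (m a) :=
  computable_foldr (h := fun p : α × GaussCode × (GaussCode × List (ℕ × Bool)) =>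
    if actWord p.2.2.2 (m p.1) = some (n p.1) then cadd p.2.2.1 p.2.1 else p.2.1) hf (by fun_prop)
    (by fun_prop)

theorem computable_sum_map {β : Type*} [Primcodable β] {f : α → List β} {g : β → ℕ}
    (hf : Computable f) (hg : Computable g) : Computable fun a => ((f a).map g).sum := by
  refine (computable_foldr (s := fun _ => 0) (h := fun p : α × ℕ × β => g p.2.2 + p.2.1) hf
    (by fun_prop) (by fun_prop)).of_eq fun a => ?_
  induction f a with
  | nil => rfl
  | cons b l ih => simp [← ih]

@[fun_prop] theorem computable_boundaryBound {f : α → RatStarPoly} (hf : Computable f) :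
    Computable fun a => boundaryBound (f a) :=
  computable_sum_map (β := GaussCode × List (ℕ × Bool)) hf (by fun_prop)

end Computable

/-- A bound for the lengths of the words of a rational `*`-polynomial. -/
def lengthBound (h : RatStarPoly) : ℕ := (h.map fun t => t.2.length).sum

theorem length_le_lengthBound (h : RatStarPoly) : ∀ t ∈ h, t.2.length ≤ lengthBound h := fun _ ht =>
  List.le_sum_of_mem (List.mem_map_of_mem ht)

@[fun_prop] theorem computable_lengthBound {α : Type*} [Primcodable α] {f : α → RatStarPoly}
    (hf : Computable f) : Computable fun a => lengthBound (f a) :=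
  computable_sum_map (β := GaussCode × List (ℕ × Bool)) hf (by fun_prop)

/-- The indices of the rows and columns of the matrices of a rational `*`-polynomial. -/
abbrev polyLevels (h : RatStarPoly) (N : ℕ) : Finset ℕ := levels (lengthBound h) N

/-- The number of elements of `polyLevels`. -/
def levelCard (h : RatStarPoly) (N : ℕ) : ℕ := 2 ^ (lengthBound h + N) - 2 ^ lengthBound h

theorem sum_polyLevels {A : Type*} [AddCommMonoid A] (h : RatStarPoly) (N : ℕ) (f : ℕ → A) :
    ∑ n ∈ polyLevels h N, f n =
      ∑ i ∈ Finset.range (levelCard h N), f (2 ^ lengthBound h + i) :=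
  Finset.sum_Ico_eq_sum_range _ _ _

theorem forall_polyLevels {h : RatStarPoly} {N : ℕ} {p : ℕ → Prop} :
    (∀ n ∈ polyLevels h N, p n) ↔ ∀ i < levelCard h N, p (2 ^ lengthBound h + i) := by
  constructor
  · intro H i hi
    exact H _ (Finset.mem_Ico.2 (by unfold levelCard at hi; omega))
  · intro H n hn
    rw [Finset.mem_Ico] at hn
    have := H (n - 2 ^ lengthBound h) (by unfold levelCard; omega)
    rwa [Nat.add_sub_cancel' hn.1] at this

theorem card_polyLevels (h : RatStarPoly) (N : ℕ) :
    (polyLevels h N).card = levelCard h N := Nat.card_Ico _ _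

@[fun_prop] theorem computable_levelCard {α : Type*} [Primcodable α] {f : α → RatStarPoly}
    {g : α → ℕ} (hf : Computable f) (hg : Computable g) :
    Computable fun a => levelCard (f a) (g a) := by unfold levelCard; fun_prop

/-- The function with a given code. -/
def gaussFun (l : List GaussCode) (n : ℕ) : GaussCode := l.getD n (cofRat (RatCode.ofNat 0))

/-- The matrix with a given code. -/
def gaussArray (G : List (List GaussCode)) (k n : ℕ) : GaussCode := gaussFun (G.getD k []) n

@[fun_prop] theorem computable_gaussFun {α : Type*} [Primcodable α] {f : α → List GaussCode}
    {g : α → ℕ} (hf : Computable f) (hg : Computable g) :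
    Computable fun a => gaussFun (f a) (g a) := by unfold gaussFun; fun_prop

@[fun_prop] theorem computable_gaussArray {α : Type*} [Primcodable α]
    {f : α → List (List GaussCode)} {g k : α → ℕ} (hf : Computable f) (hg : Computable g)
    (hk : Computable k) : Computable fun a => gaussArray (f a) (g a) (k a) := by
  unfold gaussArray; fun_prop

theorem exists_gaussFun_eq (K : ℕ) (p : ℕ → GaussCode) : ∃ l, ∀ n < K, gaussFun l n = p n :=
  ⟨(List.range K).map p, fun n hn => by simp [gaussFun, List.getD_eq_getElem?_getD, hn]⟩

theorem exists_gaussArray_eq (K : ℕ) (p : ℕ → ℕ → GaussCode) :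
    ∃ G, ∀ k < K, ∀ n < K, gaussArray G k n = p k n :=
  ⟨(List.range K).map fun k => (List.range K).map (p k), fun k hk n hn => by
    simp [gaussArray, gaussFun, List.getD_eq_getElem?_getD, hk, hn]⟩

theorem exists_tendsto_cval (z : ℂ) : ∃ c : ℕ → GaussCode, Tendsto (fun j => cval (c j)) atTop (𝓝 z) := by
  choose c hc using fun j : ℕ => exists_cval_near z (ε := 1 / ((j : ℝ) + 1)) (by positivity)
  refine ⟨c, ?_⟩
  rw [tendsto_iff_norm_sub_tendsto_zero]
  refine squeeze_zero (fun _ => norm_nonneg _) (fun j => ?_) tendsto_one_div_add_atTop_nhds_zero_nat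
  rw [norm_sub_rev]
  exact (hc j).le

/-! ## Certificates for bounds of norms -/

/-- A certificate for `‖h‖ < q`: an approximate decomposition of `q' - T` as a square. -/
def UpperCert (h : RatStarPoly) (q : RatCode)
    (c : ℕ × ℕ × RatCode × List (List GaussCode)) : Prop :=
  (∀ n ∈ polyLevels h c.1, ∀ m ∈ polyLevels h c.1,
    ‖(if n = m then (c.2.2.1.val : ℂ) else 0) - matCoef h n m - ∑ k ∈ polyLevels h c.1,
      star (cval (gaussArray c.2.2.2 k n)) * cval (gaussArray c.2.2.2 k m)‖ <
        1 / ((c.2.1 : ℝ) + 1)) ∧ ¬ c.2.2.1.val < 0 ∧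
  c.1 * c.2.2.1.val + levelCard h c.1 ^ 2 * (1 / ((c.2.1 : ℝ) + 1)) + boundaryBound h < c.1 * q.val

/-- A certificate for `q < ‖h‖`: a vector on which the form of `q - T` is negative. -/
def LowerCert (h : RatStarPoly) (q : RatCode) (c : ℕ × List GaussCode) : Prop :=
  (gapForm h q.val (polyLevels h c.1) fun n => cval (gaussFun c.2 n)).re < 0

/-! ### Soundness and completeness of the certificates. -/

section Cert

variable {O : Type} [CStarAlgebra O] [PartialOrder O] [StarOrderedRing O] {s : Fin 2 → O}

theorem CuntzRelations.norm_lt_of_upperCert (hs : CuntzRelations s) {h : RatStarPoly}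
    (h0 : 0 ≤ h.eval (cuntzSeq s)) {q : RatCode} {c : ℕ × ℕ × RatCode × List (List GaussCode)}
    (hc : UpperCert h q c) : ‖h.eval (cuntzSeq s)‖ < q.val := by
  have h1 := hs.norm_eval_le h (length_le_lengthBound h) c.1 h0 (not_lt.1 hc.2.1)
    (fun k n => cval (gaussArray c.2.2.2 k n)) fun n hn m hm => (hc.1 n hn m hm).le
  rw [card_polyLevels] at h1
  have h2 := h1.trans_lt hc.2.2
  exact lt_of_mul_lt_mul_left h2 (Nat.cast_nonneg _)

theorem isSelfAdjoint_eval_stdGen (p : RatStarPoly) :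
    IsSelfAdjoint ((p.adj.mul p).eval (cuntzSeq stdGen)) := by
  rw [RatStarPoly.eval_mul, RatStarPoly.eval_adj]
  exact IsSelfAdjoint.star_mul_self _

-- For ‖h‖ < q' < q the compression of q' - T is exactly a square, by the representation on ℓ²(ℕ).
-- Gaussian rational approximations of its factor satisfy the strict entrywise bound.
omit [PartialOrder O] [StarOrderedRing O] in
theorem IsCuntzAlgebraTwo.exists_upperCert (hO : IsCuntzAlgebraTwo O s) {h : RatStarPoly}
    (h0 : IsSelfAdjoint (h.eval (cuntzSeq stdGen))) {q : RatCode}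
    (hq : ‖h.eval (cuntzSeq s)‖ < q.val) : ∃ c, UpperCert h q c := by
  obtain ⟨q', hq1, hq2⟩ := RatCode.exists_between hq
  -- `N` is so large that N(q - q') exceeds the boundary bound plus 1; the 1 absorbs the entrywise
  -- errors.
  obtain ⟨N, hN⟩ := exists_nat_gt ((boundaryBound h + 1) / (q.val - q'.val))
  rw [div_lt_iff₀ (sub_pos.2 hq2)] at hN
  obtain ⟨G, hG⟩ := exists_eq_sum_of_gapForm_nonneg h0 (W := polyLevels h N) fun ξ =>
    gapForm_re_nonneg ((hO.norm_eval_stdGen_le h).trans hq1.le) _ ξ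
  choose g hg using fun k n => exists_tendsto_cval (G k n)
  -- With r the squared size of the matrix, r entries of error 1/(r + 1) add up to at most 1.
  let r := levelCard h N ^ 2
  have hr : (levelCard h N : ℝ) ^ 2 * (1 / ((r : ℝ) + 1)) ≤ 1 := by
    rw [mul_one_div, div_le_one (by positivity)]
    simp [r]
  have key : ∀ᶠ j in atTop, ∀ n ∈ polyLevels h N, ∀ m ∈ polyLevels h N,
      ‖(if n = m then (q'.val : ℂ) else 0) - matCoef h n m - ∑ k ∈ polyLevels h N,
        star (cval (g k n j)) * cval (g k m j)‖ < 1 / ((r : ℝ) + 1) := by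
    refine (Filter.eventually_all_finset _).2 fun n hn => (Filter.eventually_all_finset _).2
      fun m hm => ?_
    have h1 : Tendsto (fun j => ‖(if n = m then (q'.val : ℂ) else 0) - matCoef h n m -
        ∑ k ∈ polyLevels h N, star (cval (g k n j)) * cval (g k m j)‖) atTop (𝓝 0) := by
      have h2 := ((tendsto_finsetSum (polyLevels h N) fun k _ =>
        ((hg k n).star).mul (hg k m)).const_sub
          ((if n = m then (q'.val : ℂ) else 0) - matCoef h n m)).norm
      have h3 : (if n = m then (q'.val : ℂ) else 0) - matCoef h n m -
          ∑ k ∈ polyLevels h N, star (G k n) * G k m = 0 := by rw [hG n hn m hm, sub_self]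
      rwa [h3, norm_zero] at h2
    exact h1.eventually_lt_const (by positivity)
  obtain ⟨j, hj⟩ := key.exists
  obtain ⟨A, hA⟩ := exists_gaussArray_eq (2 ^ (lengthBound h + N)) fun k n => g k n j
  refine ⟨(N, r, q', A), fun n hn m hm => ?_, not_lt.2 ((norm_nonneg _).trans hq1.le), ?_⟩
  · have h1 : ∀ k ∈ polyLevels h N, k < 2 ^ (lengthBound h + N) := fun k hk =>
      (Finset.mem_Ico.1 hk).2
    refine lt_of_eq_of_lt (congrArg norm (congrArg _ (Finset.sum_congr rfl fun k hk => ?_)))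
      (hj n hn m hm)
    rw [hA k (h1 k hk) n (h1 n hn), hA k (h1 k hk) m (h1 m hm)]
  · have : (N : ℝ) * q'.val + levelCard h N ^ 2 * (1 / ((r : ℝ) + 1)) + boundaryBound h <
      N * q.val := by nlinarith
    exact this

-- A negative value of the form forces ‖T‖ > q on ℓ²(ℕ), and the norm in O₂ is at least that.
omit [PartialOrder O] [StarOrderedRing O] in
theorem IsCuntzAlgebraTwo.lt_norm_of_lowerCert (hO : IsCuntzAlgebraTwo O s) {h : RatStarPoly}
    {q : RatCode} {c : ℕ × List GaussCode} (hc : LowerCert h q c) :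
    q.val < ‖h.eval (cuntzSeq s)‖ := by
  by_contra hle
  exact absurd (gapForm_re_nonneg ((hO.norm_eval_stdGen_le h).trans (not_lt.1 hle)) _ _)
    (not_le.2 hc)

/-- If no rational vector makes the form negative, then by density none does, and q - T is a square
on every window. The averaging estimate gives N‖h‖ ≤ Nq + const for all `N`, hence ‖h‖ ≤ q. -/
theorem CuntzRelations.exists_lowerCert (hs : CuntzRelations s) {h : RatStarPoly}
    (h0 : 0 ≤ h.eval (cuntzSeq s)) (h0' : IsSelfAdjoint (h.eval (cuntzSeq stdGen))) {q : RatCode}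
    (hq0 : 0 ≤ q.val) (hq : q.val < ‖h.eval (cuntzSeq s)‖) : ∃ c, LowerCert h q c := by
  by_contra hno
  push Not at hno
  have hform : ∀ N ξ, 0 ≤ (gapForm h q.val (polyLevels h N) ξ).re := by
    intro N ξ
    choose g hg using fun n => exists_tendsto_cval (ξ n)
    have h1 : Tendsto (fun j => (gapForm h q.val (polyLevels h N) fun n => cval (g n j)).re) atTop
        (𝓝 (gapForm h q.val (polyLevels h N) ξ).re) := by
      refine (Complex.continuous_re.tendsto _).comp ?_
      exact tendsto_finsetSum _ fun n _ => tendsto_finsetSum _ fun m _ =>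
        ((hg n).star.mul_const _).mul (hg m)
    refine ge_of_tendsto' h1 fun j => ?_
    obtain ⟨l, hl⟩ := exists_gaussFun_eq (2 ^ (lengthBound h + N)) fun n => g n j
    have h2 := not_lt.1 (hno (N, l))
    have h3 : gapForm h q.val (polyLevels h N) (fun n => cval (gaussFun l n)) =
        gapForm h q.val (polyLevels h N) fun n => cval (g n j) := by
      refine Finset.sum_congr rfl fun n hn => Finset.sum_congr rfl fun m hm => ?_
      beta_reduce
      rw [hl n (Finset.mem_Ico.1 hn).2, hl m (Finset.mem_Ico.1 hm).2]
    exact h3 ▸ h2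
  have hN : ∀ N : ℕ, N * ‖h.eval (cuntzSeq s)‖ ≤ N * q.val + boundaryBound h := by
    intro N
    obtain ⟨G, hG⟩ := exists_eq_sum_of_gapForm_nonneg h0' (hform N)
    have := hs.norm_eval_le h (length_le_lengthBound h) N h0 hq0 (η := 0) G fun n hn m hm => by
      rw [hG n hn m hm, sub_self, norm_zero]
    simpa using this
  obtain ⟨N, h1⟩ := exists_nat_gt (boundaryBound h / (‖h.eval (cuntzSeq s)‖ - q.val))
  rw [div_lt_iff₀ (sub_pos.2 hq)] at h1
  linarith [hN N]

end Cert

theorem semiDecidable_upperCert : SemiDecidable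
    fun p : (RatStarPoly × RatCode) × ℕ × ℕ × RatCode × List (List GaussCode) =>
      UpperCert p.1.1 p.1.2 p.2 := by
  have c0 : Computable fun p : (((((RatStarPoly × RatCode) × ℕ × ℕ × RatCode ×
      List (List GaussCode)) × ℕ) × ℕ) × ℕ) =>
      cmul (cconj (gaussArray p.1.1.1.2.2.2.2 (2 ^ lengthBound p.1.1.1.1.1 + p.2)
        (2 ^ lengthBound p.1.1.1.1.1 + p.1.1.2)))
        (gaussArray p.1.1.1.2.2.2.2 (2 ^ lengthBound p.1.1.1.1.1 + p.2)
        (2 ^ lengthBound p.1.1.1.1.1 + p.1.2)) := by fun_prop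
  have c1 := computable_csum (m := fun p : ((((RatStarPoly × RatCode) × ℕ × ℕ × RatCode ×
      List (List GaussCode)) × ℕ) × ℕ) => levelCard p.1.1.1.1 p.1.1.2.1) (by fun_prop) c0
  have c2 : Computable fun p : ((((RatStarPoly × RatCode) × ℕ × ℕ × RatCode ×
      List (List GaussCode)) × ℕ) × ℕ) =>
      cadd (if 2 ^ lengthBound p.1.1.1.1 + p.1.2 = 2 ^ lengthBound p.1.1.1.1 + p.2 then
        cofRat p.1.1.2.2.2.1 else cofRat (RatCode.ofNat 0))
      (cneg (matCode p.1.1.1.1 (2 ^ lengthBound p.1.1.1.1 + p.1.2)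
        (2 ^ lengthBound p.1.1.1.1 + p.2))) := by fun_prop
  have c3 : Computable fun p : ((((RatStarPoly × RatCode) × ℕ × ℕ × RatCode ×
      List (List GaussCode)) × ℕ) × ℕ) =>
      RatCode.ltb (cnormSq (cadd (cadd
        (if 2 ^ lengthBound p.1.1.1.1 + p.1.2 = 2 ^ lengthBound p.1.1.1.1 + p.2 then
        cofRat p.1.1.2.2.2.1 else cofRat (RatCode.ofNat 0))
      (cneg (matCode p.1.1.1.1 (2 ^ lengthBound p.1.1.1.1 + p.1.2)
        (2 ^ lengthBound p.1.1.1.1 + p.2)))) (cneg (csum (levelCard p.1.1.1.1 p.1.1.2.1) fun k =>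
        cmul (cconj (gaussArray p.1.1.2.2.2.2 (2 ^ lengthBound p.1.1.1.1 + k)
        (2 ^ lengthBound p.1.1.1.1 + p.1.2)))
        (gaussArray p.1.1.2.2.2.2 (2 ^ lengthBound p.1.1.1.1 + k)
        (2 ^ lengthBound p.1.1.1.1 + p.2))))))
      (RatCode.mul (1, 0, p.1.1.2.2.1) (1, 0, p.1.1.2.2.1)) :=
    computable_ratCode_ltb (computable_cnormSq (computable_cadd c2 (computable_cneg c1)))
      (by fun_prop)
  have s1 := (SemiDecidable.of_computable c3).forall_lt
    (m := fun p : (((RatStarPoly × RatCode) × ℕ × ℕ × RatCode ×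
      List (List GaussCode)) × ℕ) => levelCard p.1.1.1 p.1.2.1) (by fun_prop)
  have s2 := s1.forall_lt
    (m := fun p : ((RatStarPoly × RatCode) × ℕ × ℕ × RatCode ×
      List (List GaussCode)) => levelCard p.1.1 p.2.1) (by fun_prop)
  have s3 := SemiDecidable.of_computable (g := fun p : ((RatStarPoly × RatCode) × ℕ × ℕ × RatCode ×
      List (List GaussCode)) => !(RatCode.ltb p.2.2.2.1 (RatCode.ofNat 0))) (by fun_prop)
  have s4 := SemiDecidable.of_computable (g := fun p : ((RatStarPoly × RatCode) × ℕ × ℕ × RatCode ×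
      List (List GaussCode)) => RatCode.ltb ((((RatCode.ofNat p.2.1).mul p.2.2.2.1).add
        ((RatCode.ofNat (levelCard p.1.1 p.2.1 ^ 2)).mul (1, 0, p.2.2.1))).add
          (RatCode.ofNat (boundaryBound p.1.1))) ((RatCode.ofNat p.2.1).mul p.1.2)) (by fun_prop)
  refine (s2.and (s3.and s4)).of_eq ?_
  rintro ⟨⟨h, q⟩, N, r, q', G⟩
  have hr : RatCode.val (1, 0, r) = 1 / ((r : ℝ) + 1) := by simp [RatCode.val]
  -- Moduli are compared through their squares, which are rational.
  have hsq : ∀ z : ℂ, ‖z‖ ^ 2 < 1 / ((r : ℝ) + 1) * (1 / ((r : ℝ) + 1)) ↔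
      ‖z‖ < 1 / ((r : ℝ) + 1) := fun z => by
    rw [← sq]
    exact pow_lt_pow_iff_left₀ (norm_nonneg _) (by positivity) two_ne_zero
  simp only [UpperCert, forall_polyLevels, RatCode.ltb_iff, val_cnormSq, RatCode.val_mul, hr, hsq,
    Bool.not_eq_true', Bool.eq_false_iff, ne_eq, RatCode.val_ofNat, RatCode.val_add, Nat.cast_zero,
    cval_cadd, cval_cneg, cval_csum, cval_cmul, cval_cconj, cval_matCode, apply_ite cval,
    cval_cofRat, Complex.ofReal_zero, sum_polyLevels, ← sub_eq_add_neg, Nat.cast_pow]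

theorem semiDecidable_lowerCert : SemiDecidable
    fun p : (RatStarPoly × RatCode) × ℕ × List GaussCode => LowerCert p.1.1 p.1.2 p.2 := by
  have c0 : Computable fun p : ((((RatStarPoly × RatCode) × ℕ × List GaussCode) × ℕ) × ℕ) =>
      cmul (cmul (cconj (gaussFun p.1.1.2.2 (2 ^ lengthBound p.1.1.1.1 + p.1.2)))
        (cadd (if 2 ^ lengthBound p.1.1.1.1 + p.1.2 = 2 ^ lengthBound p.1.1.1.1 + p.2 then
        cofRat p.1.1.1.2 else cofRat (RatCode.ofNat 0))
      (cneg (matCode p.1.1.1.1 (2 ^ lengthBound p.1.1.1.1 + p.1.2)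
        (2 ^ lengthBound p.1.1.1.1 + p.2)))))
        (gaussFun p.1.1.2.2 (2 ^ lengthBound p.1.1.1.1 + p.2)) := by fun_prop
  have c1 := computable_csum (m := fun p : (((RatStarPoly × RatCode) × ℕ × List GaussCode) × ℕ) =>
    levelCard p.1.1.1 p.1.2.1) (by fun_prop) c0
  have c2 := computable_csum (m := fun p : ((RatStarPoly × RatCode) × ℕ × List GaussCode) =>
    levelCard p.1.1 p.2.1) (by fun_prop) c1
  have s1 := SemiDecidable.of_computable (computable_ratCode_ltb (computable_fst c2)
    (computable_const (RatCode.ofNat 0)))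
  refine s1.of_eq ?_
  rintro ⟨⟨h, q⟩, N, l⟩
  have hre : ∀ c : GaussCode, c.1.val = (cval c).re := fun _ => rfl
  simp only [LowerCert, gapForm, RatCode.ltb_iff, hre, cval_csum, cval_cmul, cval_cconj, cval_cadd,
    cval_cneg, cval_matCode, apply_ite cval, cval_cofRat, RatCode.val_ofNat, Nat.cast_zero,
    Complex.ofReal_zero, sum_polyLevels, ← sub_eq_add_neg]

/-! ## The standard presentation of the Cuntz algebra is computable -/

theorem SemiDecidable.or {α : Type*} [Primcodable α] {p q : α → Prop} (hp : SemiDecidable p)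
    (hq : SemiDecidable q) : SemiDecidable fun a => p a ∨ q a := by
  obtain ⟨f, hf, h⟩ := hp
  obtain ⟨g, hg, h'⟩ := hq
  refine ⟨fun x => f x || g x, by fun_prop, fun a => ?_⟩
  simp [h, h', exists_or]

/-- Certificates concern p^*p and so bound ‖p‖². To pass to ‖p‖ the sign of the rational bound has
to be separated. -/
theorem ComputableReal.of_sq {α : Type*} [Primcodable α] {x : α → ℝ} (hx : ∀ a, 0 ≤ x a)
    (h1 : SemiDecidable fun p : α × RatCode => x p.1 ^ 2 < (p.2.mul p.2).val)
    (h2 : SemiDecidable fun p : α × RatCode => (p.2.mul p.2).val < x p.1 ^ 2) :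
    ComputableReal x := by
  have c1 : SemiDecidable fun p : α × RatCode => 0 < p.2.val :=
    (SemiDecidable.of_computable (g := fun p : α × RatCode => RatCode.ltb (RatCode.ofNat 0) p.2)
      (by fun_prop)).of_eq fun p => by rw [RatCode.ltb_iff, RatCode.val_ofNat, Nat.cast_zero]
  have c2 : SemiDecidable fun p : α × RatCode => p.2.val < 0 :=
    (SemiDecidable.of_computable (g := fun p : α × RatCode => RatCode.ltb p.2 (RatCode.ofNat 0))
      (by fun_prop)).of_eq fun p => by rw [RatCode.ltb_iff, RatCode.val_ofNat, Nat.cast_zero]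
  refine ComputableReal.of_semiDecidable ((c1.and h1).of_eq fun p => ?_)
    ((c2.or h2).of_eq fun p => ?_)
  · rw [RatCode.val_mul, ← sq]
    constructor
    · rintro ⟨h3, h4⟩
      exact lt_of_pow_lt_pow_left₀ 2 h3.le h4
    · intro h3
      exact ⟨(hx _).trans_lt h3, pow_lt_pow_left₀ h3 (hx _) two_ne_zero⟩
  · rw [RatCode.val_mul, ← sq]
    constructor
    · rintro (h3 | h3)
      · exact h3.trans_le (hx _)
      · exact lt_of_pow_lt_pow_left₀ 2 (hx _) h3
    · intro h3
      rcases lt_or_ge p.2.val 0 with h4 | h4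
      · exact Or.inl h4
      · exact Or.inr (pow_lt_pow_left₀ h3 h4 two_ne_zero)

section Presentation

variable {O : Type} [CStarAlgebra O] {s : Fin 2 → O}

/-- The universal property gives a map from O₂ to the closed subalgebra generated by the s_i.
Composed with the inclusion it fixes the generators, so by uniqueness it is the identity and the
subalgebra is everything. -/
theorem IsCuntzAlgebraTwo.isPresentation (hO : IsCuntzAlgebraTwo O s) :
    IsPresentation (cuntzSeq s) := by
  let B := (StarAlgebra.adjoin ℂ (Set.range (cuntzSeq s))).topologicalClosure
  have hmem : ∀ i, s i ∈ B := fun i => by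
    refine StarSubalgebra.le_topologicalClosure _ (StarAlgebra.subset_adjoin ℂ _ ⟨i, ?_⟩)
    fin_cases i <;> rfl
  have hB : IsClosed (B : Set O) := StarSubalgebra.isClosed_topologicalClosure _
  let _ : CStarAlgebra B := StarSubalgebra.cstarAlgebra B
  obtain ⟨φ, hφ, -⟩ := hO.existsUnique_hom B (fun i => ⟨s i, hmem i⟩) (by
    constructor
    · intro i j
      refine Subtype.ext ((hO.relations.1 i j).trans ?_)
      split_ifs <;> rfl
    · refine Subtype.ext (Eq.trans ?_ hO.relations.2)
      simp)
  have h1 : B.subtype.comp φ = StarAlgHom.id ℂ O :=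
    (hO.existsUnique_hom O s hO.relations).unique (fun i => by
      rw [StarAlgHom.comp_apply, hφ]; rfl) fun i => rfl
  refine eq_top_iff.2 fun x _ => ?_
  have h2 : B.subtype (φ x) = x := DFunLike.congr_fun h1 x
  rw [← h2]
  exact (φ x).2

/-- Certificates for p^*p exist exactly for the true strict bounds, so searching for them
semidecides both ‖p‖² < q² and q² < ‖p‖². -/
theorem IsCuntzAlgebraTwo.computableReal_norm (hO : IsCuntzAlgebraTwo O s) :
    ComputableReal fun p : RatStarPoly => ‖p.eval (cuntzSeq s)‖ := by
  let _ := CStarAlgebra.spectralOrder O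
  let _ := CStarAlgebra.spectralOrderedRing O
  have hsq : ∀ p : RatStarPoly, ‖p.eval (cuntzSeq s)‖ ^ 2 =
      ‖(p.adj.mul p).eval (cuntzSeq s)‖ := fun p => by
    rw [RatStarPoly.eval_mul, RatStarPoly.eval_adj, CStarRing.norm_star_mul_self, sq]
  have hpos : ∀ p : RatStarPoly, 0 ≤ (p.adj.mul p).eval (cuntzSeq s) := fun p => by
    rw [RatStarPoly.eval_mul, RatStarPoly.eval_adj]
    exact star_mul_self_nonneg _
  have hc : Computable fun p : RatStarPoly × RatCode => (p.1.adj.mul p.1, p.2.mul p.2) := by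
    fun_prop
  refine ComputableReal.of_sq (fun _ => norm_nonneg _)
    ((semiDecidable_upperCert.exists.comp hc).of_eq fun p => ?_)
    ((semiDecidable_lowerCert.exists.comp hc).of_eq fun p => ?_)
  · rw [hsq]
    constructor
    · rintro ⟨c, hc⟩
      exact hO.relations.norm_lt_of_upperCert (hpos p.1) hc
    · exact fun h => hO.exists_upperCert (isSelfAdjoint_eval_stdGen p.1) h
  · rw [hsq]
    constructor
    · rintro ⟨c, hc⟩
      exact hO.lt_norm_of_lowerCert hc
    · have hq : 0 ≤ (p.2.mul p.2).val := by
        rw [RatCode.val_mul]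
        exact mul_self_nonneg _
      exact fun h => hO.relations.exists_lowerCert (hpos p.1) (isSelfAdjoint_eval_stdGen p.1) hq h

end Presentation

theorem existsLocallyUniversalComputable_of_kirchbergEmbedding (h : KirchbergEmbedding) :
    ExistsLocallyUniversalComputable := by
  obtain ⟨O, _, s, hO, hLU⟩ := h
  exact ⟨O, _, hLU, cuntzSeq s, hO.isPresentation, hO.computableReal_norm⟩

end KEP

end
theorem mainTheorem2 :
    (KEP.KirchbergEmbedding → KEP.ExistsLocallyUniversalComputable) ∧
    (KEP.ExistsLocallyUniversalComputable →
      ∀ δ : ℕ → ℝ, (∀ m, δ m ∈ Set.Icc (0 : ℝ) 1) → KEP.IsComputableRealSeq δ →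
        ∀ L ∈ KEP.MIPcoDeltaOp δ, REPred fun z : List Bool => z ∈ L) :=
  ⟨KEP.existsLocallyUniversalComputable_of_kirchbergEmbedding, fun h _ _ hδ _ hL =>
    KEP.rePred_of_existsLocallyUniversalComputable h hδ hL⟩
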